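/- Setting. Let $(\mathcal M,g)$ be a smooth oriented $4$-dimensional Lorentzian manifold with $\mathrm{Ric}(g)=0$, and let $\mathcal N\subset \mathcal M$ be a smooth null hypersurface emanating from a $2$-sphere $\mathcal S$ and ruled by affinely parametrized null geodesics with affine parameter $s\in[1,\infty)$, $\mathcal S=\{s=1\}$. Let $L$ be the null tangent field of $\mathcal N$ with $Ls=1$ and $D_LL=0$, and $\underline L$ the null field orthogonal to the level spheres $\mathcal S_s$ of $s$ with $g(L,\underline L)=-2$. Let $\not\!g$ be the induced metric on the $\mathcal S_s$ and, for $X,Y$ tangent to the $\mathcal S_s$, $$\chi(X,Y)=g(D_XL,Y),\quad \underline\chi(X,Y)=g(D_X\underline L,Y),\quad \zeta(X)=\tfrac12 g(D_XL,\underline L),$$ $$\alpha(X,Y)=\mathrm{Rm}(L,X,L,Y),\quad \beta(X)=\tfrac12\mathrm{Rm}(L,X,L,\underline L),\quad \underline\beta(X)=\tfrac12\mathrm{Rm}(\underline L,X,\underline L,L),$$ $$\rho=\tfrac14\mathrm{Rm}(L,\underline L,L,\underline L),\qquad \sigma=\tfrac14{}^\star\mathrm{Rm}(L,\underline L,L,\underline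 L),$$ where $\mathrm{Rm}(X,Y,Z,W)=g((D_ZD_W-D_WD_Z-D_{[Z,W]})Y,X)$ and ${}^\star\mathrm{Rm}$ is its left Hodge dual. The mass aspect function is $\mu=-\not\!g^{ab}\not\!\nabla_a\zeta_b-\rho+\frac12\langle\hat\chi,\hat{\underline\chi}\rangle_{\not g}$, where hats denote trace-free parts. Let $m_{\rm S}\in\mathbb R$, $t=1-s^{-1}$, $\gamma=s^{-2}\not\!g$, and $$H=\chi-s^{-1}\not\!g,\quad Z=s\zeta,\quad \underline H=s^{-1}\underline\chi+s^{-2}\Big(1-\frac{2m_{\rm S}}{s}\Big)\not\!g,$$ $$A=s^2\alpha,\quad B=s^3\beta,\quad R=s^3(\rho+i\sigma)+2m_{\rm S},\quad \underline B=s\underline\beta,\quad M=s^3\mu-2m_{\rm S}.$$ Let $\nabla,\Delta,\epsilon$ be the Levi-Civita connection, Laplacian and volume form of $\gamma$ on the level spheres (oriented so that $(X,Y)$ is positive iff $(X,Y,\underline L,L)$ is), ${}^\star\nabla_a w=\epsilon_{ac}\gamma^{cb}\nabla_b w$, $\operatorname{tr}$ the $\gamma$-trace, and $\nabla_t\Psi_{u_1\dots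 u_l}=\mathfrak L_t\Psi_{u_1\dots u_l}-\sum_i\gamma^{cd}H_{u_ic}\Psi_{u_1\hat d_iu_l}$, where $\mathfrak L_t$ is the Lie derivative along $d/dt$ and $u_1\hat d_iu_l$ means $u_1\dots u_l$ with $u_i$ replaced by $d$. Change of foliation. Let $v$ be a smooth function on $\mathcal S$, extended to be constant along the generators of $\mathcal N$, and let $s'$ be the affine parameter with $s'-1=e^{-v}(s-1)$, so that $L'=e^vL$. Primes denote the objects built in the same way from $s'$, with $t'=1-s'^{-1}$. Components are taken at the same point of $\mathcal N$, equal indices of primed and unprimed objects referring to the coordinate fields on the level sets of $s'$ and of $s$ obtained by transporting the same coordinates of $\mathcal S$ along the generators; these are related by $X'=X+(s-1)(Xv)L$. In this way a $t'$-horizontal field induces a $t$-horizontal field, denoted by the same symbol. For $k\in\mathbb Z$ put $\mathcal B_k=[1+s^{-1}(e^v-1)]^k$ and $\mathcal C_k=s(\mathcal B_k-1)$. Proposition. On $\mathcal N$: $$H'_{ab}=e^v(H_{ab}-\mathcal C_{-1}\gamma_{ab}),\qquad Z'_a=e^{-v}\mathcal B_1(Z_a+t\gamma^{bc}\nabla_bv\,H_{ac}-\nabla_av),$$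 $$\begin{aligned}\underline H'_{ab}={}&\mathcal B_{-1}[\underline H_{ab}+2t\nabla_{ab}v+(e^{2v}-1+s^{-1}e^{2v}\mathcal C_{-1})\gamma_{ab}]\\&+2m_{\rm S}s^{-1}e^{3v}\mathcal B_{-1}[(e^{-3v}-1)-s^{-1}\mathcal C_{-1}(1+\mathcal B_{-1})]\gamma_{ab}\\&+\mathcal B_{-1}[t^2\gamma^{cd}\nabla_cv\nabla_dv\,\gamma_{ab}-2t(1-2s^{-1})\nabla_av\nabla_bv]\\&+\mathcal B_{-1}s^{-1}t^2\gamma^{cd}\nabla_cv(\nabla_dv\,H_{ab}-2\nabla_av\,H_{bd}-2\nabla_bv\,H_{ad})\\&-2\mathcal B_{-1}s^{-1}t(\nabla_av\,Z_b+\nabla_bv\,Z_a),\end{aligned}$$ $$A'_{ab}=\mathcal B_2A_{ab},\qquad B'_a=e^{-2v}\mathcal B_3(B_a+t\gamma^{bc}\nabla_bv\,A_{ac}),$$ $$\begin{aligned}R'={}&e^{-3v}\mathcal B_3R+2m_{\rm S}e^{-3v}(e^{3v}-1-s^{-1}\mathcal C_3)\\&+e^{-3v}\mathcal B_3s^{-1}t(\gamma^{ab}-i\epsilon^{ab})\nabla_av(2B_b+t\gamma^{cd}\nabla_cv\,A_{bd}),\end{aligned}$$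 $$\begin{aligned}\underline B'_a={}&e^{-2v}\mathcal B_1\underline B_a+e^{-2v}\mathcal B_1s^{-1}t[3\nabla_av(\operatorname{Re}R-2m_{\rm S})-3\,{}^\star\nabla_av\operatorname{Im}R]\\&+e^{-2v}\mathcal B_1s^{-2}t^2\nabla_bv[\gamma^{bc}(4\nabla_av\,B_c-\nabla_cv\,B_a)+2\epsilon^{bc}\,{}^\star\nabla_av\,B_c]\\&+e^{-2v}\mathcal B_1s^{-2}t^3\gamma^{bd}\gamma^{ce}\nabla_bv\nabla_cv(2\nabla_av\,A_{de}-\nabla_ev\,A_{ad}),\end{aligned}$$ and, for every $t'$-horizontal covariant tensor field $\Psi'$ of rank $l$, $$\begin{aligned}\nabla'_a\Psi'_{u_1\dots u_l}={}&\nabla_a\Psi'_{u_1\dots u_l}+s^{-1}t\nabla_av\,\nabla_t\Psi'_{u_1\dots u_l}-l\,t\nabla_av\,\Psi'_{u_1\dots u_l}\\&-s^{-1}t\gamma^{cd}\sum_{i=1}^l(\nabla_{u_i}v\,H_{da}-\nabla_dv\,H_{au_i})\Psi'_{u_1\hat c_iu_l}\\&-t\sum_{i=1}^l(\nabla_{u_i}v\,\Psi'_{u_1\hat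 a_iu_l}-\gamma^{cd}\nabla_dv\,\gamma_{au_i}\Psi'_{u_1\hat c_iu_l}).\end{aligned}$$ Corollary. On the initial sphere $\mathcal S=\{t=0\}=\{t'=0\}$: $$H'_{ab}=e^vH_{ab}+(e^v-1)\gamma_{ab},\qquad Z'_a=Z_a-\nabla_av,\qquad \underline H'_{ab}=e^{-v}\underline H_{ab}+(1-2m_{\rm S})(1-e^{-v})\gamma_{ab},$$ $$\nabla'_a(\operatorname{tr}'H')=e^v\nabla_a(\operatorname{tr}H)+e^v\nabla_av\operatorname{tr}H+2e^v\nabla_av,\qquad M'=M+\Delta v.$$ -/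

import Mathlib

open scoped Manifold ContDiff

noncomputable section

/-! ### Tensor calculus in coordinates -/

/-- Partial derivative `∂_i h` on coordinate space. -/
def pd {n : ℕ} (i : Fin n) (h : EuclideanSpace ℝ (Fin n) → ℝ)
    (x : EuclideanSpace ℝ (Fin n)) : ℝ :=
  fderiv ℝ h x (EuclideanSpace.single i 1)

/-- Christoffel symbols `Γ^c_{ab}` of the metric with components `G`. -/
def christoffel {n : ℕ} (G : EuclideanSpace ℝ (Fin n) → Matrix (Fin n) (Fin n) ℝ)
    (x : EuclideanSpace ℝ (Fin n)) (c a b : Fin n) : ℝ :=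
  (1 / 2) * ∑ d, (G x)⁻¹ c d *
    (pd a (fun y => G y d b) x + pd b (fun y => G y d a) x - pd d (fun y => G y a b) x)

/-- Curvature `R^τ_{νκλ}`, where `(D_κ D_λ - D_λ D_κ) ∂_ν = R^τ_{νκλ} ∂_τ`. -/
def riemannUp {n : ℕ} (G : EuclideanSpace ℝ (Fin n) → Matrix (Fin n) (Fin n) ℝ)
    (x : EuclideanSpace ℝ (Fin n)) (τ ν κ l : Fin n) : ℝ :=
  pd κ (fun y => christoffel G y τ l ν) x - pd l (fun y => christoffel G y τ κ ν) x
    + ∑ θ, (christoffel G x τ κ θ * christoffel G x θ l ν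
        - christoffel G x τ l θ * christoffel G x θ κ ν)

/-- Curvature `R_{μνκλ} = g_{μτ} R^τ_{νκλ}`, that is `R(X,Y,Z,W) = g(R(Z,W)Y, X)`.  With this sign,
`R(X,Y,X,Y) > 0` on a round sphere, and `R(L,L̲,L,L̲)/4 = -2m/r³` in Schwarzschild. -/
def riemann {n : ℕ} (G : EuclideanSpace ℝ (Fin n) → Matrix (Fin n) (Fin n) ℝ)
    (x : EuclideanSpace ℝ (Fin n)) (μ ν κ l : Fin n) : ℝ :=
  ∑ τ, G x μ τ * riemannUp G x τ ν κ l

/-- Ricci curvature `Ric_{νλ} = R^τ_{ντλ}`. -/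
def ricci {n : ℕ} (G : EuclideanSpace ℝ (Fin n) → Matrix (Fin n) (Fin n) ℝ)
    (x : EuclideanSpace ℝ (Fin n)) (ν l : Fin n) : ℝ :=
  ∑ τ, riemannUp G x τ ν τ l

/-! ### Vacuum spacetimes -/

section Spacetime

variable {M : Type*} [TopologicalSpace M] [ChartedSpace (EuclideanSpace ℝ (Fin 4)) M]

/-- Coordinate vector field `∂_μ` of the chart `φ` at the point with coordinates `y`. -/
def coordVec (φ : OpenPartialHomeomorph M (EuclideanSpace ℝ (Fin 4)))
    (y : EuclideanSpace ℝ (Fin 4)) (μ : Fin 4) : TangentSpace (𝓡 4) (φ.symm y) :=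
  mfderiv 𝓘(ℝ, EuclideanSpace ℝ (Fin 4)) (𝓡 4) φ.symm y
    (EuclideanSpace.single μ (1 : ℝ) : EuclideanSpace ℝ (Fin 4))

/-- Components `g_{μν}` in the chart `φ`, as functions of the coordinates. -/
def metricComp (g : ∀ p : M, LinearMap.BilinForm ℝ (TangentSpace (𝓡 4) p))
    (φ : OpenPartialHomeomorph M (EuclideanSpace ℝ (Fin 4)))
    (y : EuclideanSpace ℝ (Fin 4)) : Matrix (Fin 4) (Fin 4) ℝ :=
  fun μ ν => g (φ.symm y) (coordVec φ y μ) (coordVec φ y ν)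

/-- Components of a 4-form in the chart `φ`. -/
def volComp (vol : ∀ p : M, (TangentSpace (𝓡 4) p) [⋀^Fin 4]→ₗ[ℝ] ℝ)
    (φ : OpenPartialHomeomorph M (EuclideanSpace ℝ (Fin 4)))
    (y : EuclideanSpace ℝ (Fin 4)) (μ ν κ l : Fin 4) : ℝ :=
  vol (φ.symm y) ![coordVec φ y μ, coordVec φ y ν, coordVec φ y κ, coordVec φ y l]

/-- `e` is an orthonormal frame for `g`, with `e 0` timelike; signature `(-,+,+,+)`. -/
def IsLorentzFrame {V : Type*} [AddCommGroup V] [Module ℝ V]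
    (g : LinearMap.BilinForm ℝ V) (e : Fin 4 → V) : Prop :=
  ∀ i j, g (e i) (e j) = if i = j then (if i = 0 then -1 else 1) else 0

end Spacetime

/-- A smooth, oriented, Einstein-vacuum Lorentzian structure on the 4-manifold `M`. -/
structure VacuumSpacetime (M : Type*) [TopologicalSpace M]
    [ChartedSpace (EuclideanSpace ℝ (Fin 4)) M] [IsManifold (𝓡 4) ∞ M] where
  /-- the Lorentzian metric -/
  metric : ∀ p : M, LinearMap.BilinForm ℝ (TangentSpace (𝓡 4) p)
  symm : ∀ p X Y, metric p X Y = metric p Y X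
  lorentz : ∀ p, ∃ e : Fin 4 → TangentSpace (𝓡 4) p, IsLorentzFrame (metric p) e
  smooth : ∀ φ ∈ IsManifold.maximalAtlas (𝓡 4) ∞ M, ∀ μ ν,
    ContDiffOn ℝ ∞ (fun y => metricComp metric φ y μ ν) φ.target
  /-- the volume form, which fixes the orientation -/
  vol : ∀ p : M, (TangentSpace (𝓡 4) p) [⋀^Fin 4]→ₗ[ℝ] ℝ
  vol_unit : ∀ p e, IsLorentzFrame (metric p) e → |vol p e| = 1
  vol_smooth : ∀ φ ∈ IsManifold.maximalAtlas (𝓡 4) ∞ M, ∀ μ ν κ l,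
    ContDiffOn ℝ ∞ (fun y => volComp vol φ y μ ν κ l) φ.target
  /-- the Einstein vacuum equations -/
  vacuum : ∀ φ ∈ IsManifold.maximalAtlas (𝓡 4) ∞ M, ∀ y ∈ φ.target, ∀ μ ν,
    ricci (metricComp metric φ) y μ ν = 0

/-! ### A parametrized hypersurface in coordinates -/

/-- Coordinate expression of a foliated hypersurface: `G`, `vol` are the components of the spacetime
metric and volume form in a chart of the spacetime, and `f x s` are the coordinates of the point of
parameter `s` on the generator with transported coordinates `x = (x¹, x²)`. -/
structure ConeCoords where
  G : EuclideanSpace ℝ (Fin 4) → Matrix (Fin 4) (Fin 4) ℝ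
  vol : EuclideanSpace ℝ (Fin 4) → Fin 4 → Fin 4 → Fin 4 → Fin 4 → ℝ
  f : EuclideanSpace ℝ (Fin 2) → ℝ → EuclideanSpace ℝ (Fin 4)

namespace ConeCoords

variable (K : ConeCoords)

/-! #### Null frame -/

/-- The tangent field `L = ∂_s` of the generators. -/
def L (x : EuclideanSpace ℝ (Fin 2)) (s : ℝ) : Fin 4 → ℝ :=
  fun μ => deriv (fun σ => K.f x σ μ) s

/-- The transported coordinate vector fields `e_a`, tangent to the level sets of `s`. -/
def e (a : Fin 2) (x : EuclideanSpace ℝ (Fin 2)) (s : ℝ) : Fin 4 → ℝ :=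
  fun μ => pd a (fun y => K.f y s μ) x

/-- The spacetime metric `g(V, W)` at the point of parameters `(x, s)`. -/
def ip (x : EuclideanSpace ℝ (Fin 2)) (s : ℝ) (V W : Fin 4 → ℝ) : ℝ :=
  ∑ μ, ∑ ν, K.G (K.f x s) μ ν * V μ * W ν

/-- Spacetime covariant derivative `D_{e_a} V` of a vector field along the hypersurface. -/
def covE (a : Fin 2) (V : EuclideanSpace ℝ (Fin 2) → ℝ → Fin 4 → ℝ)
    (x : EuclideanSpace ℝ (Fin 2)) (s : ℝ) : Fin 4 → ℝ :=
  fun μ => pd a (fun y => V y s μ) x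
    + ∑ ν, ∑ l, christoffel K.G (K.f x s) μ ν l * K.e a x s ν * V x s l

/-- Spacetime covariant derivative `D_L V` of a vector field along the hypersurface. -/
def covL (V : EuclideanSpace ℝ (Fin 2) → ℝ → Fin 4 → ℝ)
    (x : EuclideanSpace ℝ (Fin 2)) (s : ℝ) : Fin 4 → ℝ :=
  fun μ => deriv (fun σ => V x σ μ) s
    + ∑ ν, ∑ l, christoffel K.G (K.f x s) μ ν l * K.L x s ν * V x s l

/-- `V` is null, orthogonal to the level set of `s`, and `g(L, V) = -2`. -/
def IsConjugate (x : EuclideanSpace ℝ (Fin 2)) (s : ℝ) (V : Fin 4 → ℝ) : Prop :=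
  K.ip x s V V = 0 ∧ (∀ a, K.ip x s V (K.e a x s) = 0) ∧ K.ip x s (K.L x s) V = -2

/-- The conjugate null vector field `L̲`: the unique vector satisfying `IsConjugate`. -/
def Lbar (x : EuclideanSpace ℝ (Fin 2)) (s : ℝ) : Fin 4 → ℝ :=
  Classical.epsilon (K.IsConjugate x s)

/-! #### Physical quantities -/

/-- The induced metric on the level sets of `s`. -/
def mind (s : ℝ) (x : EuclideanSpace ℝ (Fin 2)) : Matrix (Fin 2) (Fin 2) ℝ :=
  fun a b => K.ip x s (K.e a x s) (K.e b x s)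

def chi (x : EuclideanSpace ℝ (Fin 2)) (s : ℝ) (a b : Fin 2) : ℝ :=
  K.ip x s (K.covE a K.L x s) (K.e b x s)

def chibar (x : EuclideanSpace ℝ (Fin 2)) (s : ℝ) (a b : Fin 2) : ℝ :=
  K.ip x s (K.covE a K.Lbar x s) (K.e b x s)

def zeta (x : EuclideanSpace ℝ (Fin 2)) (s : ℝ) (a : Fin 2) : ℝ :=
  (1 / 2) * K.ip x s (K.covE a K.L x s) (K.Lbar x s)

/-- The spacetime curvature `R(V₁, V₂, V₃, V₄)`. -/
def Rm (x : EuclideanSpace ℝ (Fin 2)) (s : ℝ) (V₁ V₂ V₃ V₄ : Fin 4 → ℝ) : ℝ :=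
  ∑ μ, ∑ ν, ∑ κ, ∑ l, riemann K.G (K.f x s) μ ν κ l * V₁ μ * V₂ ν * V₃ κ * V₄ l

/-- The left Hodge dual `⋆R_{μνκλ} = ½ vol_{μν}{}^{θτ} R_{θτκλ}`, evaluated on four vectors. -/
def starRm (x : EuclideanSpace ℝ (Fin 2)) (s : ℝ) (V₁ V₂ V₃ V₄ : Fin 4 → ℝ) : ℝ :=
  ∑ μ, ∑ ν, ∑ κ, ∑ l,
    ((1 / 2) * ∑ θ, ∑ τ, ∑ θ', ∑ τ', K.vol (K.f x s) μ ν θ' τ' *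
      (K.G (K.f x s))⁻¹ θ' θ * (K.G (K.f x s))⁻¹ τ' τ * riemann K.G (K.f x s) θ τ κ l)
    * V₁ μ * V₂ ν * V₃ κ * V₄ l

def alpha (x : EuclideanSpace ℝ (Fin 2)) (s : ℝ) (a b : Fin 2) : ℝ :=
  K.Rm x s (K.L x s) (K.e a x s) (K.L x s) (K.e b x s)

def beta (x : EuclideanSpace ℝ (Fin 2)) (s : ℝ) (a : Fin 2) : ℝ :=
  (1 / 2) * K.Rm x s (K.L x s) (K.e a x s) (K.L x s) (K.Lbar x s)

def betabar (x : EuclideanSpace ℝ (Fin 2)) (s : ℝ) (a : Fin 2) : ℝ :=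
  (1 / 2) * K.Rm x s (K.Lbar x s) (K.e a x s) (K.Lbar x s) (K.L x s)

def rho (x : EuclideanSpace ℝ (Fin 2)) (s : ℝ) : ℝ :=
  (1 / 4) * K.Rm x s (K.L x s) (K.Lbar x s) (K.L x s) (K.Lbar x s)

def sigma (x : EuclideanSpace ℝ (Fin 2)) (s : ℝ) : ℝ :=
  (1 / 4) * K.starRm x s (K.L x s) (K.Lbar x s) (K.L x s) (K.Lbar x s)

/-- Trace-free part of a 2-tensor with respect to the induced metric. -/
def traceless (T : Fin 2 → Fin 2 → ℝ) (x : EuclideanSpace ℝ (Fin 2)) (s : ℝ) (a b : Fin 2) : ℝ :=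
  T a b - (1 / 2) * (∑ c, ∑ d, (K.mind s x)⁻¹ c d * T c d) * K.mind s x a b

/-- The mass aspect function. -/
def massAspect (x : EuclideanSpace ℝ (Fin 2)) (s : ℝ) : ℝ :=
  -(∑ a, ∑ b, (K.mind s x)⁻¹ a b *
      (pd a (fun y => K.zeta y s b) x - ∑ c, christoffel (K.mind s) x c a b * K.zeta x s c))
    - K.rho x s
    + (1 / 2) * ∑ a, ∑ b, ∑ c, ∑ d, (K.mind s x)⁻¹ a c * (K.mind s x)⁻¹ b d *
        K.traceless (K.chi x s) x s a b * K.traceless (K.chibar x s) x s c d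

/-! #### Renormalized quantities.  Fields are written as functions of `s`; the renormalized
parameter is `t = 1 - 1/s`. -/

/-- `γ = s⁻² g̸`. -/
def gam (s : ℝ) (x : EuclideanSpace ℝ (Fin 2)) : Matrix (Fin 2) (Fin 2) ℝ :=
  fun a b => (s ^ 2)⁻¹ * K.mind s x a b

/-- `γ^{ab}`. -/
def gamInv (x : EuclideanSpace ℝ (Fin 2)) (s : ℝ) (a b : Fin 2) : ℝ := (K.gam s x)⁻¹ a b

/-- The volume form `ε_{ab}` of `γ`, the spheres being oriented so that a frame `(X, Y)` is positive
iff `(X, Y, L̲, L)` is positive in the spacetime. -/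
def eps (x : EuclideanSpace ℝ (Fin 2)) (s : ℝ) (a b : Fin 2) : ℝ :=
  Real.sign (∑ μ, ∑ ν, ∑ κ, ∑ l, K.vol (K.f x s) μ ν κ l *
      K.e 0 x s μ * K.e 1 x s ν * K.Lbar x s κ * K.L x s l)
    * Real.sqrt (K.gam s x).det * (!![0, 1; -1, 0] : Matrix (Fin 2) (Fin 2) ℝ) a b

/-- `ε^{ab}`, indices raised with `γ`. -/
def epsUp (x : EuclideanSpace ℝ (Fin 2)) (s : ℝ) (a b : Fin 2) : ℝ :=
  ∑ c, ∑ d, K.gamInv x s a c * K.gamInv x s b d * K.eps x s c d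

def H (x : EuclideanSpace ℝ (Fin 2)) (s : ℝ) (a b : Fin 2) : ℝ :=
  K.chi x s a b - s⁻¹ * K.mind s x a b

def Z (x : EuclideanSpace ℝ (Fin 2)) (s : ℝ) (a : Fin 2) : ℝ := s * K.zeta x s a

def Hbar (m : ℝ) (x : EuclideanSpace ℝ (Fin 2)) (s : ℝ) (a b : Fin 2) : ℝ :=
  s⁻¹ * K.chibar x s a b + (s ^ 2)⁻¹ * (1 - 2 * m / s) * K.mind s x a b

def A (x : EuclideanSpace ℝ (Fin 2)) (s : ℝ) (a b : Fin 2) : ℝ := s ^ 2 * K.alpha x s a b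

def B (x : EuclideanSpace ℝ (Fin 2)) (s : ℝ) (a : Fin 2) : ℝ := s ^ 3 * K.beta x s a

def R (m : ℝ) (x : EuclideanSpace ℝ (Fin 2)) (s : ℝ) : ℂ :=
  (s : ℂ) ^ 3 * ((K.rho x s : ℂ) + Complex.I * (K.sigma x s : ℂ)) + 2 * (m : ℂ)

def Bbar (x : EuclideanSpace ℝ (Fin 2)) (s : ℝ) (a : Fin 2) : ℝ := s * K.betabar x s a

/-- The renormalized mass aspect function. -/
def Mass (m : ℝ) (x : EuclideanSpace ℝ (Fin 2)) (s : ℝ) : ℝ := s ^ 3 * K.massAspect x s - 2 * m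

/-- `tr H = γ^{ab} H_{ab}`. -/
def trH (x : EuclideanSpace ℝ (Fin 2)) (s : ℝ) : ℝ := ∑ a, ∑ b, K.gamInv x s a b * K.H x s a b

/-- `∇_{ab} w` for a function `w` constant along the generators. -/
def hess (w : EuclideanSpace ℝ (Fin 2) → ℝ) (x : EuclideanSpace ℝ (Fin 2)) (s : ℝ)
    (a b : Fin 2) : ℝ :=
  pd a (pd b w) x - ∑ c, christoffel (K.gam s) x c a b * pd c w x

/-- `Δ w = γ^{ab} ∇_{ab} w`. -/
def lap (w : EuclideanSpace ℝ (Fin 2) → ℝ) (x : EuclideanSpace ℝ (Fin 2)) (s : ℝ) : ℝ :=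
  ∑ a, ∑ b, K.gamInv x s a b * K.hess w x s a b

/-- `⋆∇_a w = ε_{ac} γ^{cb} ∇_b w`. -/
def starGrad (w : EuclideanSpace ℝ (Fin 2) → ℝ) (x : EuclideanSpace ℝ (Fin 2)) (s : ℝ)
    (a : Fin 2) : ℝ :=
  ∑ c, ∑ b, K.eps x s a c * K.gamInv x s c b * pd b w x

/-- `∇_a Ψ_{u₁…u_l}`, for a horizontal covariant tensor field with components `Ψ u x s`. -/
def nabla {l : ℕ} (Ψ : (Fin l → Fin 2) → EuclideanSpace ℝ (Fin 2) → ℝ → ℝ) (a : Fin 2)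
    (u : Fin l → Fin 2) (x : EuclideanSpace ℝ (Fin 2)) (s : ℝ) : ℝ :=
  pd a (fun y => Ψ u y s) x
    - ∑ i, ∑ c, christoffel (K.gam s) x c a (u i) * Ψ (Function.update u i c) x s

/-- `∇_t Ψ_{u₁…u_l} = 𝔏_t Ψ_{u₁…u_l} - ∑_i γ^{cd} H_{u_i c} Ψ_{u₁ … d … u_l}`.  In transported
coordinates `𝔏_t` is `∂/∂t`, and `s = 1/(1-t)`. -/
def nablaT {l : ℕ} (Ψ : (Fin l → Fin 2) → EuclideanSpace ℝ (Fin 2) → ℝ → ℝ)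
    (u : Fin l → Fin 2) (x : EuclideanSpace ℝ (Fin 2)) (s : ℝ) : ℝ :=
  deriv (fun t : ℝ => Ψ u x (1 / (1 - t))) (1 - 1 / s)
    - ∑ i, ∑ c, ∑ d, K.gamInv x s c d * K.H x s (u i) c * Ψ (Function.update u i d) x s

end ConeCoords

/-! ### Infinite null cones and changes of foliation -/

section NullCone

variable {M : Type*} [TopologicalSpace M] [ChartedSpace (EuclideanSpace ℝ (Fin 4)) M]
  [IsManifold (𝓡 4) ∞ M]
  {S : Type*} [TopologicalSpace S] [ChartedSpace (EuclideanSpace ℝ (Fin 2)) S]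

/-- The map `F : S × ℝ → M` in a chart `φ` of `M` and a chart `ψ` of `S`, together with the metric
and the volume form of the spacetime in the chart `φ`. -/
def coneCoords (g : VacuumSpacetime M) (F : S × ℝ → M)
    (φ : OpenPartialHomeomorph M (EuclideanSpace ℝ (Fin 4)))
    (ψ : OpenPartialHomeomorph S (EuclideanSpace ℝ (Fin 2))) : ConeCoords where
  G := metricComp g.metric φ
  vol := volComp g.vol φ
  f := fun x s => φ (F (ψ.symm x, s))

/-- `F` parametrizes an infinite smooth null cone `N = F(S × [1, ∞))` emanating from the sphere
`F(S × {1})`, ruled by the affinely parametrized null geodesics `s ↦ F(ω, s)`.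
(As `N` may be extended slightly beyond its initial sphere along its generators, `F` is taken to be
smooth on an open neighbourhood of `S × [1, ∞)`.) -/
structure IsNullCone (g : VacuumSpacetime M) (F : S × ℝ → M) : Prop where
  sphere : Nonempty (S ≃ₘ⟮𝓡 2, 𝓡 2⟯ Metric.sphere (0 : EuclideanSpace ℝ (Fin 3)) 1)
  smooth : ∃ U : Set (S × ℝ), IsOpen U ∧ Set.univ ×ˢ Set.Ici (1 : ℝ) ⊆ U ∧
    ContMDiffOn ((𝓡 2).prod 𝓘(ℝ, ℝ)) (𝓡 4) ∞ F U
  embedding : Topology.IsEmbedding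
    (fun q : (Set.univ ×ˢ Set.Ici 1 : Set (S × ℝ)) => F q)
  immersion : ∀ φ ∈ IsManifold.maximalAtlas (𝓡 4) ∞ M, ∀ ψ ∈ IsManifold.maximalAtlas (𝓡 2) ∞ S,
    ∀ x ∈ ψ.target, ∀ s : ℝ, 1 ≤ s → F (ψ.symm x, s) ∈ φ.source →
      LinearIndependent ℝ ![(coneCoords g F φ ψ).e 0 x s, (coneCoords g F φ ψ).e 1 x s,
        (coneCoords g F φ ψ).L x s]
  /-- `L` is null and orthogonal to `N` -/
  null : ∀ φ ∈ IsManifold.maximalAtlas (𝓡 4) ∞ M, ∀ ψ ∈ IsManifold.maximalAtlas (𝓡 2) ∞ S,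
    ∀ x ∈ ψ.target, ∀ s : ℝ, 1 ≤ s → F (ψ.symm x, s) ∈ φ.source →
      (coneCoords g F φ ψ).ip x s ((coneCoords g F φ ψ).L x s) ((coneCoords g F φ ψ).L x s) = 0 ∧
      ∀ a, (coneCoords g F φ ψ).ip x s ((coneCoords g F φ ψ).L x s)
        ((coneCoords g F φ ψ).e a x s) = 0
  /-- `D_L L = 0` -/
  geodesic : ∀ φ ∈ IsManifold.maximalAtlas (𝓡 4) ∞ M, ∀ ψ ∈ IsManifold.maximalAtlas (𝓡 2) ∞ S,
    ∀ x ∈ ψ.target, ∀ s : ℝ, 1 ≤ s → F (ψ.symm x, s) ∈ φ.source →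
      (coneCoords g F φ ψ).covL (coneCoords g F φ ψ).L x s = 0

/-- The change of foliation with distortion function `v`: the same null cone, parametrized by the
new affine parameter `s'` with `s' - 1 = e^{-v} (s - 1)`.  Its tangent field is `L' = e^v L`. -/
def refoliate (F : S × ℝ → M) (v : S → ℝ) : S × ℝ → M :=
  fun q => F (q.1, 1 + Real.exp (v q.1) * (q.2 - 1))

end NullCone

/-- The coefficients `𝓑_k = [1 + s⁻¹ (e^v - 1)]^k`, where `w` is the value of `v`. -/
def coefB (w s : ℝ) (k : ℤ) : ℝ := (1 + s⁻¹ * (Real.exp w - 1)) ^ k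

/-- The coefficients `𝓒_k = s (𝓑_k - 1)`. -/
def coefC (w s : ℝ) (k : ℤ) : ℝ := s * (coefB w s k - 1)

end

/-!
The proof is a computation in the coordinates of a pair of charts, at one point of the cone, in
three layers.

*Algebra of null frames.* At a fixed point the change of foliation acts on the null frame by
`L' = e^v L`, `e'_a = e_a + y_a L` with `y_a = (s - 1) ∂_a v`, hence (`isNullConj_nullRotate`)
`L̲' = e^{-v} (L̲ + 2 Y^a e_a + y_a Y^a L)`, where `Y` is `y` with its index raised: the conjugate
null vector is unique (`NullTriple.isNullConj_unique`), so it suffices to check the defining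
relations. The curvature formulas then follow by expanding `Rm` multilinearly. The terms that are
not null components from the start are reduced to them by the vacuum equations and the symmetries of
the curvature tensor, which express every component through `α`, `β`, `ρ`, `σ`, `β̲` (the lemmas on
`IsVacuumCurvature`).

*Differentiation along the hypersurface.* The level sets of `s'` are graphs over those of `s`, so
that a derivative along `e'_a` is the derivative along `e_a + y_a L` of a field on the parameter
space (`IsNullAt.tilt_covE`). Compatibility with the metric, vanishing torsion and `D_L L = 0` turn
the transformed frame into the formulas for `χ'`, `ζ'`, `χ̲'` (`tilt_chi`, `tilt_zeta`,
`tilt_chibar`). The induced metric has the same components in both foliations (`tilt_mind`); its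
derivatives differ by `2 y_a χ`, which gives the difference of the Christoffel symbols
(`tilt_christoffel`) and the connection formula (`tilt_nabla`). Since `L̲` is defined by choice, it
is replaced near a point by an explicit smooth formula (`conj`, `Lbar_eq_conj`).

*Renormalization.* With `𝓑_k = (e^v s' / s)^k` (`coefB_eq`) the stated identities are identities
between rational functions. On the initial sphere `y = 0`; for the mass aspect function the only
term that changes is the divergence of `ζ' = ζ - dv`, because the factors `e^v` and `e^{-v}` of the
two shears cancel (`tilt_Mass_one`).

The hypotheses of the first two layers are collected in `ConeCoords.IsNullAt` and
`IsVacuumCurvature`; `IsNullCone.isNullAt` and `VacuumSpacetime.isVacuumCurvature` verify them in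
charts.
-/

open Topology Filter

noncomputable section

/-! ### Null frames -/

/-- The bilinear form with matrix `G`. -/
def bil (G : Matrix (Fin 4) (Fin 4) ℝ) (V W : Fin 4 → ℝ) : ℝ :=
  ∑ μ, ∑ ν, G μ ν * V μ * W ν

section bil

variable (G : Matrix (Fin 4) (Fin 4) ℝ) (U V W : Fin 4 → ℝ) (r : ℝ)

theorem bil_add_left : bil G (U + V) W = bil G U W + bil G V W := by
  simp only [bil, ← Finset.sum_add_distrib]
  exact Finset.sum_congr rfl fun _ _ => Finset.sum_congr rfl fun _ _ => by
    simp only [Pi.add_apply]; ring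

theorem bil_add_right : bil G U (V + W) = bil G U V + bil G U W := by
  simp only [bil, ← Finset.sum_add_distrib]
  exact Finset.sum_congr rfl fun _ _ => Finset.sum_congr rfl fun _ _ => by
    simp only [Pi.add_apply]; ring

theorem bil_smul_left : bil G (r • V) W = r * bil G V W := by
  simp only [bil, Finset.mul_sum]
  exact Finset.sum_congr rfl fun _ _ => Finset.sum_congr rfl fun _ _ => by
    simp only [Pi.smul_apply, smul_eq_mul]; ring

theorem bil_smul_right : bil G V (r • W) = r * bil G V W := by
  simp only [bil, Finset.mul_sum]
  exact Finset.sum_congr rfl fun _ _ => Finset.sum_congr rfl fun _ _ => by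
    simp only [Pi.smul_apply, smul_eq_mul]; ring

theorem bil_zero_right : bil G V 0 = 0 := by simp [bil]

variable {G} in
theorem bil_comm (hG : ∀ μ ν, G μ ν = G ν μ) : bil G V W = bil G W V := by
  simp only [bil]
  rw [Finset.sum_comm]
  exact Finset.sum_congr rfl fun _ _ => Finset.sum_congr rfl fun _ _ => by
    rw [hG]; ring

theorem bil_eq_dotProduct : bil G V W = V ⬝ᵥ G.mulVec W := by
  simp only [bil, dotProduct, Matrix.mulVec, Finset.mul_sum]
  exact Finset.sum_congr rfl fun _ _ => Finset.sum_congr rfl fun _ _ => by ring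

theorem gram_eq (E : Fin 4 → Fin 4 → ℝ) :
    Matrix.of E * G * (Matrix.of E).transpose = Matrix.of fun i j => bil G (E i) (E j) := by
  ext i j
  simp only [Matrix.mul_apply, Matrix.transpose_apply, Matrix.of_apply, bil, Finset.sum_mul]
  rw [Finset.sum_comm]
  exact Finset.sum_congr rfl fun _ _ => Finset.sum_congr rfl fun _ _ => by ring

theorem det_gram (E : Fin 4 → Fin 4 → ℝ) :
    (Matrix.of fun i j => bil G (E i) (E j)).det = (Matrix.of E).det ^ 2 * G.det := by
  rw [← gram_eq, Matrix.det_mul, Matrix.det_mul, Matrix.det_transpose]; ring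

end bil

/-- A null vector `L` and two vectors `e 0`, `e 1` orthogonal to it, spanning the tangent space of a
null hypersurface, for a scalar product with matrix `G` of Lorentzian sign. -/
structure NullTriple (G : Matrix (Fin 4) (Fin 4) ℝ) (e : Fin 2 → Fin 4 → ℝ) (L : Fin 4 → ℝ) :
    Prop where
  symm : ∀ μ ν, G μ ν = G ν μ
  det : G.det < 0
  null : bil G L L = 0
  orth : ∀ a, bil G L (e a) = 0
  indep : LinearIndependent ℝ ![e 0, e 1, L]

/-- The Gram matrix of `e 0`, `e 1`. -/
def gram2 (G : Matrix (Fin 4) (Fin 4) ℝ) (e : Fin 2 → Fin 4 → ℝ) : Matrix (Fin 2) (Fin 2) ℝ :=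
  fun a b => bil G (e a) (e b)

/-- `V` is null, orthogonal to `e 0`, `e 1`, and its product with `L` is `-2`. -/
structure IsNullConj (G : Matrix (Fin 4) (Fin 4) ℝ) (e : Fin 2 → Fin 4 → ℝ) (L V : Fin 4 → ℝ) :
    Prop where
  null : bil G V V = 0
  orth : ∀ a, bil G V (e a) = 0
  pair : bil G L V = -2

theorem det_fin_four {R : Type*} [CommRing R] (M : Matrix (Fin 4) (Fin 4) R) :
    M.det = M 0 0 * (M 1 1 * (M 2 2 * M 3 3 - M 2 3 * M 3 2)
        - M 1 2 * (M 2 1 * M 3 3 - M 2 3 * M 3 1) + M 1 3 * (M 2 1 * M 3 2 - M 2 2 * M 3 1))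
      - M 0 1 * (M 1 0 * (M 2 2 * M 3 3 - M 2 3 * M 3 2)
        - M 1 2 * (M 2 0 * M 3 3 - M 2 3 * M 3 0) + M 1 3 * (M 2 0 * M 3 2 - M 2 2 * M 3 0))
      + M 0 2 * (M 1 0 * (M 2 1 * M 3 3 - M 2 3 * M 3 1)
        - M 1 1 * (M 2 0 * M 3 3 - M 2 3 * M 3 0) + M 1 3 * (M 2 0 * M 3 1 - M 2 1 * M 3 0))
      - M 0 3 * (M 1 0 * (M 2 1 * M 3 2 - M 2 2 * M 3 1)
        - M 1 1 * (M 2 0 * M 3 2 - M 2 2 * M 3 0) + M 1 2 * (M 2 0 * M 3 1 - M 2 1 * M 3 0)) := by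
  simp [Matrix.det_succ_row_zero, Fin.sum_univ_succ, Fin.succAbove]
  ring

namespace NullTriple

variable {G : Matrix (Fin 4) (Fin 4) ℝ} {e : Fin 2 → Fin 4 → ℝ} {L : Fin 4 → ℝ}
  (h : NullTriple G e L)
include h

theorem L_ne_zero : L ≠ 0 := by
  simpa using h.indep.ne_zero 2

theorem comm (V W : Fin 4 → ℝ) : bil G V W = bil G W V := bil_comm V W h.symm

/-- Lowering the index of `L` gives the components of a vector transversal to the hypersurface. -/
theorem bil_lower_ne_zero : bil G L (G.mulVec L) ≠ 0 := by
  rw [h.comm, bil_eq_dotProduct]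
  intro h0
  have := dotProduct_self_eq_zero.1 h0
  exact h.L_ne_zero (Matrix.eq_zero_of_mulVec_eq_zero h.det.ne this)

theorem det_frame_ne_zero {N : Fin 4 → ℝ} (hN : bil G L N ≠ 0) :
    (Matrix.of ![e 0, e 1, N, L]).det ≠ 0 := by
  have hli : LinearIndependent ℝ ![e 0, e 1, N, L] := by
    rw [Fintype.linearIndependent_iff]
    intro c hc
    simp only [Fin.sum_univ_four, Matrix.cons_val] at hc
    have h1 := congrArg (bil G L) hc
    simp only [bil_add_right, bil_smul_right, h.orth, h.null, bil_zero_right] at h1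
    have h2 : c 2 = 0 := by simpa [hN] using h1
    have h3 := Fintype.linearIndependent_iff.1 h.indep ![c 0, c 1, c 3]
      (by simpa [Fin.sum_univ_three, h2] using hc)
    intro i
    fin_cases i
    · exact h3 0
    · exact h3 1
    · exact h2
    · exact h3 2
  have := (Matrix.linearIndependent_rows_iff_isUnit (A := Matrix.of ![e 0, e 1, N, L])).1 hli
  exact ((Matrix.isUnit_iff_isUnit_det _).1 this).ne_zero

/-- The Gram determinant of the frame `e 0`, `e 1`, `N`, `L`, computed in two ways. -/
theorem det_gram2_mul (N : Fin 4 → ℝ) :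
    (gram2 G e).det * bil G L N ^ 2 = - ((Matrix.of ![e 0, e 1, N, L]).det ^ 2 * G.det) := by
  rw [← det_gram, det_fin_four, Matrix.det_fin_two]
  simp [gram2, h.orth, h.null, h.comm (e 0) L, h.comm (e 1) L, h.comm N L]
  ring

/-- The induced metric on a section of a null hypersurface has positive determinant; this is where
the sign of `det G` enters. -/
theorem det_gram2_pos : 0 < (gram2 G e).det := by
  have h1 := h.det_gram2_mul (G.mulVec L)
  have h2 := h.bil_lower_ne_zero
  have h3 := h.det_frame_ne_zero h2
  have h4 : 0 < (gram2 G e).det * bil G L (G.mulVec L) ^ 2 := by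
    rw [h1]
    have := h.det
    have : 0 < (Matrix.of ![e 0, e 1, G.mulVec L, L]).det ^ 2 := by positivity
    nlinarith
  exact pos_of_mul_pos_left h4 (sq_nonneg _)

theorem gram2_symm (a b : Fin 2) : gram2 G e a b = gram2 G e b a := h.comm _ _

theorem inv_gram2_mul (b c : Fin 2) :
    ∑ a, (gram2 G e)⁻¹ c a * gram2 G e a b = if c = b then 1 else 0 := by
  have := Matrix.nonsing_inv_mul (gram2 G e) (h.det_gram2_pos.ne'.isUnit)
  have := congrFun (congrFun this c) b
  rwa [Matrix.mul_apply, Matrix.one_apply] at this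

/-- A vector orthogonal to the hypersurface is a multiple of `L`. -/
theorem eq_smul_of_orth {V : Fin 4 → ℝ} (h0 : bil G L V = 0) (ha : ∀ a, bil G (e a) V = 0) :
    ∃ r : ℝ, V = r • L := by
  set N := G.mulVec L
  have hN : bil G L N ≠ 0 := h.bil_lower_ne_zero
  set P := Matrix.of ![e 0, e 1, N, L]
  have hP : P.det ≠ 0 := h.det_frame_ne_zero hN
  refine ⟨bil G N V / bil G L N, ?_⟩
  -- the difference is orthogonal to the whole frame
  set W := V - (bil G N V / bil G L N) • L with hW
  have key : ∀ i, bil G (![e 0, e 1, N, L] i) W = 0 := by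
    have hs : W = V + (-(bil G N V / bil G L N)) • L := by rw [hW]; module
    intro i
    rw [hs, bil_add_right, bil_smul_right]
    fin_cases i
    · simp [ha, h.comm (e 0) L, h.orth]
    · simp [ha, h.comm (e 1) L, h.orth]
    · simp only [Fin.reduceFinMk, Matrix.cons_val]
      rw [h.comm N L]; field_simp; ring
    · simp [h0, h.null]
  have h1 : P.mulVec (G.mulVec W) = 0 := by
    ext i
    have := key i
    rw [bil_eq_dotProduct] at this
    exact this
  have h2 := Matrix.eq_zero_of_mulVec_eq_zero h.det.ne (Matrix.eq_zero_of_mulVec_eq_zero hP h1)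
  exact sub_eq_zero.1 h2

theorem isNullConj_unique {V W : Fin 4 → ℝ} (hV : IsNullConj G e L V) (hW : IsNullConj G e L W) : V = W := by
  obtain ⟨r, hr⟩ := h.eq_smul_of_orth (V := V + (-1 : ℝ) • W)
    (by rw [bil_add_right, bil_smul_right, hV.pair, hW.pair]; ring)
    (fun a => by rw [bil_add_right, bil_smul_right, h.comm, hV.orth, h.comm, hW.orth]; ring)
  have hVW : V = W + r • L := by rw [← hr]; module
  have := hV.null
  rw [hVW] at this
  simp only [bil_add_left, bil_add_right, bil_smul_left, bil_smul_right, hW.null, h.null,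
    h.comm W L, hW.pair] at this
  have : r = 0 := by linarith
  simpa [this] using hVW

end NullTriple

/-- The component orthogonal to `e 0`, `e 1` of the vector with components `L_μ = G_{μν} L^ν`. -/
def transversal (G : Matrix (Fin 4) (Fin 4) ℝ) (e : Fin 2 → Fin 4 → ℝ) (L : Fin 4 → ℝ) :
    Fin 4 → ℝ :=
  G.mulVec L + ∑ a, (-∑ b, (gram2 G e)⁻¹ a b * bil G (G.mulVec L) (e b)) • e a

/-- An explicit formula for the conjugate null vector. -/
def conjVec (G : Matrix (Fin 4) (Fin 4) ℝ) (e : Fin 2 → Fin 4 → ℝ) (L : Fin 4 → ℝ) : Fin 4 → ℝ :=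
  (-2 / bil G L (G.mulVec L)) • transversal G e L
    + (bil G (transversal G e L) (transversal G e L) / bil G L (G.mulVec L) ^ 2) • L

namespace NullTriple

variable {G : Matrix (Fin 4) (Fin 4) ℝ} {e : Fin 2 → Fin 4 → ℝ} {L : Fin 4 → ℝ}
  (h : NullTriple G e L)
include h

theorem isNullConj_conjVec : IsNullConj G e L (conjVec G e L) := by
  have hn := h.bil_lower_ne_zero
  have hLP : bil G L (transversal G e L) = bil G L (G.mulVec L) := by
    simp [transversal, bil_add_right, Fin.sum_univ_two, bil_smul_right, h.orth]
  have heP : ∀ a, bil G (transversal G e L) (e a) = 0 := by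
    intro a
    have hs := h.comm (e 1) (e 0)
    have hd := h.det_gram2_pos.ne'
    rw [Matrix.det_fin_two] at hd
    simp only [gram2, hs] at hd
    simp only [transversal, bil_add_left, Fin.sum_univ_two, bil_smul_left, Matrix.inv_def,
      Matrix.adjugate_fin_two, Matrix.det_fin_two, gram2, Ring.inverse_eq_inv', Matrix.smul_apply,
      Matrix.of_apply, smul_eq_mul, hs]
    generalize hD : bil G (e 0) (e 0) * bil G (e 1) (e 1) - bil G (e 0) (e 1) * bil G (e 0) (e 1)
      = D at hd
    fin_cases a <;> simp [hs] <;> field_simp <;> rw [← hD] <;> ring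
  generalize hP : transversal G e L = P at *
  generalize hq : bil G L (G.mulVec L) = n at *
  have hc : conjVec G e L = (-2 / n) • P + (bil G P P / n ^ 2) • L := by
    rw [conjVec, hP, hq]
  rw [hc]
  refine ⟨?_, fun a => ?_, ?_⟩
  · simp only [bil_add_left, bil_add_right, bil_smul_left, bil_smul_right, h.null, h.comm P L, hLP]
    field_simp; ring
  · simp [bil_add_left, bil_smul_left, h.orth, heP]
  · simp only [bil_add_right, bil_smul_right, h.null, hLP]
    field_simp; ring

end NullTriple

/-! ### Tensors of rank four and contractions in a null frame -/

/-- The quadrilinear form with components `T`. -/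
def quad (T : Fin 4 → Fin 4 → Fin 4 → Fin 4 → ℝ) (V₁ V₂ V₃ V₄ : Fin 4 → ℝ) : ℝ :=
  ∑ μ, ∑ ν, ∑ κ, ∑ l, T μ ν κ l * V₁ μ * V₂ ν * V₃ κ * V₄ l

theorem sum₄_congr {f g : Fin 4 → Fin 4 → Fin 4 → Fin 4 → ℝ} (h : ∀ μ ν κ l, f μ ν κ l = g μ ν κ l) :
    ∑ μ, ∑ ν, ∑ κ, ∑ l, f μ ν κ l = ∑ μ, ∑ ν, ∑ κ, ∑ l, g μ ν κ l := by
  simp only [h]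

section quad

variable (T : Fin 4 → Fin 4 → Fin 4 → Fin 4 → ℝ) (U V V₁ V₂ V₃ V₄ : Fin 4 → ℝ) (r : ℝ)

theorem quad_add₁ : quad T (U + V) V₂ V₃ V₄ = quad T U V₂ V₃ V₄ + quad T V V₂ V₃ V₄ := by
  simp only [quad, Pi.add_apply, mul_add, add_mul, Finset.sum_add_distrib]

theorem quad_add₂ : quad T V₁ (U + V) V₃ V₄ = quad T V₁ U V₃ V₄ + quad T V₁ V V₃ V₄ := by
  simp only [quad, Pi.add_apply, mul_add, add_mul, Finset.sum_add_distrib]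

theorem quad_add₃ : quad T V₁ V₂ (U + V) V₄ = quad T V₁ V₂ U V₄ + quad T V₁ V₂ V V₄ := by
  simp only [quad, Pi.add_apply, mul_add, add_mul, Finset.sum_add_distrib]

theorem quad_add₄ : quad T V₁ V₂ V₃ (U + V) = quad T V₁ V₂ V₃ U + quad T V₁ V₂ V₃ V := by
  simp only [quad, Pi.add_apply, mul_add, Finset.sum_add_distrib]

theorem quad_smul₁ : quad T (r • V₁) V₂ V₃ V₄ = r * quad T V₁ V₂ V₃ V₄ := by
  simp only [quad, Pi.smul_apply, smul_eq_mul, Finset.mul_sum]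
  exact sum₄_congr fun _ _ _ _ => by ring

theorem quad_smul₂ : quad T V₁ (r • V₂) V₃ V₄ = r * quad T V₁ V₂ V₃ V₄ := by
  simp only [quad, Pi.smul_apply, smul_eq_mul, Finset.mul_sum]
  exact sum₄_congr fun _ _ _ _ => by ring

theorem quad_smul₃ : quad T V₁ V₂ (r • V₃) V₄ = r * quad T V₁ V₂ V₃ V₄ := by
  simp only [quad, Pi.smul_apply, smul_eq_mul, Finset.mul_sum]
  exact sum₄_congr fun _ _ _ _ => by ring

theorem quad_smul₄ : quad T V₁ V₂ V₃ (r • V₄) = r * quad T V₁ V₂ V₃ V₄ := by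
  simp only [quad, Pi.smul_apply, smul_eq_mul, Finset.mul_sum]
  exact sum₄_congr fun _ _ _ _ => by ring

end quad

/-- A tensor with the algebraic symmetries of a Riemann tensor. -/
structure IsCurvatureTensor (T : Fin 4 → Fin 4 → Fin 4 → Fin 4 → ℝ) : Prop where
  anti₁₂ : ∀ μ ν κ l, T ν μ κ l = -T μ ν κ l
  anti₃₄ : ∀ μ ν κ l, T μ ν l κ = -T μ ν κ l
  cyclic : ∀ μ ν κ l, T μ ν κ l + T μ κ l ν + T μ l ν κ = 0

namespace IsCurvatureTensor

variable {T : Fin 4 → Fin 4 → Fin 4 → Fin 4 → ℝ} (h : IsCurvatureTensor T)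
include h

/-- The exchange symmetry follows from the other three. -/
theorem pair (μ ν κ l : Fin 4) : T κ l μ ν = T μ ν κ l := by
  have := h.cyclic μ ν κ l
  have := h.cyclic ν κ l μ
  have := h.cyclic κ l μ ν
  have := h.cyclic l μ ν κ
  have := h.anti₁₂ μ ν κ l
  have := h.anti₁₂ κ l μ ν
  have := h.anti₁₂ μ κ l ν
  have := h.anti₁₂ μ l ν κ
  have := h.anti₁₂ ν l κ μ
  have := h.anti₁₂ ν κ l μ
  have := h.anti₃₄ μ ν κ l
  have := h.anti₃₄ κ l μ ν
  have := h.anti₃₄ μ κ l ν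
  have := h.anti₃₄ μ l ν κ
  have := h.anti₃₄ ν l κ μ
  have := h.anti₃₄ ν κ l μ
  have := h.anti₃₄ κ ν μ l
  have := h.anti₃₄ l ν μ κ
  have := h.anti₃₄ κ μ ν l
  have := h.anti₃₄ l μ ν κ
  linarith

variable (V₁ V₂ V₃ V₄ : Fin 4 → ℝ)

theorem quad_anti₁₂ : quad T V₂ V₁ V₃ V₄ = -quad T V₁ V₂ V₃ V₄ := by
  simp only [quad, ← Finset.sum_neg_distrib]
  rw [Finset.sum_comm]
  exact sum₄_congr fun _ _ _ _ => by rw [h.anti₁₂]; ring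

theorem quad_anti₃₄ : quad T V₁ V₂ V₄ V₃ = -quad T V₁ V₂ V₃ V₄ := by
  simp only [quad, ← Finset.sum_neg_distrib]
  rw [Finset.sum_congr rfl fun μ _ => Finset.sum_congr rfl fun ν _ => Finset.sum_comm]
  exact sum₄_congr fun _ _ _ _ => by rw [h.anti₃₄]; ring

theorem quad_self₁₂ : quad T V₁ V₁ V₃ V₄ = 0 := by
  linarith [h.quad_anti₁₂ V₁ V₁ V₃ V₄]

theorem quad_self₃₄ : quad T V₁ V₂ V₃ V₃ = 0 := by
  linarith [h.quad_anti₃₄ V₁ V₂ V₃ V₃]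

theorem quad_pair : quad T V₃ V₄ V₁ V₂ = quad T V₁ V₂ V₃ V₄ := by
  have key : quad T V₃ V₄ V₁ V₂ = ∑ κ, ∑ l, ∑ μ, ∑ ν, T μ ν κ l * V₁ μ * V₂ ν * V₃ κ * V₄ l := by
    simp only [quad]
    exact sum₄_congr fun _ _ _ _ => by rw [h.pair]; ring
  rw [key, quad]
  rw [Finset.sum_congr rfl fun κ _ => Finset.sum_comm, Finset.sum_comm]
  refine Finset.sum_congr rfl fun μ _ => ?_
  rw [Finset.sum_congr rfl fun κ _ => Finset.sum_comm, Finset.sum_comm]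

theorem quad_cyclic :
    quad T V₁ V₂ V₃ V₄ + quad T V₁ V₃ V₄ V₂ + quad T V₁ V₄ V₂ V₃ = 0 := by
  have h1 : quad T V₁ V₃ V₄ V₂ = ∑ μ, ∑ ν, ∑ κ, ∑ l, T μ κ l ν * V₁ μ * V₂ ν * V₃ κ * V₄ l := by
    rw [quad]
    rw [Finset.sum_congr rfl fun μ _ => (Finset.sum_congr rfl fun κ _ => Finset.sum_comm).trans
      Finset.sum_comm]
    exact sum₄_congr fun _ _ _ _ => by ring
  have h2 : quad T V₁ V₄ V₂ V₃ = ∑ μ, ∑ ν, ∑ κ, ∑ l, T μ l ν κ * V₁ μ * V₂ ν * V₃ κ * V₄ l := by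
    rw [quad]
    rw [Finset.sum_congr rfl fun μ _ => Finset.sum_comm.trans
      (Finset.sum_congr rfl fun κ _ => Finset.sum_comm)]
    exact sum₄_congr fun _ _ _ _ => by ring
  rw [h1, h2, quad]
  simp only [← Finset.sum_add_distrib]
  refine Finset.sum_eq_zero fun μ _ => Finset.sum_eq_zero fun ν _ => Finset.sum_eq_zero fun κ _ =>
    Finset.sum_eq_zero fun l _ => ?_
  linear_combination (V₁ μ * V₂ ν * V₃ κ * V₄ l) * h.cyclic μ ν κ l

end IsCurvatureTensor

/-- The inverse of the Gram matrix of the frame `e 0`, `e 1`, `L̲`, `L`. -/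
def frameInv (G : Matrix (Fin 4) (Fin 4) ℝ) (e : Fin 2 → Fin 4 → ℝ) : Matrix (Fin 4) (Fin 4) ℝ :=
  !![(gram2 G e)⁻¹ 0 0, (gram2 G e)⁻¹ 0 1, 0, 0;
     (gram2 G e)⁻¹ 1 0, (gram2 G e)⁻¹ 1 1, 0, 0;
     0, 0, 0, -1 / 2;
     0, 0, -1 / 2, 0]

section Contraction

variable {G : Matrix (Fin 4) (Fin 4) ℝ} {e : Fin 2 → Fin 4 → ℝ} {L Lb : Fin 4 → ℝ}
  (h : NullTriple G e L) (hc : IsNullConj G e L Lb)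
include h hc

/-- The completeness relation of the null frame. -/
theorem inv_eq_frame :
    G⁻¹ = (Matrix.of ![e 0, e 1, Lb, L]).transpose * frameInv G e
      * Matrix.of ![e 0, e 1, Lb, L] := by
  set P := Matrix.of ![e 0, e 1, Lb, L] with hP
  have h1 : frameInv G e * (P * G * P.transpose) = 1 := by
    rw [hP, gram_eq]
    have k := fun b c => h.inv_gram2_mul b c
    simp only [Fin.sum_univ_two, gram2] at k
    have oe : ∀ a, bil G (e a) L = 0 := fun a => by rw [h.comm, h.orth]
    have ob : ∀ a, bil G (e a) Lb = 0 := fun a => by rw [h.comm, hc.orth]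
    have pr : bil G Lb L = -2 := by rw [h.comm, hc.pair]
    ext i j
    fin_cases i <;> fin_cases j <;>
      simp [Matrix.mul_apply, Fin.sum_univ_four, frameInv, h.orth, hc.orth, h.null, hc.null, oe, ob,
        pr, hc.pair] <;>
      first
        | exact (k _ _).trans (if_pos rfl)
        | exact (k _ _).trans (if_neg (by decide))
  have h2 : P.transpose * (frameInv G e * (P * G)) = 1 := by
    rw [← mul_eq_one_comm]
    simpa only [Matrix.mul_assoc] using h1
  exact Matrix.inv_eq_left_inv (by simpa only [Matrix.mul_assoc] using h2)

/-- Contraction of a 2-tensor with the inverse metric, in the null frame. -/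
theorem contract_eq (Φ : Matrix (Fin 4) (Fin 4) ℝ) :
    ∑ μ, ∑ ν, G⁻¹ μ ν * Φ μ ν =
      ∑ a, ∑ b, (gram2 G e)⁻¹ a b * bil Φ (e a) (e b) - (1 / 2) * (bil Φ Lb L + bil Φ L Lb) := by
  have h0 : ∀ A B : Matrix (Fin 4) (Fin 4) ℝ,
      ∑ μ, ∑ ν, A μ ν * B μ ν = (A.transpose * B).trace := fun A B => by
    simp only [Matrix.trace, Matrix.diag, Matrix.mul_apply, Matrix.transpose_apply]
    exact Finset.sum_comm
  rw [h0, inv_eq_frame h hc]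
  set P := Matrix.of ![e 0, e 1, Lb, L] with hP
  have : ((P.transpose * frameInv G e * P).transpose * Φ).trace
      = ((frameInv G e).transpose * (P * Φ * P.transpose)).trace := by
    simp only [Matrix.transpose_mul, Matrix.transpose_transpose]
    rw [← Matrix.mul_assoc, ← Matrix.mul_assoc, Matrix.trace_mul_comm _ P.transpose]
    simp only [Matrix.mul_assoc]
  rw [this, ← h0, hP, gram_eq]
  simp [Fin.sum_univ_four, Fin.sum_univ_two, frameInv]
  ring

/-- Full contraction of two antisymmetric 2-tensors, in the null frame. -/
theorem contract_contract_eq (Φ Ψ : Matrix (Fin 4) (Fin 4) ℝ)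
    (hΦ : ∀ V W, bil Φ W V = -bil Φ V W) (hΨ : ∀ V W, bil Ψ W V = -bil Ψ V W) :
    ∑ θ, ∑ τ, ∑ θ', ∑ τ', Φ θ' τ' * G⁻¹ θ' θ * G⁻¹ τ' τ * Ψ θ τ =
      2 * (gram2 G e).det⁻¹ * bil Φ (e 0) (e 1) * bil Ψ (e 0) (e 1)
      - ∑ a, ∑ b, (gram2 G e)⁻¹ a b * (bil Φ (e a) Lb * bil Ψ (e b) L
          + bil Φ (e a) L * bil Ψ (e b) Lb)
      - (1 / 2) * bil Φ Lb L * bil Ψ Lb L := by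
  have h0 : ∀ A B C D : Matrix (Fin 4) (Fin 4) ℝ,
      ∑ θ, ∑ τ, ∑ θ', ∑ τ', A θ' τ' * C θ' θ * D τ' τ * B θ τ
        = (A.transpose * C * B * D.transpose).trace := fun A B C D => by
    simp only [Matrix.trace, Matrix.diag, Matrix.mul_apply, Matrix.transpose_apply, Finset.sum_mul]
    rw [Finset.sum_congr rfl fun θ _ => Finset.sum_congr rfl fun τ _ => Finset.sum_comm]
    rw [Finset.sum_congr rfl fun θ _ => Finset.sum_comm, Finset.sum_comm]
    rw [Finset.sum_congr rfl fun τ' _ => Finset.sum_comm]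
    exact sum₄_congr fun _ _ _ _ => by ring
  have hG : ∀ E : Matrix (Fin 4) (Fin 4) ℝ, ∀ P : Matrix (Fin 4) (Fin 4) ℝ,
      (Φ.transpose * (P.transpose * E * P) * Ψ * (P.transpose * E * P).transpose).trace
      = ((P * Φ * P.transpose).transpose * E * (P * Ψ * P.transpose) * E.transpose).trace :=
    fun E P => by
      simp only [Matrix.transpose_mul, Matrix.transpose_transpose]
      rw [← Matrix.mul_assoc, ← Matrix.mul_assoc, Matrix.trace_mul_comm _ P]
      simp only [Matrix.mul_assoc]
  have hΦ0 : ∀ V, bil Φ V V = 0 := fun V => by linarith [hΦ V V]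
  have hΨ0 : ∀ V, bil Ψ V V = 0 := fun V => by linarith [hΨ V V]
  rw [h0, inv_eq_frame h hc, hG, ← h0, gram_eq, gram_eq]
  have hdet := h.det_gram2_pos.ne'
  have hi : (gram2 G e)⁻¹ 0 0 * (gram2 G e)⁻¹ 1 1 - (gram2 G e)⁻¹ 0 1 * (gram2 G e)⁻¹ 1 0
      = (gram2 G e).det⁻¹ := by
    rw [← Matrix.det_fin_two, Matrix.det_nonsing_inv, Ring.inverse_eq_inv']
  simp only [Fin.sum_univ_four, Fin.sum_univ_two, Matrix.of_apply, frameInv, Matrix.cons_val',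
    Matrix.cons_val, Matrix.cons_val_zero, Matrix.cons_val_one, mul_zero, zero_mul, add_zero,
    zero_add, hΦ0, hΨ0, hΦ (e 0) (e 1), hΨ (e 0) (e 1), hΦ (e 0) L, hΦ (e 1) L, hΨ (e 0) L,
    hΨ (e 1) L, hΦ (e 0) Lb, hΦ (e 1) Lb, hΨ (e 0) Lb, hΨ (e 1) Lb, hΦ Lb L, hΨ Lb L]
  linear_combination (2 * bil Φ (e 0) (e 1) * bil Ψ (e 0) (e 1)) * hi

end Contraction

/-! ### Vacuum curvature in a null frame -/

/-- The left Hodge dual of `T` with respect to the metric `G` and the 4-form `vol`. -/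
def starTensor (G : Matrix (Fin 4) (Fin 4) ℝ) (vol T : Fin 4 → Fin 4 → Fin 4 → Fin 4 → ℝ)
    (μ ν κ l : Fin 4) : ℝ :=
  (1 / 2) * ∑ θ, ∑ τ, ∑ θ', ∑ τ', vol μ ν θ' τ' * G⁻¹ θ' θ * G⁻¹ τ' τ * T θ τ κ l

theorem sum₄_comm (f : Fin 4 → Fin 4 → Fin 4 → Fin 4 → Fin 4 → Fin 4 → Fin 4 → Fin 4 → ℝ) :
    ∑ μ, ∑ ν, ∑ κ, ∑ l, ∑ θ, ∑ τ, ∑ θ', ∑ τ', f μ ν κ l θ τ θ' τ' =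
      ∑ θ, ∑ τ, ∑ θ', ∑ τ', ∑ μ, ∑ ν, ∑ κ, ∑ l, f μ ν κ l θ τ θ' τ' := by
  have h : ∀ g : Fin 4 → Fin 4 → Fin 4 → Fin 4 → ℝ,
      ∑ μ, ∑ ν, ∑ κ, ∑ l, g μ ν κ l = ∑ p : Fin 4 × Fin 4 × Fin 4 × Fin 4, g p.1 p.2.1 p.2.2.1 p.2.2.2 :=
    fun g => by simp only [Fintype.sum_prod_type]
  simp only [h]
  exact Finset.sum_comm

theorem quad_starTensor (G : Matrix (Fin 4) (Fin 4) ℝ)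
    (vol T : Fin 4 → Fin 4 → Fin 4 → Fin 4 → ℝ) (V₁ V₂ V₃ V₄ : Fin 4 → ℝ) :
    quad (starTensor G vol T) V₁ V₂ V₃ V₄ = (1 / 2) * ∑ θ, ∑ τ, ∑ θ', ∑ τ',
      (∑ μ, ∑ ν, vol μ ν θ' τ' * V₁ μ * V₂ ν) * G⁻¹ θ' θ * G⁻¹ τ' τ
        * (∑ κ, ∑ l, T θ τ κ l * V₃ κ * V₄ l) := by
  have h1 : quad (starTensor G vol T) V₁ V₂ V₃ V₄ = ∑ μ, ∑ ν, ∑ κ, ∑ l, ∑ θ, ∑ τ, ∑ θ', ∑ τ',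
      (1 / 2) * (vol μ ν θ' τ' * G⁻¹ θ' θ * G⁻¹ τ' τ * T θ τ κ l) * V₁ μ * V₂ ν * V₃ κ * V₄ l := by
    simp only [quad, starTensor, Finset.mul_sum, Finset.sum_mul]
  rw [h1, sum₄_comm, Finset.mul_sum]
  simp only [Finset.mul_sum, Finset.sum_mul]
  refine sum₄_congr fun θ τ θ' τ' => ?_
  -- the right-hand side lists `κ, l` before `μ, ν`
  rw [Finset.sum_congr rfl fun μ _ => Finset.sum_comm, Finset.sum_comm]
  refine Finset.sum_congr rfl fun κ _ => ?_
  rw [Finset.sum_congr rfl fun μ _ => Finset.sum_comm, Finset.sum_comm]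
  exact Finset.sum_congr rfl fun l _ => Finset.sum_congr rfl fun μ _ =>
    Finset.sum_congr rfl fun ν _ => by ring

/-- The value at a point of a metric, a unit volume form and a Ricci-flat curvature tensor. -/
structure IsVacuumCurvature (G : Matrix (Fin 4) (Fin 4) ℝ)
    (vol T : Fin 4 → Fin 4 → Fin 4 → Fin 4 → ℝ) : Prop extends IsCurvatureTensor T where
  ricci : ∀ ν l, ∑ κ, ∑ μ, G⁻¹ κ μ * T μ ν κ l = 0
  vol : ∃ c : ℝ, c ^ 2 = -G.det ∧
    ∀ V₁ V₂ V₃ V₄, quad vol V₁ V₂ V₃ V₄ = c * (Matrix.of ![V₁, V₂, V₃, V₄]).det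

namespace IsVacuumCurvature

variable {G : Matrix (Fin 4) (Fin 4) ℝ} {vol T : Fin 4 → Fin 4 → Fin 4 → Fin 4 → ℝ}
  {e : Fin 2 → Fin 4 → ℝ} {L Lb : Fin 4 → ℝ}
  (hT : IsVacuumCurvature G vol T)
include hT

theorem vol_swap₁₂ (V₁ V₂ V₃ V₄ : Fin 4 → ℝ) :
    quad vol V₂ V₁ V₃ V₄ = -quad vol V₁ V₂ V₃ V₄ := by
  obtain ⟨c, -, hv⟩ := hT.vol
  rw [hv, hv, det_fin_four, det_fin_four]
  simp only [Matrix.of_apply, Matrix.cons_val]; ring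

theorem vol_swap₂₃ (V₁ V₂ V₃ V₄ : Fin 4 → ℝ) :
    quad vol V₁ V₃ V₂ V₄ = -quad vol V₁ V₂ V₃ V₄ := by
  obtain ⟨c, -, hv⟩ := hT.vol
  rw [hv, hv, det_fin_four, det_fin_four]
  simp only [Matrix.of_apply, Matrix.cons_val]; ring

theorem vol_swap₃₄ (V₁ V₂ V₃ V₄ : Fin 4 → ℝ) :
    quad vol V₁ V₂ V₄ V₃ = -quad vol V₁ V₂ V₃ V₄ := by
  obtain ⟨c, -, hv⟩ := hT.vol
  rw [hv, hv, det_fin_four, det_fin_four]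
  simp only [Matrix.of_apply, Matrix.cons_val]; ring

theorem vol_self₁₂ (V W U : Fin 4 → ℝ) : quad vol V V W U = 0 := by
  linarith [hT.vol_swap₁₂ V V W U]

theorem vol_self₂₃ (V W U : Fin 4 → ℝ) : quad vol W V V U = 0 := by
  linarith [hT.vol_swap₂₃ W V V U]

theorem vol_self₃₄ (V W U : Fin 4 → ℝ) : quad vol W U V V = 0 := by
  linarith [hT.vol_swap₃₄ W U V V]

variable (h : NullTriple G e L) (hc : IsNullConj G e L Lb)
include h hc

/-- The area element of `span (e 0, e 1)` is half of `vol (e 0, e 1, L̲, L)`. -/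
theorem vol_sq : (quad vol (e 0) (e 1) Lb L / 2) ^ 2 = (gram2 G e).det := by
  obtain ⟨c, hc2, hv⟩ := hT.vol
  have h1 := h.det_gram2_mul Lb
  rw [hc.pair] at h1
  rw [hv]
  linear_combination (1 / 4) * (Matrix.of ![e 0, e 1, Lb, L]).det ^ 2 * hc2 - (1 / 4) * h1

theorem vol_ne_zero : quad vol (e 0) (e 1) Lb L ≠ 0 := by
  intro h0
  have := hT.vol_sq h hc
  rw [h0] at this
  exact h.det_gram2_pos.ne (by simpa using this)

omit hT hc in
theorem det_gram2_eq : (gram2 G e).det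
    = gram2 G e 0 0 * gram2 G e 1 1 - gram2 G e 0 1 * gram2 G e 0 1 := by
  rw [Matrix.det_fin_two, h.gram2_symm 1 0]

/-- Ricci-flatness in the null frame, multiplied by the determinant of the induced metric so that no
inverse matrix occurs. -/
theorem quad_ricci (V W : Fin 4 → ℝ) :
    gram2 G e 1 1 * quad T (e 0) V (e 0) W - gram2 G e 0 1 * quad T (e 0) V (e 1) W
      - gram2 G e 0 1 * quad T (e 1) V (e 0) W + gram2 G e 0 0 * quad T (e 1) V (e 1) W
      = (gram2 G e).det / 2 * (quad T L V Lb W + quad T Lb V L W) := by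
  have h1 := contract_eq h hc fun κ μ => ∑ ν, ∑ l, T μ ν κ l * V ν * W l
  have h2 : ∀ X Y, bil (fun κ μ => ∑ ν, ∑ l, T μ ν κ l * V ν * W l) X Y = quad T Y V X W := by
    intro X Y
    simp only [bil, quad, Finset.sum_mul]
    rw [Finset.sum_comm]
    refine Finset.sum_congr rfl fun μ _ => ?_
    rw [Finset.sum_comm]
    exact Finset.sum_congr rfl fun _ _ => Finset.sum_congr rfl fun _ _ =>
      Finset.sum_congr rfl fun _ _ => by ring
  have h3 : ∑ κ, ∑ μ, G⁻¹ κ μ * ∑ ν, ∑ l, T μ ν κ l * V ν * W l = 0 := by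
    have : ∑ κ, ∑ μ, G⁻¹ κ μ * ∑ ν, ∑ l, T μ ν κ l * V ν * W l
        = ∑ ν, ∑ l, (∑ κ, ∑ μ, G⁻¹ κ μ * T μ ν κ l) * V ν * W l := by
      simp only [Finset.mul_sum, Finset.sum_mul]
      rw [Finset.sum_congr rfl fun κ _ => Finset.sum_comm, Finset.sum_comm]
      refine Finset.sum_congr rfl fun ν _ => ?_
      rw [Finset.sum_congr rfl fun κ _ => Finset.sum_comm, Finset.sum_comm]
      exact Finset.sum_congr rfl fun _ _ => Finset.sum_congr rfl fun _ _ =>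
        Finset.sum_congr rfl fun _ _ => by ring
    simp [this, hT.ricci]
  rw [h3] at h1
  simp only [h2, Fin.sum_univ_two] at h1
  have hd := h.det_gram2_pos.ne'
  rw [Matrix.inv_def, Matrix.adjugate_fin_two, Ring.inverse_eq_inv'] at h1
  simp only [Matrix.smul_apply, smul_eq_mul, Matrix.of_apply, Matrix.cons_val',
    Matrix.cons_val_zero, Matrix.cons_val_one, Matrix.cons_val_fin_one, h.gram2_symm 1 0] at h1
  field_simp at h1
  linear_combination -(1 / 2) * h1

/-- In vacuum, the components with one entry `L` and three tangential entries reduce to `β`. -/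
theorem quad_L_tangent (a b c : Fin 2) : quad T L (e b) (e c) (e a) =
    (1 / 2) * (gram2 G e b c * quad T L (e a) L Lb - gram2 G e b a * quad T L (e c) L Lb) := by
  have hd := h.det_gram2_pos.ne'
  have hD := det_gram2_eq h
  have r0 := hT.quad_ricci h hc L (e 0)
  have r1 := hT.quad_ricci h hc L (e 1)
  have q0 : ∀ a W U, quad T (e a) L W U = -quad T L (e a) W U :=
    fun _ _ _ => hT.quad_anti₁₂ _ _ _ _
  have q3 : ∀ W U, quad T Lb L W U = -quad T L Lb W U := fun _ _ => hT.quad_anti₁₂ _ _ _ _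
  have q1 : ∀ V W, quad T V W (e 1) (e 0) = -quad T V W (e 0) (e 1) :=
    fun _ _ => hT.quad_anti₃₄ _ _ _ _
  have q2 : ∀ a, quad T L Lb L (e a) = quad T L (e a) L Lb := fun _ => hT.quad_pair _ _ _ _
  simp only [q0, q1, q2, q3, hT.quad_self₁₂, hT.quad_self₃₄] at r0 r1
  have x0 : quad T L (e 0) (e 0) (e 1) = (1 / 2) *
      (gram2 G e 0 0 * quad T L (e 1) L Lb - gram2 G e 0 1 * quad T L (e 0) L Lb) := by
    apply mul_left_cancel₀ hd
    linear_combination quad T L (e 0) (e 0) (e 1) * hD - gram2 G e 0 0 * r1 + gram2 G e 0 1 * r0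
  have x1 : quad T L (e 1) (e 0) (e 1) = (1 / 2) *
      (gram2 G e 0 1 * quad T L (e 1) L Lb - gram2 G e 1 1 * quad T L (e 0) L Lb) := by
    apply mul_left_cancel₀ hd
    linear_combination quad T L (e 1) (e 0) (e 1) * hD - gram2 G e 0 1 * r1 + gram2 G e 1 1 * r0
  have hs := h.gram2_symm 1 0
  fin_cases a <;> fin_cases b <;> fin_cases c <;>
    simp only [Fin.mk_one, Fin.zero_eta, q1, hT.quad_self₃₄, x0, x1, hs] <;> ring

/-- The left dual in the null frame. -/
theorem quad_star (V₁ V₂ V₃ V₄ : Fin 4 → ℝ) :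
    quad (starTensor G vol T) V₁ V₂ V₃ V₄ =
      (gram2 G e).det⁻¹ * quad vol V₁ V₂ (e 0) (e 1) * quad T (e 0) (e 1) V₃ V₄
      - (1 / 2) * ∑ a, ∑ b, (gram2 G e)⁻¹ a b *
          (quad vol V₁ V₂ (e a) Lb * quad T (e b) L V₃ V₄
            + quad vol V₁ V₂ (e a) L * quad T (e b) Lb V₃ V₄)
      - (1 / 4) * quad vol V₁ V₂ Lb L * quad T Lb L V₃ V₄ := by
  have h1 : ∀ X Y, bil (fun θ' τ' => ∑ μ, ∑ ν, vol μ ν θ' τ' * V₁ μ * V₂ ν) X Y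
      = quad vol V₁ V₂ X Y := by
    intro X Y
    simp only [bil, quad, Finset.sum_mul]
    rw [Finset.sum_congr rfl fun θ _ => Finset.sum_comm, Finset.sum_comm]
    refine Finset.sum_congr rfl fun μ _ => ?_
    rw [Finset.sum_congr rfl fun θ _ => Finset.sum_comm, Finset.sum_comm]
  have h2 : ∀ X Y, bil (fun θ τ => ∑ κ, ∑ l, T θ τ κ l * V₃ κ * V₄ l) X Y
      = quad T X Y V₃ V₄ := by
    intro X Y
    simp only [bil, quad, Finset.sum_mul]
    exact sum₄_congr fun _ _ _ _ => by ring
  rw [quad_starTensor]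
  rw [contract_contract_eq h hc (fun θ' τ' => ∑ μ, ∑ ν, vol μ ν θ' τ' * V₁ μ * V₂ ν)
    (fun θ τ => ∑ κ, ∑ l, T θ τ κ l * V₃ κ * V₄ l)
    (fun V W => by rw [h1, h1, hT.vol_swap₃₄]) (fun V W => by rw [h2, h2, hT.quad_anti₁₂])]
  simp only [h1, h2]
  ring

theorem quad_star_L_tangent (a : Fin 2) (V W : Fin 4 → ℝ) :
    quad (starTensor G vol T) L (e a) V W =
      (2 / quad vol (e 0) (e 1) Lb L) *
        (gram2 G e a 1 * quad T L (e 0) V W - gram2 G e a 0 * quad T L (e 1) V W) := by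
  have hv := hT.vol_ne_zero h hc
  have hsq := hT.vol_sq h hc
  have v1 : ∀ X Y Z, quad vol L X Y Z = -quad vol X Y Z L := fun X Y Z => by
    rw [hT.vol_swap₁₂, hT.vol_swap₂₃, hT.vol_swap₃₄]; ring
  have v2 : quad vol (e 1) (e 0) Lb L = -quad vol (e 0) (e 1) Lb L := hT.vol_swap₁₂ _ _ _ _
  have v4 : quad vol (e 1) (e 0) (e 1) L = 0 := by rw [hT.vol_swap₁₂, hT.vol_self₂₃, neg_zero]
  have q0 : ∀ a, quad T (e a) L V W = -quad T L (e a) V W := fun _ => hT.quad_anti₁₂ _ _ _ _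
  rw [hT.quad_star h hc]
  simp only [v1, hT.vol_self₃₄, q0, Fin.sum_univ_two,
    Matrix.inv_def, Matrix.adjugate_fin_two, Ring.inverse_eq_inv', Matrix.smul_apply, smul_eq_mul,
    Matrix.of_apply, Matrix.cons_val', Matrix.cons_val_zero, Matrix.cons_val_one,
    Matrix.cons_val_fin_one, ← hsq, h.gram2_symm 1 0]
  fin_cases a <;>
    simp only [Fin.mk_one, Fin.zero_eta, hT.vol_self₁₂, v2, v4, h.gram2_symm 1 0] <;>
    field_simp <;> ring

theorem quad_star_L_conj (V W : Fin 4 → ℝ) :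
    quad (starTensor G vol T) L Lb V W =
      -(4 / quad vol (e 0) (e 1) Lb L) * quad T (e 0) (e 1) V W := by
  have hv := hT.vol_ne_zero h hc
  have hsq := hT.vol_sq h hc
  have v1 : ∀ X Y Z, quad vol L X Y Z = -quad vol X Y Z L := fun X Y Z => by
    rw [hT.vol_swap₁₂, hT.vol_swap₂₃, hT.vol_swap₃₄]; ring
  have v2 : ∀ a b, quad vol Lb (e a) (e b) L = quad vol (e a) (e b) Lb L := fun a b => by
    rw [hT.vol_swap₁₂, hT.vol_swap₂₃]; ring
  have v3 : ∀ a, quad vol Lb (e a) Lb L = 0 := fun a => by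
    rw [hT.vol_swap₁₂, hT.vol_self₂₃]; ring
  rw [hT.quad_star h hc]
  simp only [v1, v2, v3, hT.vol_self₁₂, hT.vol_self₃₄, ← hsq, mul_zero, zero_mul, neg_zero,
    add_zero, Finset.sum_const_zero, sub_zero]
  field_simp
  ring

/-- The component `R(e 0, e 1, L, L̲)` is determined by `σ`. -/
theorem quad_tangent_mixed : quad T (e 0) (e 1) L Lb = -(quad vol (e 0) (e 1) Lb L / 4)
    * quad (starTensor G vol T) L Lb L Lb := by
  have := hT.vol_ne_zero h hc
  rw [hT.quad_star_L_conj h hc]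
  field_simp

/-- In vacuum, the components `R(L, e a, L̲, e b)` are determined by `ρ`, which gives the symmetric part,
and `σ`, which gives the antisymmetric part. -/
theorem quad_mixed (a b : Fin 2) : quad T L (e a) Lb (e b) =
    -(1 / 4) * gram2 G e a b * quad T L Lb L Lb
      + (1 / 2) * quad T (e a) (e b) L Lb := by
  have hd := h.det_gram2_pos.ne'
  have hD := det_gram2_eq h
  have r := fun a b => hT.quad_ricci h hc (e a) (e b)
  have r00 := r 0 0
  have r01 := r 0 1
  have r11 := r 1 1
  have rL := hT.quad_ricci h hc L Lb
  have q0 : ∀ a W U, quad T (e a) L W U = -quad T L (e a) W U :=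
    fun _ _ _ => hT.quad_anti₁₂ _ _ _ _
  have q1 : ∀ a b, quad T L (e a) (e b) Lb = -quad T L (e a) Lb (e b) :=
    fun _ _ => hT.quad_anti₃₄ _ _ _ _
  have q2 : ∀ W U, quad T (e 1) (e 0) W U = -quad T (e 0) (e 1) W U :=
    fun _ _ => hT.quad_anti₁₂ _ _ _ _
  have q3 : ∀ W U, quad T W U (e 1) (e 0) = -quad T W U (e 0) (e 1) :=
    fun _ _ => hT.quad_anti₃₄ _ _ _ _
  have q4 : ∀ W U, quad T Lb L W U = -quad T L Lb W U := fun _ _ => hT.quad_anti₁₂ _ _ _ _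
  have q5 : ∀ a b, quad T Lb (e a) L (e b) = quad T L (e b) Lb (e a) :=
    fun _ _ => hT.quad_pair _ _ _ _
  have q6 : ∀ a b, quad T L Lb (e a) (e b) = quad T (e a) (e b) L Lb :=
    fun _ _ => hT.quad_pair _ _ _ _
  have cyc := hT.quad_cyclic L (e 0) Lb (e 1)
  have q7 : quad T L (e 1) (e 0) Lb = -quad T L (e 1) Lb (e 0) := hT.quad_anti₃₄ _ _ _ _
  have q8 : quad T L Lb (e 1) (e 0) = -quad T (e 0) (e 1) L Lb := by rw [q3, q6]
  rw [q7, q8] at cyc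
  simp only [q0, q1, q2, q3, q4, q5, hT.quad_self₁₂, hT.quad_self₃₄] at r00 r01 r11 rL
  -- the sectional curvature of the plane spanned by `e 0`, `e 1`
  have k : quad T (e 0) (e 1) (e 0) (e 1)
      = -(1 / 4) * (gram2 G e).det * quad T L Lb L Lb := by
    apply mul_left_cancel₀ hd
    linear_combination quad T (e 0) (e 1) (e 0) (e 1) * hD
      + (1 / 2) * gram2 G e 1 1 * r00 + (1 / 2) * gram2 G e 0 0 * r11 - gram2 G e 0 1 * r01
      + (gram2 G e).det / 2 * rL
  have hs := h.gram2_symm 1 0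
  fin_cases a <;> fin_cases b <;> simp only [Fin.mk_one, Fin.zero_eta, hs, q2, hT.quad_self₁₂] <;>
    apply mul_left_cancel₀ hd
  · linear_combination gram2 G e 0 0 * k - r00
  · linear_combination gram2 G e 0 1 * k - r01 + (gram2 G e).det / 2 * cyc
  · linear_combination gram2 G e 0 1 * k - r01 - (gram2 G e).det / 2 * cyc
  · linear_combination gram2 G e 1 1 * k - r11

end IsVacuumCurvature

/-! ### Null rotations -/

/-- The null vector conjugate to `L` with respect to the tilted plane spanned by `e a + y a • L`,
where `y a = g (e a, e b) Y b`. -/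
def nullRotate (e : Fin 2 → Fin 4 → ℝ) (L Lb : Fin 4 → ℝ) (y Y : Fin 2 → ℝ) : Fin 4 → ℝ :=
  Lb + (2 * Y 0) • e 0 + (2 * Y 1) • e 1 + (y 0 * Y 0 + y 1 * Y 1) • L

section NullRotation

variable {G : Matrix (Fin 4) (Fin 4) ℝ} {e : Fin 2 → Fin 4 → ℝ} {L Lb : Fin 4 → ℝ}
  {y Y : Fin 2 → ℝ}

theorem NullTriple.rotate (h : NullTriple G e L) (y : Fin 2 → ℝ) {c : ℝ} (hc : c ≠ 0) :
    NullTriple G (fun a => e a + y a • L) (c • L) where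
  symm := h.symm
  det := h.det
  null := by rw [bil_smul_left, bil_smul_right, h.null]; ring
  orth a := by rw [bil_smul_left, bil_add_right, bil_smul_right, h.null, h.orth]; ring
  indep := by
    have hi := Fintype.linearIndependent_iff.1 h.indep
    rw [Fintype.linearIndependent_iff]
    intro g hg
    have := hi ![g 0, g 1, g 0 * y 0 + g 1 * y 1 + g 2 * c] (by
      rw [← hg]
      simp only [Fin.sum_univ_three, Matrix.cons_val_zero, Matrix.cons_val_one, Matrix.cons_val]
      module)
    have h0 : g 0 = 0 := this 0
    have h1 : g 1 = 0 := this 1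
    have h2 : g 0 * y 0 + g 1 * y 1 + g 2 * c = 0 := this 2
    intro i
    fin_cases i
    · exact h0
    · exact h1
    · simpa [h0, h1, hc] using h2

/-- The induced metric of a section of a null hypersurface does not depend on the section. -/
theorem gram2_rotate (h : NullTriple G e L) (y : Fin 2 → ℝ) :
    gram2 G (fun a => e a + y a • L) = gram2 G e := by
  ext a b
  simp only [gram2, bil_add_left, bil_add_right, bil_smul_left, bil_smul_right, h.null, h.orth,
    h.comm (e a) L]
  ring

variable (h : NullTriple G e L) (hc : IsNullConj G e L Lb)
  (hy : ∀ a, y a = gram2 G e a 0 * Y 0 + gram2 G e a 1 * Y 1)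
include h hc hy

/-- The conjugate null vector of the rotated frame, including the rescaling of `L` by `c`. -/
theorem isNullConj_nullRotate {c : ℝ} (hc0 : c ≠ 0) :
    IsNullConj G (fun a => e a + y a • L) (c • L) (c⁻¹ • nullRotate e L Lb y Y) := by
  have oe : ∀ a, bil G (e a) L = 0 := fun a => by rw [h.comm, h.orth]
  have ob : ∀ a, bil G (e a) Lb = 0 := fun a => by rw [h.comm, hc.orth]
  have pr : bil G Lb L = -2 := by rw [h.comm, hc.pair]
  have s10 : bil G (e 1) (e 0) = bil G (e 0) (e 1) := h.comm _ _
  simp only [gram2] at hy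
  refine ⟨?_, fun a => ?_, ?_⟩
  · simp only [nullRotate, bil_add_left, bil_add_right, bil_smul_left, bil_smul_right, h.null,
      h.orth, hc.null, hc.orth, hc.pair, oe, ob, pr, hy, s10]
    ring
  · simp only [nullRotate, bil_add_left, bil_add_right, bil_smul_left, bil_smul_right, h.null,
      h.orth, hc.orth, oe, pr, hy, h.comm (e a)]
    ring
  · simp only [nullRotate, bil_add_right, bil_smul_left, bil_smul_right, h.null, h.orth, hc.pair]
    field_simp
    ring

end NullRotation

namespace IsVacuumCurvature

variable {G : Matrix (Fin 4) (Fin 4) ℝ} {vol T : Fin 4 → Fin 4 → Fin 4 → Fin 4 → ℝ}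
  {e : Fin 2 → Fin 4 → ℝ} {L Lb : Fin 4 → ℝ} {y Y : Fin 2 → ℝ}
  (hT : IsVacuumCurvature G vol T)
include hT

theorem alpha_rotate (a b : Fin 2) :
    quad T L (e a + y a • L) L (e b + y b • L) = quad T L (e a) L (e b) := by
  simp only [quad_add₂, quad_add₄, quad_smul₂, quad_smul₄, hT.quad_self₁₂, hT.quad_self₃₄]
  ring

theorem beta_rotate (a : Fin 2) :
    quad T L (e a + y a • L) L (nullRotate e L Lb y Y) =
      quad T L (e a) L Lb + 2 * ∑ l, Y l * quad T L (e a) L (e l) := by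
  simp only [nullRotate, quad_add₂, quad_add₄, quad_smul₂, quad_smul₄, hT.quad_self₁₂,
    hT.quad_self₃₄, Fin.sum_univ_two]
  ring

theorem rho_rotate :
    quad T L (nullRotate e L Lb y Y) L (nullRotate e L Lb y Y) =
      quad T L Lb L Lb + 4 * ∑ l, Y l * (quad T L (e l) L Lb
        + ∑ k, Y k * quad T L (e l) L (e k)) := by
  have q : ∀ a, quad T L Lb L (e a) = quad T L (e a) L Lb := fun _ => hT.quad_pair _ _ _ _
  simp only [nullRotate, quad_add₂, quad_add₄, quad_smul₂, quad_smul₄, hT.quad_self₁₂,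
    hT.quad_self₃₄, Fin.sum_univ_two, q]
  ring

variable (h : NullTriple G e L) (hc : IsNullConj G e L Lb)
  (hy : ∀ a, y a = gram2 G e a 0 * Y 0 + gram2 G e a 1 * Y 1)
include h hc hy

theorem sigma_rotate :
    quad (starTensor G vol T) L (nullRotate e L Lb y Y) L (nullRotate e L Lb y Y) =
      quad (starTensor G vol T) L Lb L Lb - (8 / quad vol (e 0) (e 1) Lb L) *
        (y 0 * (quad T L (e 1) L Lb + ∑ l, Y l * quad T L (e 1) L (e l))
          - y 1 * (quad T L (e 0) L Lb + ∑ l, Y l * quad T L (e 0) L (e l))) := by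
  have hv := hT.vol_ne_zero h hc
  have q : ∀ a, quad T (e 0) (e 1) L (e a) =
      (1 / 2) * (gram2 G e a 0 * quad T L (e 1) L Lb - gram2 G e a 1 * quad T L (e 0) L Lb) :=
    fun a => by
      rw [hT.quad_pair, hT.quad_L_tangent h hc]
  have q2 : quad T L (e 1) L (e 0) = quad T L (e 0) L (e 1) := hT.quad_pair _ _ _ _
  have z : ∀ V W, quad (starTensor G vol T) L L V W = 0 := fun V W => by
    rw [hT.quad_star h hc]; simp [hT.vol_self₁₂]
  simp only [nullRotate, quad_add₂, quad_add₄, quad_smul₂, quad_smul₄,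
    hT.quad_self₃₄, Fin.sum_univ_two, z, hT.quad_star_L_tangent h hc, hT.quad_star_L_conj h hc, q,
    q2, hy, h.gram2_symm 1 0]
  field_simp
  ring

theorem betabar_rotate (a : Fin 2) :
    quad T (nullRotate e L Lb y Y) (e a + y a • L) (nullRotate e L Lb y Y) L =
      quad T Lb (e a) Lb L + (3 / 2) * y a * quad T L Lb L Lb
      - (3 / 2) * (quad vol (e 0) (e 1) Lb L / 2 * (![Y 1, -Y 0] : Fin 2 → ℝ) a)
        * quad (starTensor G vol T) L Lb L Lb
      + 4 * y a * ∑ k, Y k * quad T L (e k) L Lb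
      - (∑ k, Y k * y k) * quad T L (e a) L Lb
      + 2 * (![Y 1, -Y 0] : Fin 2 → ℝ) a * (y 0 * quad T L (e 1) L Lb - y 1 * quad T L (e 0) L Lb)
      + 4 * y a * ∑ k, ∑ l, Y k * Y l * quad T L (e k) L (e l)
      - 2 * (∑ k, Y k * y k) * ∑ l, Y l * quad T L (e a) L (e l) := by
  have hv := hT.vol_ne_zero h hc
  have a1 : ∀ W U, quad T (e 1) (e 0) W U = -quad T (e 0) (e 1) W U :=
    fun _ _ => hT.quad_anti₁₂ _ _ _ _
  have a2 : ∀ b W U, quad T (e b) L W U = -quad T L (e b) W U := fun _ _ _ => hT.quad_anti₁₂ _ _ _ _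
  have a3 : ∀ W U, quad T Lb L W U = -quad T L Lb W U := fun _ _ => hT.quad_anti₁₂ _ _ _ _
  have a4 : ∀ b W U, quad T W U (e b) L = -quad T W U L (e b) :=
    fun _ _ _ => hT.quad_anti₃₄ _ _ _ _
  have a5 : ∀ W U, quad T W U Lb L = -quad T W U L Lb := fun _ _ => hT.quad_anti₃₄ _ _ _ _
  have p1 : ∀ b, quad T L Lb L (e b) = quad T L (e b) L Lb := fun _ => hT.quad_pair _ _ _ _
  have p2 : quad T L (e 1) L (e 0) = quad T L (e 0) L (e 1) := hT.quad_pair _ _ _ _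
  have p3 : ∀ b c, quad T Lb (e b) L (e c) = quad T L (e c) Lb (e b) :=
    fun _ _ => hT.quad_pair _ _ _ _
  have t1 : ∀ b, quad T (e 0) (e 1) L (e b) =
      (1 / 2) * (gram2 G e b 0 * quad T L (e 1) L Lb - gram2 G e b 1 * quad T L (e 0) L Lb) :=
    fun b => by rw [hT.quad_pair, hT.quad_L_tangent h hc]
  fin_cases a <;>
  · simp only [nullRotate, quad_add₁, quad_add₂, quad_add₃, quad_smul₁, quad_smul₂,
      quad_smul₃, hT.quad_self₁₂, hT.quad_self₃₄, Fin.sum_univ_two, Fin.mk_one, Fin.zero_eta,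
      a1, a2, a3, a4, a5, p1, p2, p3, t1, hT.quad_mixed h hc, hT.quad_tangent_mixed h hc, hy,
      h.gram2_symm 1 0, Matrix.cons_val_zero, Matrix.cons_val_one, Matrix.cons_val_fin_one]
    ring

end IsVacuumCurvature

/-! ### Christoffel symbols and the symmetries of the curvature -/

section MatrixSmooth

variable {E : Type*} [NormedAddCommGroup E] [NormedSpace ℝ E] {n : ℕ} {k : WithTop ℕ∞}
  {M : E → Matrix (Fin n) (Fin n) ℝ} {x : E}

theorem contDiffAt_matrix_det (hM : ∀ i j, ContDiffAt ℝ k (fun y => M y i j) x) :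
    ContDiffAt ℝ k (fun y => (M y).det) x := by
  simp only [Matrix.det_apply]
  exact ContDiffAt.sum fun σ _ => (contDiffAt_prod fun i _ => hM _ _).const_smul _

theorem contDiffAt_matrix_inv (hM : ∀ i j, ContDiffAt ℝ k (fun y => M y i j) x) (hd : (M x).det ≠ 0)
    (i j : Fin n) : ContDiffAt ℝ k (fun y => (M y)⁻¹ i j) x := by
  simp only [Matrix.inv_def, Ring.inverse_eq_inv', Matrix.smul_apply, smul_eq_mul]
  refine ((contDiffAt_matrix_det hM).inv hd).mul ?_
  simp only [Matrix.adjugate_apply]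
  refine contDiffAt_matrix_det fun a b => ?_
  simp only [Matrix.updateRow_apply]
  split_ifs
  · exact contDiffAt_const
  · exact hM _ _

end MatrixSmooth

section PartialDerivative

variable {n : ℕ} {x : EuclideanSpace ℝ (Fin n)} {u w : EuclideanSpace ℝ (Fin n) → ℝ}

theorem contDiffAt_pd (hu : ContDiffAt ℝ ∞ u x) (i : Fin n) : ContDiffAt ℝ ∞ (pd i u) x :=
  (hu.fderiv_right (m := ∞) (by simp)).clm_apply contDiffAt_const

theorem pd_congr (i : Fin n) (h : u =ᶠ[𝓝 x] w) : pd i u x = pd i w x := by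
  rw [pd, pd, h.fderiv_eq]

theorem pd_add (i : Fin n) (hu : DifferentiableAt ℝ u x) (hw : DifferentiableAt ℝ w x) :
    pd i (fun y => u y + w y) x = pd i u x + pd i w x := by
  rw [pd, fderiv_fun_add hu hw]; rfl

theorem pd_sub (i : Fin n) (hu : DifferentiableAt ℝ u x) (hw : DifferentiableAt ℝ w x) :
    pd i (fun y => u y - w y) x = pd i u x - pd i w x := by
  rw [pd, fderiv_fun_sub hu hw]; rfl

theorem pd_mul (i : Fin n) (hu : DifferentiableAt ℝ u x) (hw : DifferentiableAt ℝ w x) :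
    pd i (fun y => u y * w y) x = u x * pd i w x + w x * pd i u x := by
  rw [pd, fderiv_fun_mul hu hw]; rfl

theorem pd_const_mul (i : Fin n) (c : ℝ) (hu : DifferentiableAt ℝ u x) :
    pd i (fun y => c * u y) x = c * pd i u x := by
  rw [pd, fderiv_const_mul hu]; rfl

theorem pd_const (i : Fin n) (c : ℝ) : pd i (fun _ => c) x = 0 := by
  simp [pd]

theorem pd_sum {ι : Type*} (s : Finset ι) (i : Fin n) {u : ι → EuclideanSpace ℝ (Fin n) → ℝ}
    (hu : ∀ j ∈ s, DifferentiableAt ℝ (u j) x) :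
    pd i (fun y => ∑ j ∈ s, u j y) x = ∑ j ∈ s, pd i (u j) x := by
  rw [pd, fderiv_fun_sum hu]; simp [pd]

theorem fderiv_pd (i : Fin n) (hu : ContDiffAt ℝ ∞ u x) (w : EuclideanSpace ℝ (Fin n)) :
    fderiv ℝ (pd i u) x w = fderiv ℝ (fderiv ℝ u) x w (EuclideanSpace.single i 1) := by
  have h := (hu.fderiv_right (m := ∞) (by simp)).differentiableAt (by simp)
  unfold pd
  rw [fderiv_clm_apply h (differentiableAt_const _)]
  simp

theorem pd_comm (i j : Fin n) (hu : ContDiffAt ℝ ∞ u x) : pd i (pd j u) x = pd j (pd i u) x := by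
  rw [pd, fderiv_pd j hu, pd, fderiv_pd i hu]
  exact (hu.isSymmSndFDerivAt (by
    simpa using (WithTop.coe_le_coe.2 le_top : ((2 : ℕ∞) : WithTop ℕ∞) ≤ ∞))) _ _

end PartialDerivative

section Christoffel

variable {n : ℕ} {G : EuclideanSpace ℝ (Fin n) → Matrix (Fin n) (Fin n) ℝ}
  {x : EuclideanSpace ℝ (Fin n)}

/-- The Christoffel symbols of the first kind, the derivatives `∂_c G_{ab}` being given by `D c a b`. -/
def christoffelLow (D : Fin n → Fin n → Fin n → ℝ) (d a b : Fin n) : ℝ :=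
  (1 / 2) * (D a d b + D b d a - D d a b)

theorem christoffel_eq (c a b : Fin n) : christoffel G x c a b =
    ∑ d, (G x)⁻¹ c d * christoffelLow (fun i p q => pd i (fun y => G y p q) x) d a b := by
  rw [christoffel, Finset.mul_sum]
  exact Finset.sum_congr rfl fun d _ => by rw [christoffelLow]; ring

theorem christoffel_lower (hd : (G x).det ≠ 0) (d a b : Fin n) :
    ∑ c, G x d c * christoffel G x c a b =
      christoffelLow (fun i p q => pd i (fun y => G y p q) x) d a b := by
  have h := Matrix.mul_nonsing_inv (G x) hd.isUnit
  simp only [christoffel_eq, Finset.mul_sum]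
  rw [Finset.sum_comm]
  simp only [← mul_assoc, ← Finset.sum_mul]
  have h1 : ∀ p, ∑ c, G x d c * (G x)⁻¹ c p = if d = p then 1 else 0 := fun p => by
    rw [← Matrix.mul_apply, h, Matrix.one_apply]
  simp [h1]

theorem christoffel_symm (hs : ∀ᶠ y in 𝓝 x, ∀ a b, G y a b = G y b a) (c a b : Fin n) :
    christoffel G x c a b = christoffel G x c b a := by
  rw [christoffel, christoffel]
  congr 1
  refine Finset.sum_congr rfl fun d _ => ?_
  rw [pd_congr d (u := fun y => G y a b) (w := fun y => G y b a) (hs.mono fun y hy => hy a b)]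
  ring

theorem contDiffAt_christoffel (hG : ∀ a b, ContDiffAt ℝ ∞ (fun y => G y a b) x)
    (hd : (G x).det ≠ 0) (c a b : Fin n) :
    ContDiffAt ℝ ∞ (fun y => christoffel G y c a b) x := by
  unfold christoffel
  refine contDiffAt_const.mul (ContDiffAt.sum fun d _ => (contDiffAt_matrix_inv hG hd _ _).mul ?_)
  exact ((contDiffAt_pd (hG _ _) _).add (contDiffAt_pd (hG _ _) _)).sub (contDiffAt_pd (hG _ _) _)

/-- Compatibility of the connection with the metric. -/
theorem pd_metric (hs : ∀ᶠ y in 𝓝 x, ∀ a b, G y a b = G y b a) (hd : (G x).det ≠ 0)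
    (i a b : Fin n) : pd i (fun y => G y a b) x =
      ∑ c, G x a c * christoffel G x c i b + ∑ c, G x b c * christoffel G x c i a := by
  rw [christoffel_lower hd, christoffel_lower hd, christoffelLow, christoffelLow]
  rw [pd_congr i (u := fun y => G y b a) (w := fun y => G y a b) (hs.mono fun y hy => hy b a)]
  rw [pd_congr a (u := fun y => G y i b) (w := fun y => G y b i) (hs.mono fun y hy => hy i b)]
  rw [pd_congr b (u := fun y => G y i a) (w := fun y => G y a i) (hs.mono fun y hy => hy i a)]
  ring

/-- Ricci curvature as a contraction of the fully covariant curvature. -/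
theorem sum_inv_mul_riemann (hd : (G x).det ≠ 0) (ν l : Fin n) :
    ∑ κ, ∑ μ, (G x)⁻¹ κ μ * riemann G x μ ν κ l = ricci G x ν l := by
  have h := Matrix.nonsing_inv_mul (G x) hd.isUnit
  have h1 : ∀ κ p, ∑ μ, (G x)⁻¹ κ μ * G x μ p = if κ = p then 1 else 0 := fun κ p => by
    rw [← Matrix.mul_apply, h, Matrix.one_apply]
  simp only [riemann, Finset.mul_sum, ricci]
  refine Finset.sum_congr rfl fun κ _ => ?_
  rw [Finset.sum_comm]
  simp only [← mul_assoc, ← Finset.sum_mul, h1]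
  simp

variable (hG : ∀ᶠ y in 𝓝 x, ∀ a b, ContDiffAt ℝ ∞ (fun y => G y a b) y)
  (hs : ∀ᶠ y in 𝓝 x, ∀ a b, G y a b = G y b a) (hd : (G x).det ≠ 0)

theorem riemann_anti₃₄ (μ ν κ l : Fin n) : riemann G x μ ν l κ = -riemann G x μ ν κ l := by
  rw [riemann, riemann, ← Finset.sum_neg_distrib]
  refine Finset.sum_congr rfl fun τ _ => ?_
  rw [riemannUp, riemannUp]
  have : ∑ θ, (christoffel G x τ l θ * christoffel G x θ κ ν
        - christoffel G x τ κ θ * christoffel G x θ l ν) =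
      -∑ θ, (christoffel G x τ κ θ * christoffel G x θ l ν
        - christoffel G x τ l θ * christoffel G x θ κ ν) := by
    rw [← Finset.sum_neg_distrib]
    exact Finset.sum_congr rfl fun _ _ => by ring
  rw [this]; ring

include hs in
/-- The first Bianchi identity. -/
theorem riemann_cyclic (μ ν κ l : Fin n) :
    riemann G x μ ν κ l + riemann G x μ κ l ν + riemann G x μ l ν κ = 0 := by
  have hsym : ∀ i a b τ, pd i (fun y => christoffel G y τ a b) x
      = pd i (fun y => christoffel G y τ b a) x := fun i a b τ =>
    pd_congr i (hs.eventually_nhds.mono fun y hy => christoffel_symm hy τ a b)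
  have hx := fun a b τ => christoffel_symm hs τ a b
  simp only [riemann, ← Finset.sum_add_distrib, ← mul_add]
  refine Finset.sum_eq_zero fun τ _ => ?_
  simp only [riemannUp, Finset.sum_sub_distrib]
  rw [hsym κ l ν, hsym l κ ν, hsym ν l κ]
  have e1 : ∀ a b c, ∑ θ, christoffel G x τ a θ * christoffel G x θ b c
      = ∑ θ, christoffel G x τ a θ * christoffel G x θ c b := fun a b c =>
    Finset.sum_congr rfl fun θ _ => by rw [hx b c]
  rw [e1 κ l ν, e1 l κ ν, e1 ν l κ]
  ring

include hG hs hd in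
/-- The curvature with lowered index in terms of the Christoffel symbols of the first kind. -/
theorem riemann_eq (μ ν κ l : Fin n) :
    riemann G x μ ν κ l =
      pd κ (fun y => christoffelLow (fun i p q => pd i (fun z => G z p q) y) μ l ν) x
      - pd l (fun y => christoffelLow (fun i p q => pd i (fun z => G z p q) y) μ κ ν) x
      - (∑ θ, ∑ τ, G x θ τ * christoffel G x τ κ μ * christoffel G x θ l ν
        - ∑ θ, ∑ τ, G x θ τ * christoffel G x τ l μ * christoffel G x θ κ ν) := by
  have hGx := hG.self_of_nhds
  have hdet : ∀ᶠ y in 𝓝 x, (G y).det ≠ 0 :=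
    ((contDiffAt_matrix_det hGx).continuousAt).eventually_ne hd
  -- the product rule for `G_{μτ} Γ^τ_{ij}`
  have key : ∀ k i j, pd k (fun y => christoffelLow (fun i p q => pd i (fun z => G z p q) y) μ i j) x
      = ∑ τ, G x μ τ * pd k (fun y => christoffel G y τ i j) x
        + ∑ τ, christoffel G x τ i j * (∑ c, G x μ c * christoffel G x c k τ
          + ∑ c, G x τ c * christoffel G x c k μ) := by
    intro k i j
    rw [pd_congr k (w := fun y => ∑ c, G y μ c * christoffel G y c i j)
      (hdet.mono fun y hy => (christoffel_lower hy μ i j).symm)]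
    have d1 : ∀ τ, DifferentiableAt ℝ (fun y => G y μ τ) x :=
      fun τ => (hGx _ _).differentiableAt (by simp)
    have d2 : ∀ τ, DifferentiableAt ℝ (fun y => christoffel G y τ i j) x :=
      fun τ => (contDiffAt_christoffel hGx hd τ i j).differentiableAt (by simp)
    rw [pd_sum _ k fun τ _ => (d1 τ).fun_mul (d2 τ), ← Finset.sum_add_distrib]
    refine Finset.sum_congr rfl fun τ _ => ?_
    rw [pd_mul k (d1 τ) (d2 τ), pd_metric hs hd]
  have swap : ∀ k i j, ∑ τ, christoffel G x τ i j * ∑ c, G x μ c * christoffel G x c k τ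
      = ∑ τ, G x μ τ * ∑ θ, christoffel G x τ k θ * christoffel G x θ i j := by
    intro k i j
    simp only [Finset.mul_sum]
    rw [Finset.sum_comm]
    exact Finset.sum_congr rfl fun _ _ => Finset.sum_congr rfl fun _ _ => by ring
  have low : ∀ k i j, ∑ τ, christoffel G x τ i j * ∑ c, G x τ c * christoffel G x c k μ
      = ∑ θ, ∑ τ, G x θ τ * christoffel G x τ k μ * christoffel G x θ i j := by
    intro k i j
    simp only [Finset.mul_sum]
    exact Finset.sum_congr rfl fun _ _ => Finset.sum_congr rfl fun _ _ => by ring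
  rw [key, key]
  simp only [mul_add, Finset.sum_add_distrib, swap, low]
  simp only [riemann, riemannUp, mul_add, mul_sub, Finset.sum_add_distrib, Finset.sum_sub_distrib]
  ring

include hG hs hd in
theorem riemann_anti₁₂ (μ ν κ l : Fin n) : riemann G x ν μ κ l = -riemann G x μ ν κ l := by
  have hGx := hG.self_of_nhds
  have hsx := hs.self_of_nhds
  rw [riemann_eq hG hs hd, riemann_eq hG hs hd]
  have q : ∀ a b c d, ∑ θ, ∑ τ, G x θ τ * christoffel G x τ a b * christoffel G x θ c d
      = ∑ θ, ∑ τ, G x θ τ * christoffel G x τ c d * christoffel G x θ a b := by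
    intro a b c d
    rw [Finset.sum_comm]
    exact Finset.sum_congr rfl fun _ _ => Finset.sum_congr rfl fun _ _ => by rw [hsx]; ring
  have d : ∀ a p q, DifferentiableAt ℝ (fun y => pd a (fun z => G z p q) y) x :=
    fun a p q => (contDiffAt_pd (hGx p q) a).differentiableAt (by simp)
  have ex : ∀ k m i j, pd k (fun y => christoffelLow (fun i p q => pd i (fun z => G z p q) y) m i j) x
      = (1 / 2) * (pd k (pd i fun z => G z m j) x + pd k (pd j fun z => G z m i) x
        - pd k (pd m fun z => G z i j) x) := by
    intro k m i j
    simp only [christoffelLow]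
    rw [pd_const_mul _ _ (((d _ _ _).fun_add (d _ _ _)).fun_sub (d _ _ _)),
      pd_sub _ ((d _ _ _).fun_add (d _ _ _)) (d _ _ _), pd_add _ (d _ _ _) (d _ _ _)]
  have sy : ∀ k i p q, pd k (pd i fun z => G z p q) x = pd k (pd i fun z => G z q p) x :=
    fun k i p q => pd_congr k (hs.eventually_nhds.mono fun y hy =>
      pd_congr i (hy.mono fun z hz => hz p q))
  have cm : ∀ k i p q, pd k (pd i fun z => G z p q) x = pd i (pd k fun z => G z p q) x :=
    fun k i p q => pd_comm k i (hGx p q)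
  rw [ex, ex, ex, ex, q κ ν l μ, q l ν κ μ, cm κ l, cm κ l, sy l κ ν μ, sy κ ν l μ, sy κ μ l ν, sy l ν κ μ,
    sy l μ κ ν]
  ring

end Christoffel

theorem isCurvatureTensor_riemann {G : EuclideanSpace ℝ (Fin 4) → Matrix (Fin 4) (Fin 4) ℝ}
    {x : EuclideanSpace ℝ (Fin 4)}
    (hG : ∀ᶠ y in 𝓝 x, ∀ a b, ContDiffAt ℝ ∞ (fun y => G y a b) y)
    (hs : ∀ᶠ y in 𝓝 x, ∀ a b, G y a b = G y b a) (hd : (G x).det ≠ 0) :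
    IsCurvatureTensor (riemann G x) where
  anti₁₂ := riemann_anti₁₂ hG hs hd
  anti₃₄ := riemann_anti₃₄
  cyclic := riemann_cyclic hs

/-! ### Covariant differentiation along the hypersurface -/

/-- The space of parameters `(x, s)`. -/
abbrev ParamSpace := EuclideanSpace ℝ (Fin 2) × ℝ

/-- The coordinate direction `∂/∂x^a` in parameter space. -/
def dirE (a : Fin 2) : ParamSpace := (EuclideanSpace.single a 1, 0)

/-- The direction `∂/∂s` in parameter space. -/
def dirL : ParamSpace := (0, 1)

section Partial

variable {u : ParamSpace → ℝ} {x : EuclideanSpace ℝ (Fin 2)} {s : ℝ}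

theorem pd_comp_graph {σ : EuclideanSpace ℝ (Fin 2) → ℝ} (hσ : DifferentiableAt ℝ σ x)
    (hu : DifferentiableAt ℝ u (x, σ x)) (a : Fin 2) :
    pd a (fun y => u (y, σ y)) x = fderiv ℝ u (x, σ x) (dirE a + pd a σ x • dirL) := by
  have h1 : HasFDerivAt (fun y => (y, σ y))
      ((ContinuousLinearMap.id ℝ (EuclideanSpace ℝ (Fin 2))).prod (fderiv ℝ σ x)) x :=
    (hasFDerivAt_id x).prodMk hσ.hasFDerivAt
  have h2 := HasFDerivAt.comp (g := u) x hu.hasFDerivAt h1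
  have h3 : fderiv ℝ (fun y => u (y, σ y)) x = _ := h2.fderiv
  rw [pd, h3]
  simp [dirE, dirL, pd]

theorem pd_slice (hu : DifferentiableAt ℝ u (x, s)) (a : Fin 2) :
    pd a (fun y => u (y, s)) x = fderiv ℝ u (x, s) (dirE a) := by
  have := pd_comp_graph (σ := fun _ => s) (differentiableAt_const s) hu a
  simpa [pd_const] using this

theorem deriv_slice (hu : DifferentiableAt ℝ u (x, s)) :
    deriv (fun τ => u (x, τ)) s = fderiv ℝ u (x, s) dirL := by
  have h1 : HasFDerivAt (fun τ : ℝ => (x, τ)) ((0 : ℝ →L[ℝ] EuclideanSpace ℝ (Fin 2)).prod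
      (ContinuousLinearMap.id ℝ ℝ)) s := (hasFDerivAt_const x s).prodMk (hasFDerivAt_id s)
  have h2 := (HasFDerivAt.comp (g := u) s hu.hasFDerivAt h1).hasDerivAt.deriv
  have h3 : deriv (fun τ => u (x, τ)) s = _ := h2
  rw [h3]
  simp [dirL]

end Partial

namespace ConeCoords

variable (K : ConeCoords)

/-- The image of the parameter direction `w` under the differential of the parametrization. -/
def dF (w : ParamSpace) (x : EuclideanSpace ℝ (Fin 2)) (s : ℝ) : Fin 4 → ℝ :=
  fun μ => fderiv ℝ (fun q : ParamSpace => K.f q.1 q.2 μ) (x, s) w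

/-- The covariant derivative of a field along the hypersurface in the parameter direction `w`. -/
def cov (w : ParamSpace) (V : EuclideanSpace ℝ (Fin 2) → ℝ → Fin 4 → ℝ)
    (x : EuclideanSpace ℝ (Fin 2)) (s : ℝ) : Fin 4 → ℝ :=
  fun μ => fderiv ℝ (fun q : ParamSpace => V q.1 q.2 μ) (x, s) w
    + ∑ ν, ∑ l, christoffel K.G (K.f x s) μ ν l * K.dF w x s ν * V x s l

/-- The part of the structure of a null cone that concerns a neighbourhood of one point. -/
structure IsNullAt (x : EuclideanSpace ℝ (Fin 2)) (s : ℝ) : Prop where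
  one_le : 1 ≤ s
  smooth_f : ∀ᶠ z in 𝓝 (x, s), ContDiffAt ℝ ∞ (fun q : ParamSpace => K.f q.1 q.2) z
  smooth_G : ∀ᶠ p in 𝓝 (K.f x s), ∀ μ ν, ContDiffAt ℝ ∞ (fun p => K.G p μ ν) p
  symm_G : ∀ᶠ p in 𝓝 (K.f x s), ∀ μ ν, K.G p μ ν = K.G p ν μ
  null : ∀ᶠ z : ParamSpace in 𝓝 (x, s), 1 ≤ z.2 →
    NullTriple (K.G (K.f z.1 z.2)) (fun a => K.e a z.1 z.2) (K.L z.1 z.2)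

/-- Smoothness at a point of a vector field along the hypersurface. -/
def SmoothField (V : EuclideanSpace ℝ (Fin 2) → ℝ → Fin 4 → ℝ) (x : EuclideanSpace ℝ (Fin 2))
    (s : ℝ) : Prop :=
  ∀ μ, ContDiffAt ℝ ∞ (fun q : ParamSpace => V q.1 q.2 μ) (x, s)

variable {K} {x : EuclideanSpace ℝ (Fin 2)} {s : ℝ}
  {V W : EuclideanSpace ℝ (Fin 2) → ℝ → Fin 4 → ℝ}

theorem SmoothField.diff (hV : SmoothField V x s) (μ : Fin 4) :
    DifferentiableAt ℝ (fun q : ParamSpace => V q.1 q.2 μ) (x, s) :=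
  (hV μ).differentiableAt (by simp)

theorem SmoothField.add (hV : SmoothField V x s) (hW : SmoothField W x s) :
    SmoothField (fun y τ => V y τ + W y τ) x s := fun μ => (hV μ).add (hW μ)

theorem SmoothField.smul (hV : SmoothField V x s) {r : ParamSpace → ℝ}
    (hr : ContDiffAt ℝ ∞ r (x, s)) : SmoothField (fun y τ => r (y, τ) • V y τ) x s :=
  fun μ => hr.mul (hV μ)

theorem SmoothField.congr (hV : SmoothField V x s)
    (h : ∀ᶠ q : ParamSpace in 𝓝 (x, s), W q.1 q.2 = V q.1 q.2) : SmoothField W x s :=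
  fun μ => (hV μ).congr_of_eventuallyEq (h.mono fun _ hq => congrFun hq μ)

theorem cov_congr (w : ParamSpace) (h : ∀ᶠ q : ParamSpace in 𝓝 (x, s), W q.1 q.2 = V q.1 q.2) :
    K.cov w W x s = K.cov w V x s := by
  funext μ
  have h0 : W x s = V x s := h.self_of_nhds
  have h1 : (fun q : ParamSpace => W q.1 q.2 μ) =ᶠ[𝓝 (x, s)] fun q => V q.1 q.2 μ :=
    h.mono fun _ hq => congrFun hq μ
  rw [cov, cov, h1.fderiv_eq, h0]

theorem dF_add (w w' : ParamSpace) : K.dF (w + w') x s = K.dF w x s + K.dF w' x s := by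
  funext μ; simp [dF]

theorem dF_smul (r : ℝ) (w : ParamSpace) : K.dF (r • w) x s = r • K.dF w x s := by
  funext μ; simp [dF]

theorem cov_add_dir (w w' : ParamSpace) :
    K.cov (w + w') V x s = K.cov w V x s + K.cov w' V x s := by
  funext μ
  simp only [cov, dF_add, map_add, Pi.add_apply, mul_add, add_mul, Finset.sum_add_distrib]
  ring

theorem cov_smul_dir (r : ℝ) (w : ParamSpace) : K.cov (r • w) V x s = r • K.cov w V x s := by
  funext μ
  simp only [cov, dF_smul, map_smul, Pi.smul_apply, smul_eq_mul, mul_add, Finset.mul_sum]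
  congr 1
  exact Finset.sum_congr rfl fun _ _ => Finset.sum_congr rfl fun _ _ => by ring

theorem cov_add (w : ParamSpace) (hV : SmoothField V x s) (hW : SmoothField W x s) :
    K.cov w (fun y τ => V y τ + W y τ) x s = K.cov w V x s + K.cov w W x s := by
  funext μ
  have := fderiv_fun_add (hV.diff μ) (hW.diff μ)
  simp only [cov, Pi.add_apply, mul_add, Finset.sum_add_distrib, this,
    add_apply]
  ring

theorem cov_smul (w : ParamSpace) (hV : SmoothField V x s) {r : ParamSpace → ℝ}
    (hr : ContDiffAt ℝ ∞ r (x, s)) :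
    K.cov w (fun y τ => r (y, τ) • V y τ) x s =
      fderiv ℝ r (x, s) w • V x s + r (x, s) • K.cov w V x s := by
  funext μ
  have := fderiv_fun_mul (hr.differentiableAt (by simp)) (hV.diff μ)
  simp only [cov, Pi.add_apply, Pi.smul_apply, smul_eq_mul, mul_add, Finset.mul_sum] at this ⊢
  rw [this]
  simp only [add_apply, smul_apply, smul_eq_mul]
  have h : ∀ ν l, christoffel K.G (K.f x s) μ ν l * K.dF w x s ν * (r (x, s) * V x s l)
    = r (x, s) * (christoffel K.G (K.f x s) μ ν l * K.dF w x s ν * V x s l) := fun _ _ => by ring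
  simp only [h]
  ring

theorem contDiffAt_f_comp (hf : ContDiffAt ℝ ∞ (fun q : ParamSpace => K.f q.1 q.2) (x, s))
    (μ : Fin 4) : ContDiffAt ℝ ∞ (fun q : ParamSpace => K.f q.1 q.2 μ) (x, s) :=
  (EuclideanSpace.proj (𝕜 := ℝ) μ).contDiff.contDiffAt.comp (x, s) hf

theorem smoothField_dF (hf : ContDiffAt ℝ ∞ (fun q : ParamSpace => K.f q.1 q.2) (x, s))
    (w : ParamSpace) : SmoothField (K.dF w) x s := fun μ =>
  ((contDiffAt_f_comp hf μ).fderiv_right (m := ∞) (by simp)).clm_apply contDiffAt_const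

theorem e_eq_dF (hf : ContDiffAt ℝ ∞ (fun q : ParamSpace => K.f q.1 q.2) (x, s)) (a : Fin 2) :
    K.e a x s = K.dF (dirE a) x s := by
  funext μ
  exact pd_slice (u := fun q : ParamSpace => K.f q.1 q.2 μ)
    ((contDiffAt_f_comp hf μ).differentiableAt (by simp)) a

theorem L_eq_dF (hf : ContDiffAt ℝ ∞ (fun q : ParamSpace => K.f q.1 q.2) (x, s)) :
    K.L x s = K.dF dirL x s := by
  funext μ
  exact deriv_slice (u := fun q : ParamSpace => K.f q.1 q.2 μ)
    ((contDiffAt_f_comp hf μ).differentiableAt (by simp))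

/-- The chain rule for a function on the spacetime. -/
theorem fderiv_comp_f (hf : ContDiffAt ℝ ∞ (fun q : ParamSpace => K.f q.1 q.2) (x, s))
    {u : EuclideanSpace ℝ (Fin 4) → ℝ} (hu : DifferentiableAt ℝ u (K.f x s)) (w : ParamSpace) :
    fderiv ℝ (fun q : ParamSpace => u (K.f q.1 q.2)) (x, s) w =
      ∑ κ, pd κ u (K.f x s) * K.dF w x s κ := by
  have hd := hf.differentiableAt (by simp)
  have h1 : fderiv ℝ (fun q : ParamSpace => u (K.f q.1 q.2)) (x, s) w =
      fderiv ℝ u (K.f x s) (fderiv ℝ (fun q : ParamSpace => K.f q.1 q.2) (x, s) w) := by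
    have := fderiv_comp (x, s) (g := u) (f := fun q : ParamSpace => K.f q.1 q.2) hu hd
    exact congrArg (fun A : ParamSpace →L[ℝ] ℝ => A w) this
  have h2 : ∀ κ, K.dF w x s κ = (fderiv ℝ (fun q : ParamSpace => K.f q.1 q.2) (x, s) w) κ := by
    intro κ
    have := ((EuclideanSpace.proj κ : EuclideanSpace ℝ (Fin 4) →L[ℝ] ℝ).hasFDerivAt.comp
      (x, s) hd.hasFDerivAt).fderiv
    exact congrArg (fun A : ParamSpace →L[ℝ] ℝ => A w) this
  rw [h1]
  simp only [h2]
  generalize fderiv ℝ (fun q : ParamSpace => K.f q.1 q.2) (x, s) w = v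
  conv_lhs => rw [← (EuclideanSpace.basisFun (Fin 4) ℝ).sum_repr v]
  rw [map_sum]
  refine Finset.sum_congr rfl fun κ _ => ?_
  rw [map_smul, smul_eq_mul, mul_comm, EuclideanSpace.basisFun_repr, EuclideanSpace.basisFun_apply]
  rfl

theorem IsNullAt.f (h : K.IsNullAt x s) :
    ContDiffAt ℝ ∞ (fun q : ParamSpace => K.f q.1 q.2) (x, s) := h.smooth_f.self_of_nhds

theorem IsNullAt.G (h : K.IsNullAt x s) (μ ν : Fin 4) :
    ContDiffAt ℝ ∞ (fun p => K.G p μ ν) (K.f x s) := h.smooth_G.self_of_nhds μ ν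

theorem IsNullAt.triple (h : K.IsNullAt x s) :
    NullTriple (K.G (K.f x s)) (fun a => K.e a x s) (K.L x s) := h.null.self_of_nhds h.one_le

theorem IsNullAt.contDiffAt_G (h : K.IsNullAt x s) (μ ν : Fin 4) :
    ContDiffAt ℝ ∞ (fun q : ParamSpace => K.G (K.f q.1 q.2) μ ν) (x, s) :=
  ContDiffAt.comp (g := fun p => K.G p μ ν) (x, s) (h.G μ ν) h.f

theorem IsNullAt.contDiffAt_ip (h : K.IsNullAt x s) (hV : SmoothField V x s)
    (hW : SmoothField W x s) :
    ContDiffAt ℝ ∞ (fun q : ParamSpace => K.ip q.1 q.2 (V q.1 q.2) (W q.1 q.2)) (x, s) :=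
  ContDiffAt.sum fun μ _ => ContDiffAt.sum fun ν _ =>
    ((h.contDiffAt_G μ ν).mul (hV μ)).mul (hW ν)

theorem IsNullAt.smoothField_e (h : K.IsNullAt x s) (a : Fin 2) : SmoothField (K.e a) x s :=
  (smoothField_dF h.f (dirE a)).congr (h.smooth_f.mono fun _ hq => e_eq_dF hq a)

theorem IsNullAt.smoothField_L (h : K.IsNullAt x s) : SmoothField K.L x s :=
  (smoothField_dF h.f dirL).congr (h.smooth_f.mono fun _ hq => L_eq_dF hq)

theorem IsNullAt.smoothField_cov (h : K.IsNullAt x s) (hV : SmoothField V x s) (w : ParamSpace) :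
    SmoothField (K.cov w V) x s := fun μ =>
  (((hV μ).fderiv_right (m := ∞) (by simp)).clm_apply contDiffAt_const).add
    (ContDiffAt.sum fun ν _ => ContDiffAt.sum fun l _ =>
      ((ContDiffAt.comp (g := fun p => christoffel K.G p μ ν l) (x, s)
        (contDiffAt_christoffel h.G h.triple.det.ne μ ν l) h.f).mul
          (smoothField_dF h.f w ν)).mul (hV l))

/-- Compatibility of covariant differentiation with the metric. -/
theorem IsNullAt.fderiv_ip (h : K.IsNullAt x s) (w : ParamSpace) (hV : SmoothField V x s)
    (hW : SmoothField W x s) :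
    fderiv ℝ (fun q : ParamSpace => K.ip q.1 q.2 (V q.1 q.2) (W q.1 q.2)) (x, s) w =
      K.ip x s (K.cov w V x s) (W x s) + K.ip x s (V x s) (K.cov w W x s) := by
  have dG : ∀ μ ν, DifferentiableAt ℝ (fun q : ParamSpace => K.G (K.f q.1 q.2) μ ν) (x, s) :=
    fun μ ν => (h.contDiffAt_G μ ν).differentiableAt (by simp)
  have d2 : ∀ μ ν, fderiv ℝ (fun q : ParamSpace =>
      K.G (K.f q.1 q.2) μ ν * V q.1 q.2 μ * W q.1 q.2 ν) (x, s) w =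
      (∑ κ, pd κ (fun p => K.G p μ ν) (K.f x s) * K.dF w x s κ) * V x s μ * W x s ν
      + K.G (K.f x s) μ ν * fderiv ℝ (fun q : ParamSpace => V q.1 q.2 μ) (x, s) w * W x s ν
      + K.G (K.f x s) μ ν * V x s μ * fderiv ℝ (fun q : ParamSpace => W q.1 q.2 ν) (x, s) w := by
    intro μ ν
    rw [fderiv_fun_mul ((dG μ ν).fun_mul (hV.diff μ)) (hW.diff ν),
      fderiv_fun_mul (dG μ ν) (hV.diff μ)]
    simp only [add_apply, smul_apply, smul_eq_mul]
    rw [fderiv_comp_f (u := fun p => K.G p μ ν) h.f ((h.G μ ν).differentiableAt (by simp))]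
    ring
  have d3 : fderiv ℝ (fun q : ParamSpace => K.ip q.1 q.2 (V q.1 q.2) (W q.1 q.2)) (x, s) w =
      ∑ μ, ∑ ν, fderiv ℝ (fun q : ParamSpace =>
        K.G (K.f q.1 q.2) μ ν * V q.1 q.2 μ * W q.1 q.2 ν) (x, s) w := by
    simp only [ip]
    rw [fderiv_fun_sum fun μ _ => DifferentiableAt.fun_sum fun ν _ =>
      ((dG μ ν).fun_mul (hV.diff μ)).fun_mul (hW.diff ν)]
    rw [sum_apply]
    refine Finset.sum_congr rfl fun μ _ => ?_
    rw [fderiv_fun_sum fun ν _ => ((dG μ ν).fun_mul (hV.diff μ)).fun_mul (hW.diff ν)]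
    rw [sum_apply]
  rw [d3]
  simp only [d2, pd_metric h.symm_G h.triple.det.ne]
  simp only [ip, cov, Finset.sum_add_distrib, mul_add, add_mul]
  have hs := h.triple.symm
  have e1 : ∑ μ, ∑ ν, (∑ κ, (∑ c, K.G (K.f x s) μ c * christoffel K.G (K.f x s) c κ ν)
        * K.dF w x s κ) * V x s μ * W x s ν
      = ∑ μ, ∑ ν, K.G (K.f x s) μ ν * V x s μ *
        ∑ κ, ∑ l, christoffel K.G (K.f x s) ν κ l * K.dF w x s κ * W x s l := by
    refine Finset.sum_congr rfl fun μ _ => ?_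
    simp only [Finset.sum_mul, Finset.mul_sum]
    rw [Finset.sum_congr rfl fun ν _ => Finset.sum_comm, Finset.sum_comm]
    refine Finset.sum_congr rfl fun c _ => ?_
    rw [Finset.sum_comm]
    exact Finset.sum_congr rfl fun _ _ => Finset.sum_congr rfl fun _ _ => by ring
  have e2 : ∑ μ, ∑ ν, (∑ κ, (∑ c, K.G (K.f x s) ν c * christoffel K.G (K.f x s) c κ μ)
        * K.dF w x s κ) * V x s μ * W x s ν
      = ∑ μ, ∑ ν, (K.G (K.f x s) μ ν *
        ∑ κ, ∑ l, christoffel K.G (K.f x s) μ κ l * K.dF w x s κ * V x s l) * W x s ν := by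
    rw [Finset.sum_comm, Finset.sum_comm (f := fun μ ν => (K.G (K.f x s) μ ν * _) * W x s ν)]
    refine Finset.sum_congr rfl fun ν _ => ?_
    simp only [Finset.sum_mul, Finset.mul_sum]
    rw [Finset.sum_congr rfl fun ν _ => Finset.sum_comm, Finset.sum_comm]
    refine Finset.sum_congr rfl fun c _ => ?_
    rw [Finset.sum_comm]
    exact Finset.sum_congr rfl fun _ _ => Finset.sum_congr rfl fun _ _ => by rw [hs c ν]; ring
  rw [e1, e2]
  ring

/-- The connection is torsion-free. -/
theorem IsNullAt.cov_dF_comm (h : K.IsNullAt x s) (w w' : ParamSpace) :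
    K.cov w (K.dF w') x s = K.cov w' (K.dF w) x s := by
  funext μ
  have hc := contDiffAt_f_comp h.f μ
  have hd := (hc.fderiv_right (m := ∞) (by simp)).differentiableAt (by simp)
  have e : ∀ v v' : ParamSpace, fderiv ℝ (fun q : ParamSpace => K.dF v' q.1 q.2 μ) (x, s) v =
      fderiv ℝ (fderiv ℝ fun q : ParamSpace => K.f q.1 q.2 μ) (x, s) v v' := by
    intro v v'
    simp only [dF]
    rw [fderiv_clm_apply hd (differentiableAt_const _)]
    simp
  have hsym := (hc.isSymmSndFDerivAt (by
    simpa using (WithTop.coe_le_coe.2 le_top : ((2 : ℕ∞) : WithTop ℕ∞) ≤ ∞))) w w'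
  rw [cov, cov, e, e, hsym, Finset.sum_comm]
  congr 1
  exact Finset.sum_congr rfl fun ν _ => Finset.sum_congr rfl fun l _ => by
    rw [christoffel_symm h.symm_G μ l ν]; ring

end ConeCoords

/-! ### The conjugate null field and the null structure equations -/

namespace ConeCoords

variable (K : ConeCoords)

/-- The conjugate null field given by the explicit formula `conjVec`.  Unlike `Lbar` it is smooth in
a neighbourhood of the initial sphere, on both sides of it. -/
def conj (x : EuclideanSpace ℝ (Fin 2)) (s : ℝ) : Fin 4 → ℝ :=
  conjVec (K.G (K.f x s)) (fun a => K.e a x s) (K.L x s)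

variable {K} {x : EuclideanSpace ℝ (Fin 2)} {s : ℝ}
  {V W : EuclideanSpace ℝ (Fin 2) → ℝ → Fin 4 → ℝ}

theorem isConjugate_iff (V : Fin 4 → ℝ) : K.IsConjugate x s V ↔
    IsNullConj (K.G (K.f x s)) (fun a => K.e a x s) (K.L x s) V :=
  ⟨fun h => ⟨h.1, h.2.1, h.2.2⟩, fun h => ⟨h.null, h.orth, h.pair⟩⟩

theorem isNullConj_Lbar
    (h : NullTriple (K.G (K.f x s)) (fun a => K.e a x s) (K.L x s)) :
    IsNullConj (K.G (K.f x s)) (fun a => K.e a x s) (K.L x s) (K.Lbar x s) :=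
  (isConjugate_iff _).1 <|
    Classical.epsilon_spec (p := K.IsConjugate x s) ⟨_, (isConjugate_iff _).2 h.isNullConj_conjVec⟩

theorem Lbar_eq_conj (h : NullTriple (K.G (K.f x s)) (fun a => K.e a x s) (K.L x s)) :
    K.Lbar x s = K.conj x s :=
  h.isNullConj_unique (isNullConj_Lbar h) h.isNullConj_conjVec

theorem eventually_graph {P : ParamSpace → Prop} {σ : EuclideanSpace ℝ (Fin 2) → ℝ}
    (h : ∀ᶠ z in 𝓝 (x, σ x), P z) (hσ : ContinuousAt σ x) : ∀ᶠ y in 𝓝 x, P (y, σ y) :=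
  (continuousAt_id.prodMk hσ).eventually h

namespace IsNullAt

variable (h : K.IsNullAt x s)
include h

theorem eventually_triple :
    ∀ᶠ y in 𝓝 x, NullTriple (K.G (K.f y s)) (fun a => K.e a y s) (K.L y s) :=
  (eventually_graph (σ := fun _ => s) h.null continuousAt_const).mono fun _ hy => hy h.one_le

theorem isNullConj :
    IsNullConj (K.G (K.f x s)) (fun a => K.e a x s) (K.L x s) (K.conj x s) :=
  h.triple.isNullConj_conjVec

theorem smoothField_conj : SmoothField K.conj x s := by
  have hL := h.smoothField_L
  have he := h.smoothField_e
  have hb : ∀ {V W}, SmoothField V x s → SmoothField W x s → ContDiffAt ℝ ∞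
      (fun q : ParamSpace => bil (K.G (K.f q.1 q.2)) (V q.1 q.2) (W q.1 q.2)) (x, s) :=
    fun hV hW => h.contDiffAt_ip hV hW
  have hN : SmoothField (fun y τ => (K.G (K.f y τ)).mulVec (K.L y τ)) x s := fun μ =>
    (ContDiffAt.sum fun ν _ => (h.contDiffAt_G μ ν).mul (hL ν) :
      ContDiffAt ℝ ∞ (fun q : ParamSpace => ∑ ν, K.G (K.f q.1 q.2) μ ν * K.L q.1 q.2 ν) (x, s))
  have hg : ∀ a b, ContDiffAt ℝ ∞ (fun q : ParamSpace =>
      (gram2 (K.G (K.f q.1 q.2)) (fun a => K.e a q.1 q.2))⁻¹ a b) (x, s) := fun a b =>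
    contDiffAt_matrix_inv (fun a b => hb (he a) (he b)) h.triple.det_gram2_pos.ne' a b
  have hP : SmoothField (fun y τ => transversal (K.G (K.f y τ)) (fun a => K.e a y τ) (K.L y τ))
      x s := by
    intro μ
    simp only [transversal, Pi.add_apply, Finset.sum_apply, Pi.smul_apply, smul_eq_mul]
    exact (hN μ).add (ContDiffAt.sum fun a _ =>
      (ContDiffAt.sum fun b _ => (hg a b).mul (hb hN (he b))).neg.mul (he a μ))
  have hn := hb hL hN
  have hn0 := h.triple.bil_lower_ne_zero
  intro μ
  simp only [conj, conjVec, Pi.add_apply, Pi.smul_apply, smul_eq_mul]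
  exact ((contDiffAt_const.div hn hn0).mul (hP μ)).add
    (((hb hP hP).div (hn.pow 2) (pow_ne_zero 2 hn0)).mul (hL μ))

theorem covE_eq (hV : SmoothField V x s) (a : Fin 2) :
    K.covE a V x s = K.cov (dirE a) V x s := by
  funext μ
  rw [covE, cov, e_eq_dF h.f, ← pd_slice (u := fun q : ParamSpace => V q.1 q.2 μ) (hV.diff μ)]

theorem covL_eq (hV : SmoothField V x s) : K.covL V x s = K.cov dirL V x s := by
  funext μ
  rw [covL, cov, L_eq_dF h.f, ← deriv_slice (u := fun q : ParamSpace => V q.1 q.2 μ) (hV.diff μ)]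

theorem covE_Lbar (a : Fin 2) : K.covE a K.Lbar x s = K.cov (dirE a) K.conj x s := by
  rw [← h.covE_eq h.smoothField_conj]
  funext μ
  have h1 := h.eventually_triple.mono fun y hy => Lbar_eq_conj hy
  rw [covE, covE, h1.self_of_nhds,
    pd_congr a (u := fun y => K.Lbar y s μ) (h1.mono fun y hy => congrFun hy μ)]

theorem pd_ip (hV : SmoothField V x s) (hW : SmoothField W x s) (a : Fin 2) :
    pd a (fun y => K.ip y s (V y s) (W y s)) x =
      K.ip x s (K.cov (dirE a) V x s) (W x s) + K.ip x s (V x s) (K.cov (dirE a) W x s) := by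
  rw [← h.fderiv_ip _ hV hW,
    ← pd_slice (u := fun q : ParamSpace => K.ip q.1 q.2 (V q.1 q.2) (W q.1 q.2))
      ((h.contDiffAt_ip hV hW).differentiableAt (by simp))]

theorem ip_comm (V W : Fin 4 → ℝ) : K.ip x s V W = K.ip x s W V := h.triple.comm V W

theorem chi_eq (a b : Fin 2) : K.chi x s a b = K.ip x s (K.cov (dirE a) K.L x s) (K.e b x s) := by
  rw [chi, h.covE_eq h.smoothField_L]

theorem zeta_eq (a : Fin 2) :
    K.zeta x s a = (1 / 2) * K.ip x s (K.cov (dirE a) K.L x s) (K.conj x s) := by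
  rw [zeta, h.covE_eq h.smoothField_L, Lbar_eq_conj h.triple]

theorem ip_cov_L_L (a : Fin 2) : K.ip x s (K.cov (dirE a) K.L x s) (K.L x s) = 0 := by
  have h1 := h.pd_ip h.smoothField_L h.smoothField_L a
  rw [pd_congr a (u := fun y => K.ip y s (K.L y s) (K.L y s)) (w := fun _ => 0)
    (h.eventually_triple.mono fun y hy => hy.null), pd_const,
    h.ip_comm (K.L x s)] at h1
  linarith

theorem ip_L_cov_e (a b : Fin 2) :
    K.ip x s (K.L x s) (K.cov (dirE a) (K.e b) x s) = -K.chi x s a b := by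
  have h1 := h.pd_ip h.smoothField_L (h.smoothField_e b) a
  rw [pd_congr a (u := fun y => K.ip y s (K.L y s) (K.e b y s)) (w := fun _ => 0)
    (h.eventually_triple.mono fun y hy => hy.orth b), pd_const,
    ← h.chi_eq] at h1
  linarith

theorem cov_e_eq (w : ParamSpace) (a : Fin 2) : K.cov w (K.e a) x s = K.cov w (K.dF (dirE a)) x s :=
  cov_congr w (h.smooth_f.mono fun _ hq => e_eq_dF hq a)

theorem cov_L_eq (w : ParamSpace) : K.cov w K.L x s = K.cov w (K.dF dirL) x s :=
  cov_congr w (h.smooth_f.mono fun _ hq => L_eq_dF hq)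

theorem cov_e_comm (a b : Fin 2) :
    K.cov (dirE a) (K.e b) x s = K.cov (dirE b) (K.e a) x s := by
  rw [h.cov_e_eq, h.cov_e_eq, h.cov_dF_comm]

theorem cov_dirL_e (b : Fin 2) : K.cov dirL (K.e b) x s = K.cov (dirE b) K.L x s := by
  rw [h.cov_e_eq, h.cov_L_eq, h.cov_dF_comm]

theorem chi_symm (a b : Fin 2) : K.chi x s a b = K.chi x s b a := by
  have h1 := h.ip_L_cov_e a b
  have h2 := h.ip_L_cov_e b a
  rw [h.cov_e_comm] at h1
  linarith

theorem chibar_eq (a b : Fin 2) :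
    K.chibar x s a b = -K.ip x s (K.conj x s) (K.cov (dirE a) (K.e b) x s) := by
  have h1 := h.pd_ip h.smoothField_conj (h.smoothField_e b) a
  rw [pd_congr a (u := fun y => K.ip y s (K.conj y s) (K.e b y s)) (w := fun _ => 0)
    (h.eventually_triple.mono fun y hy => hy.isNullConj_conjVec.orth b), pd_const] at h1
  rw [chibar, h.covE_Lbar]
  linarith

theorem contDiffAt_mind (a b : Fin 2) :
    ContDiffAt ℝ ∞ (fun q : ParamSpace => K.mind q.2 q.1 a b) (x, s) :=
  h.contDiffAt_ip (h.smoothField_e a) (h.smoothField_e b)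

/-- The Koszul formula for the induced connection. -/
theorem ip_e_cov_e (c a b : Fin 2) : K.ip x s (K.e c x s) (K.cov (dirE a) (K.e b) x s) =
    christoffelLow (fun i p q => pd i (fun y => K.mind s y p q) x) c a b := by
  have h1 := fun i p q => h.pd_ip (h.smoothField_e p) (h.smoothField_e q) i
  simp only [christoffelLow, mind, h1, h.ip_comm _ (K.cov _ _ _ _)]
  rw [h.cov_e_comm a c, h.cov_e_comm b c, h.cov_e_comm b a]
  ring

end IsNullAt

/-! ### The change of foliation -/

/-- The coordinate expression of the change of foliation with distortion function `w`. -/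
def tilt (K : ConeCoords) (w : EuclideanSpace ℝ (Fin 2) → ℝ) : ConeCoords where
  G := K.G
  vol := K.vol
  f := fun y τ => K.f y (1 + Real.exp (w y) * (τ - 1))

section Tilt

variable {w : EuclideanSpace ℝ (Fin 2) → ℝ} {s' : ℝ}

theorem tilt_L (hs : 1 + Real.exp (w x) * (s' - 1) = s)
    (hf : ContDiffAt ℝ ∞ (fun q : ParamSpace => K.f q.1 q.2) (x, s)) :
    (K.tilt w).L x s' = Real.exp (w x) • K.L x s := by
  funext μ
  have hd : DifferentiableAt ℝ (fun τ => K.f x τ μ) s := by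
    have := (contDiffAt_f_comp hf μ).differentiableAt (by simp)
    exact this.comp s ((differentiableAt_const x).prodMk differentiableAt_id)
  have h1 : HasDerivAt (fun τ => 1 + Real.exp (w x) * (τ - 1)) (Real.exp (w x)) s' := by
    simpa using (((hasDerivAt_id s').sub_const 1).const_mul (Real.exp (w x))).const_add 1
  rw [← hs] at hd
  have h2 := (HasDerivAt.comp (h₂ := fun τ => K.f x τ μ) s' hd.hasDerivAt h1).deriv
  rw [hs] at h2
  exact h2.trans (mul_comm _ _)

theorem pd_sigma (hs : 1 + Real.exp (w x) * (s' - 1) = s) (hw : DifferentiableAt ℝ w x)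
    (a : Fin 2) : pd a (fun y => 1 + Real.exp (w y) * (s' - 1)) x = (s - 1) * pd a w x := by
  have h2 := ((hw.hasFDerivAt.exp.mul_const (s' - 1)).const_add 1).fderiv
  rw [pd, h2, ← hs]
  simp [pd]
  ring

theorem differentiableAt_sigma (hw : DifferentiableAt ℝ w x) :
    DifferentiableAt ℝ (fun y => 1 + Real.exp (w y) * (s' - 1)) x :=
  ((hw.exp).mul_const _).const_add _

theorem tilt_e (hs : 1 + Real.exp (w x) * (s' - 1) = s) (hw : DifferentiableAt ℝ w x)
    (hf : ContDiffAt ℝ ∞ (fun q : ParamSpace => K.f q.1 q.2) (x, s)) (a : Fin 2) :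
    (K.tilt w).e a x s' = K.e a x s + ((s - 1) * pd a w x) • K.L x s := by
  funext μ
  have hd := (contDiffAt_f_comp hf μ).differentiableAt (by simp)
  subst hs
  have h1 := pd_comp_graph (u := fun q : ParamSpace => K.f q.1 q.2 μ)
    (differentiableAt_sigma (s' := s') hw) hd a
  rw [pd_sigma rfl hw] at h1
  rw [e_eq_dF hf, L_eq_dF hf, ← dF_smul, ← dF_add]
  exact h1

theorem contDiffAt_tiltMap {y : EuclideanSpace ℝ (Fin 2)} (hw : ContDiffAt ℝ ∞ w y) (τ : ℝ) :
    ContDiffAt ℝ ∞ (fun q : ParamSpace => (q.1, 1 + Real.exp (w q.1) * (q.2 - 1))) (y, τ) := by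
  have h1 : ContDiffAt ℝ ∞ (fun q : ParamSpace => w q.1) (y, τ) :=
    ContDiffAt.comp (g := w) (y, τ) hw contDiffAt_fst
  exact contDiffAt_fst.prodMk (contDiffAt_const.add (h1.exp.mul (contDiffAt_snd.sub contDiffAt_const)))

theorem IsNullAt.tilt (h : K.IsNullAt x s) (hs : 1 + Real.exp (w x) * (s' - 1) = s)
    (hs' : 1 ≤ s') (hw : ∀ᶠ y in 𝓝 x, ContDiffAt ℝ ∞ w y) : (K.tilt w).IsNullAt x s' := by
  have hΦ : Tendsto (fun q : ParamSpace => (q.1, 1 + Real.exp (w q.1) * (q.2 - 1))) (𝓝 (x, s'))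
      (𝓝 (x, s)) := by
    have := (contDiffAt_tiltMap hw.self_of_nhds s').continuousAt.tendsto
    simpa only [hs] using this
  have hf := hΦ.eventually h.smooth_f
  have hw' : ∀ᶠ z : ParamSpace in 𝓝 (x, s'), ContDiffAt ℝ ∞ w z.1 :=
    (continuousAt_fst (p := ((x, s') : ParamSpace))).eventually hw
  have hfx : (K.tilt w).f x s' = K.f x s := by simp only [ConeCoords.tilt, hs]
  refine ⟨hs', ?_, ?_, ?_, ?_⟩
  · filter_upwards [hf, hw'] with z hz hwz
    exact ContDiffAt.comp (g := fun q : ParamSpace => K.f q.1 q.2) z hz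
      (contDiffAt_tiltMap hwz z.2)
  · rw [hfx]; exact h.smooth_G
  · rw [hfx]; exact h.symm_G
  · filter_upwards [hf, hw', hΦ.eventually h.null] with z hz hwz hn hz1
    have h1 : 1 ≤ 1 + Real.exp (w z.1) * (z.2 - 1) := by
      have := mul_nonneg (Real.exp_pos (w z.1)).le (sub_nonneg.2 hz1)
      linarith
    rw [tilt_L rfl hz]
    simp only [tilt_e rfl (hwz.differentiableAt (by simp)) hz]
    exact (hn h1).rotate (fun a => (1 + Real.exp (w z.1) * (z.2 - 1) - 1) * pd a w z.1)
      (Real.exp_pos _).ne'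

/-- The covector `(s - 1) dw` that relates the two foliations. -/
def shift (w : EuclideanSpace ℝ (Fin 2) → ℝ) (x : EuclideanSpace ℝ (Fin 2)) (s : ℝ) (a : Fin 2) :
    ℝ := (s - 1) * pd a w x

variable (K) in
/-- The covector `shift`, its index raised with the induced metric. -/
def shiftUp (w : EuclideanSpace ℝ (Fin 2) → ℝ) (x : EuclideanSpace ℝ (Fin 2)) (s : ℝ) (a : Fin 2) :
    ℝ := ∑ b, (K.mind s x)⁻¹ a b * shift w x s b

variable (K) in
/-- The conjugate null vector of the tilted foliation, up to normalization. -/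
def tiltConj (w : EuclideanSpace ℝ (Fin 2) → ℝ) (x : EuclideanSpace ℝ (Fin 2)) (s : ℝ) :
    Fin 4 → ℝ :=
  nullRotate (fun a => K.e a x s) (K.L x s) (K.conj x s) (shift w x s) (K.shiftUp w x s)

namespace IsNullAt

variable (h : K.IsNullAt x s)
include h

theorem mind_symm (a b : Fin 2) : K.mind s x a b = K.mind s x b a := h.ip_comm _ _

theorem mind_det_pos : 0 < (K.mind s x).det := h.triple.det_gram2_pos

theorem shift_eq (a : Fin 2) : shift w x s a =
    K.mind s x a 0 * K.shiftUp w x s 0 + K.mind s x a 1 * K.shiftUp w x s 1 := by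
  have h1 := Matrix.mul_nonsing_inv (K.mind s x) h.mind_det_pos.ne'.isUnit
  have h2 : (K.mind s x).mulVec ((K.mind s x)⁻¹.mulVec (shift w x s)) = shift w x s := by
    rw [Matrix.mulVec_mulVec, h1, Matrix.one_mulVec]
  have h3 := congrFun h2 a
  rw [← h3]
  simp [Matrix.mulVec, dotProduct, Fin.sum_univ_two, shiftUp]

variable (hs : 1 + Real.exp (w x) * (s' - 1) = s) (hs' : 1 ≤ s')
  (hw : ∀ᶠ y in 𝓝 x, ContDiffAt ℝ ∞ w y)
include hs

theorem tilt_L_eq : (K.tilt w).L x s' = Real.exp (w x) • K.L x s := tilt_L hs h.f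

include hw

theorem tilt_e_eq (a : Fin 2) : (K.tilt w).e a x s' = K.e a x s + shift w x s a • K.L x s :=
  tilt_e hs (hw.self_of_nhds.differentiableAt (by simp)) h.f a

/-- At the same point of the hypersurface the two induced metrics have equal components. -/
theorem tilt_mind : (K.tilt w).mind s' x = K.mind s x := by
  have h1 := gram2_rotate h.triple (shift w x s)
  ext a b
  have h2 := congrFun (congrFun h1 a) b
  have hfx : (K.tilt w).f x s' = K.f x s := by simp only [ConeCoords.tilt, hs]
  simp only [gram2] at h2
  simp only [mind, ip, h.tilt_e_eq hs hw, hfx]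
  exact h2

include hs'

theorem tilt_Lbar : (K.tilt w).Lbar x s' = (Real.exp (w x))⁻¹ • K.tiltConj w x s := by
  have h' := h.tilt hs hs' hw
  have h1 := isNullConj_Lbar h'.triple
  have h2 := isNullConj_nullRotate h.triple h.isNullConj (h.shift_eq (w := w))
    (Real.exp_pos (w x)).ne'
  have hfx : (K.tilt w).f x s' = K.f x s := by simp only [ConeCoords.tilt, hs]
  refine h'.triple.isNullConj_unique h1 ?_
  simp only [h.tilt_L_eq hs, h.tilt_e_eq hs hw, hfx]
  exact h2

end IsNullAt

end Tilt

end ConeCoords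

/-! ### Transformation of the connection coefficients -/

theorem matrix_inv_smul {n : ℕ} {M : Matrix (Fin n) (Fin n) ℝ} {r : ℝ} (hr : r ≠ 0)
    (hM : M.det ≠ 0) : (r • M)⁻¹ = r⁻¹ • M⁻¹ :=
  Matrix.inv_smul' (A := M) (Units.mk0 r hr) hM.isUnit

/-- The Christoffel symbols do not change when the metric is multiplied by a constant. -/
theorem christoffel_smul {n : ℕ} {G : EuclideanSpace ℝ (Fin n) → Matrix (Fin n) (Fin n) ℝ}
    {x : EuclideanSpace ℝ (Fin n)} {r : ℝ} (hr : r ≠ 0)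
    (hG : ∀ a b, DifferentiableAt ℝ (fun y => G y a b) x) (hd : (G x).det ≠ 0) (c a b : Fin n) :
    christoffel (fun y => r • G y) x c a b = christoffel G x c a b := by
  simp only [christoffel, matrix_inv_smul hr hd, Matrix.smul_apply, smul_eq_mul,
    pd_const_mul _ r (hG _ _)]
  congr 1
  exact Finset.sum_congr rfl fun d _ => by field_simp

namespace ConeCoords

variable {K : ConeCoords} {x : EuclideanSpace ℝ (Fin 2)} {s s' : ℝ}
  {V : EuclideanSpace ℝ (Fin 2) → ℝ → Fin 4 → ℝ} {w : EuclideanSpace ℝ (Fin 2) → ℝ}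

theorem ip_eq_bil (V W : Fin 4 → ℝ) : K.ip x s V W = bil (K.G (K.f x s)) V W := rfl

theorem tilt_ip (hs : 1 + Real.exp (w x) * (s' - 1) = s) (V W : Fin 4 → ℝ) :
    (K.tilt w).ip x s' V W = K.ip x s V W := by
  subst hs; rfl

/-- A function constant along the generators has the same derivative along `e_a` and `e_a + c L`. -/
theorem fderiv_comp_fst {u : EuclideanSpace ℝ (Fin 2) → ℝ} (hu : DifferentiableAt ℝ u x)
    (a : Fin 2) (c : ℝ) :
    fderiv ℝ (fun q : ParamSpace => u q.1) (x, s) (dirE a + c • dirL) = pd a u x := by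
  have h1 : HasFDerivAt (fun q : ParamSpace => u q.1) _ (x, s) :=
    HasFDerivAt.comp (g := u) (x, s) hu.hasFDerivAt hasFDerivAt_fst
  rw [h1.fderiv]
  simp [pd, dirE, dirL]

namespace IsNullAt

variable (h : K.IsNullAt x s) (hs : 1 + Real.exp (w x) * (s' - 1) = s)
  (hw : ∀ᶠ y in 𝓝 x, ContDiffAt ℝ ∞ w y)
include h hs hw

theorem eventually_f_graph : ∀ᶠ y in 𝓝 x,
    ContDiffAt ℝ ∞ (fun q : ParamSpace => K.f q.1 q.2) (y, 1 + Real.exp (w y) * (s' - 1)) := by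
  have hc := (differentiableAt_sigma (s' := s')
    (hw.self_of_nhds.differentiableAt (by simp))).continuousAt
  exact eventually_graph (by rw [hs]; exact h.smooth_f) hc

/-- Covariant differentiation along the new level sets is covariant differentiation along
`e_a + y_a L`, since these are graphs over the old parameter space. -/
theorem tilt_covE {V' : EuclideanSpace ℝ (Fin 2) → ℝ → Fin 4 → ℝ} (hV : SmoothField V x s)
    (hV' : ∀ᶠ y in 𝓝 x, V' y s' = V y (1 + Real.exp (w y) * (s' - 1))) (a : Fin 2) :
    (K.tilt w).covE a V' x s' = K.cov (dirE a + shift w x s a • dirL) V x s := by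
  have hwd := hw.self_of_nhds.differentiableAt (by simp : (∞ : WithTop ℕ∞) ≠ 0)
  have he := h.tilt_e_eq hs hw a
  rw [e_eq_dF h.f, L_eq_dF h.f, ← dF_smul, ← dF_add] at he
  have h0 : V' x s' = V x s := by rw [← hs]; exact hV'.self_of_nhds
  funext μ
  have h1 : pd a (fun y => V' y s' μ) x =
      fderiv ℝ (fun q : ParamSpace => V q.1 q.2 μ) (x, s) (dirE a + shift w x s a • dirL) := by
    rw [pd_congr a (w := fun y => V y (1 + Real.exp (w y) * (s' - 1)) μ)
      (hV'.mono fun y hy => congrFun hy μ)]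
    have hd := hV.diff μ
    rw [← hs] at hd
    have := pd_comp_graph (u := fun q : ParamSpace => V q.1 q.2 μ)
      (differentiableAt_sigma (s' := s') hwd) hd a
    rw [pd_sigma hs hwd] at this
    simp only [hs] at this
    exact this
  have hfx : (K.tilt w).f x s' = K.f x s := by simp only [ConeCoords.tilt, hs]
  rw [covE, cov, h1, he, h0, hfx]
  rfl

theorem eventually_tilt_e (b : Fin 2) : ∀ᶠ y in 𝓝 x, (K.tilt w).e b y s' =
    K.e b y (1 + Real.exp (w y) * (s' - 1))
      + (((1 + Real.exp (w y) * (s' - 1)) - 1) * pd b w y) • K.L y (1 + Real.exp (w y) * (s' - 1)) := by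
  filter_upwards [h.eventually_f_graph hs hw, hw] with y hy hwy
  exact tilt_e rfl (hwy.differentiableAt (by simp)) hy b

variable (hgeo : K.covL K.L x s = 0)
include hgeo

theorem tilt_covE_L (a : Fin 2) : (K.tilt w).covE a (K.tilt w).L x s' =
    Real.exp (w x) • (pd a w x • K.L x s + K.cov (dirE a) K.L x s) := by
  have hr : ContDiffAt ℝ ∞ (fun q : ParamSpace => Real.exp (w q.1)) (x, s) :=
    (ContDiffAt.comp (g := w) (x, s) hw.self_of_nhds contDiffAt_fst).exp
  have hwd := hw.self_of_nhds.differentiableAt (by simp : (∞ : WithTop ℕ∞) ≠ 0)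
  have hE : pd a (fun y => Real.exp (w y)) x = Real.exp (w x) * pd a w x := by
    rw [pd, hwd.hasFDerivAt.exp.fderiv]; rfl
  rw [h.tilt_covE hs hw (h.smoothField_L.smul hr)
    ((h.eventually_f_graph hs hw).mono fun y hy => tilt_L rfl hy), cov_smul _ h.smoothField_L hr,
    fderiv_comp_fst (u := fun y => Real.exp (w y)) hwd.exp, hE, cov_add_dir, cov_smul_dir,
    ← h.covL_eq h.smoothField_L, hgeo]
  module

theorem tilt_covE_e (a b : Fin 2) : (K.tilt w).covE a ((K.tilt w).e b) x s' =
    K.cov (dirE a) (K.e b) x s + shift w x s a • K.cov (dirE b) K.L x s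
      + shift w x s b • K.cov (dirE a) K.L x s
      + (shift w x s a * pd b w x + (s - 1) * pd a (pd b w) x) • K.L x s := by
  have hp : ContDiffAt ℝ ∞ (pd b w) x := contDiffAt_pd hw.self_of_nhds b
  have hp' : ContDiffAt ℝ ∞ (fun q : ParamSpace => pd b w q.1) (x, s) :=
    ContDiffAt.comp (g := pd b w) (x, s) hp contDiffAt_fst
  have hr : ContDiffAt ℝ ∞ (fun q : ParamSpace => (q.2 - 1) * pd b w q.1) (x, s) :=
    (contDiffAt_snd.sub contDiffAt_const).mul hp'
  have hd : fderiv ℝ (fun q : ParamSpace => (q.2 - 1) * pd b w q.1) (x, s)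
      (dirE a + shift w x s a • dirL) =
      shift w x s a * pd b w x + (s - 1) * pd a (pd b w) x := by
    have d1 : HasFDerivAt (fun q : ParamSpace => q.2 - 1) (ContinuousLinearMap.snd ℝ _ ℝ) (x, s) :=
      hasFDerivAt_snd.sub_const 1
    rw [fderiv_fun_mul d1.differentiableAt (hp'.differentiableAt (by simp)), d1.fderiv]
    rw [add_apply, smul_apply, smul_apply, fderiv_comp_fst (hp.differentiableAt (by simp))]
    simp [dirE, dirL]
    ring
  rw [h.tilt_covE hs hw ((h.smoothField_e b).add (h.smoothField_L.smul hr))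
    (h.eventually_tilt_e hs hw b), cov_add _ (h.smoothField_e b) (h.smoothField_L.smul hr),
    cov_smul _ h.smoothField_L hr, hd]
  simp only [cov_add_dir, cov_smul_dir, ← h.covL_eq h.smoothField_L, hgeo, h.cov_dirL_e]
  simp only [shift]
  module

theorem tilt_chi (a b : Fin 2) :
    (K.tilt w).chi x s' a b = Real.exp (w x) * K.chi x s a b := by
  have h1 := h.ip_cov_L_L a
  have h2 := h.triple.null
  have h3 := h.triple.orth b
  rw [chi, h.tilt_covE_L hs hw hgeo, h.tilt_e_eq hs hw, tilt_ip hs, h.chi_eq]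
  simp only [ip_eq_bil, bil_add_left, bil_add_right, bil_smul_left, bil_smul_right] at *
  rw [h1, h2, h3]
  ring

variable (hs' : 1 ≤ s')
include hs'

theorem tilt_zeta (a : Fin 2) :
    (K.tilt w).zeta x s' a =
      K.zeta x s a - pd a w x + ∑ b, K.shiftUp w x s b * K.chi x s a b := by
  have h1 := h.ip_cov_L_L a
  have h2 := h.triple.null
  have h3 := h.triple.orth
  have h4 := h.isNullConj.pair
  rw [zeta, h.tilt_covE_L hs hw hgeo, h.tilt_Lbar hs hs' hw, tilt_ip hs, h.zeta_eq]
  simp only [h.chi_eq, Fin.sum_univ_two, tiltConj, nullRotate]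
  simp only [ip_eq_bil, bil_add_left, bil_add_right, bil_smul_left, bil_smul_right] at *
  rw [h1, h2, h3, h3, h4]
  have := (Real.exp_pos (w x)).ne'
  field_simp
  ring

theorem tilt_chibar (a b : Fin 2) :
    (K.tilt w).chibar x s' a b = (Real.exp (w x))⁻¹ * (K.chibar x s a b
      + 2 * (s - 1) * (pd a (pd b w) x - ∑ c, christoffel (K.mind s) x c a b * pd c w x)
      + 2 * shift w x s a * pd b w x
      - 2 * (shift w x s a * K.zeta x s b + shift w x s b * K.zeta x s a)
      - 2 * ∑ c, K.shiftUp w x s c *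
          (shift w x s a * K.chi x s b c + shift w x s b * K.chi x s a c)
      + (∑ c, shift w x s c * K.shiftUp w x s c) * K.chi x s a b) := by
  have h' := h.tilt hs hs' hw
  have k1 := h.ip_cov_L_L
  have k2 := h.triple.null
  have k4 := h.isNullConj.pair
  have k5 := h.ip_L_cov_e a b
  have k6 := h.chibar_eq a b
  have k7 := h.zeta_eq
  have k8 := h.chi_eq
  have k3 := fun c => h.triple.orth c
  have k9 := fun c => h.ip_e_cov_e c a b
  have k10 := fun c => christoffel_lower (G := K.mind s) (x := x) h.mind_det_pos.ne' c a b
  have k11 : ∀ c, shift w x s c = (s - 1) * pd c w x := fun _ => rfl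
  -- the tangential part of `D_{e_a} e_b` contributes the induced connection
  have k12 : ∑ c, K.shiftUp w x s c * K.ip x s (K.e c x s) (K.cov (dirE a) (K.e b) x s)
      = (s - 1) * ∑ c, christoffel (K.mind s) x c a b * pd c w x := by
    simp only [k9, ← k10, Fin.sum_univ_two]
    have e0 := h.shift_eq (w := w) 0
    have e1 := h.shift_eq (w := w) 1
    rw [k11] at e0 e1
    rw [h.mind_symm 0 1] at e0
    rw [h.mind_symm 0 1]
    linear_combination -(christoffel (K.mind s) x 0 a b) * e0 - christoffel (K.mind s) x 1 a b * e1
  rw [h'.chibar_eq, ← Lbar_eq_conj h'.triple, h.tilt_Lbar hs hs' hw,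
    ← h'.covE_eq (h'.smoothField_e b), h.tilt_covE_e hs hw hgeo, tilt_ip hs]
  simp only [Fin.sum_univ_two, tiltConj, nullRotate] at k12 ⊢
  have c1 : ∀ c d, K.ip x s (K.e c x s) (K.cov (dirE d) K.L x s) = K.chi x s d c := fun c d => by
    rw [h.ip_comm, ← k8]
  have c2 : ∀ c, K.ip x s (K.conj x s) (K.cov (dirE c) K.L x s) = 2 * K.zeta x s c := fun c => by
    rw [h.ip_comm, k7]; ring
  have c3 : ∀ c, K.ip x s (K.L x s) (K.cov (dirE c) K.L x s) = 0 := fun c => by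
    rw [h.ip_comm, k1]
  have c4 : K.ip x s (K.conj x s) (K.L x s) = -2 := by rw [h.ip_comm]; exact k4
  have c5 : ∀ c, K.ip x s (K.e c x s) (K.L x s) = 0 := fun c => by rw [h.ip_comm]; exact k3 c
  have c6 : K.ip x s (K.L x s) (K.L x s) = 0 := k2
  simp only [ip_eq_bil] at *
  simp only [bil_add_left, bil_add_right, bil_smul_left, bil_smul_right, c1, c2, c3, c4, c5, c6, k5,
    k6]
  linear_combination -2 * (Real.exp (w x))⁻¹ * k12

end IsNullAt

end ConeCoords

/-! ### Transformation of the induced connection -/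

namespace ConeCoords

variable {K : ConeCoords} {x : EuclideanSpace ℝ (Fin 2)} {s s' : ℝ}
  {w : EuclideanSpace ℝ (Fin 2) → ℝ}

namespace IsNullAt

variable (h : K.IsNullAt x s)
include h

theorem s_pos : 0 < s := lt_of_lt_of_le one_pos h.one_le

theorem differentiableAt_mind (a b : Fin 2) : DifferentiableAt ℝ (fun y => K.mind s y a b) x := by
  have h1 : DifferentiableAt ℝ (fun y : EuclideanSpace ℝ (Fin 2) => ((y, s) : ParamSpace)) x :=
    differentiableAt_id.prodMk (differentiableAt_const s)
  have h2 : DifferentiableAt ℝ (fun q : ParamSpace => K.mind q.2 q.1 a b) (x, s) :=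
    (h.contDiffAt_mind a b).differentiableAt (by simp)
  have h3 := h2.comp x h1
  exact h3

/-- `γ` and the induced metric differ by the constant factor `s⁻²` on a level sphere. -/
theorem christoffel_gam (c a b : Fin 2) :
    christoffel (K.gam s) x c a b = christoffel (K.mind s) x c a b :=
  christoffel_smul (G := K.mind s) (r := (s ^ 2)⁻¹) (inv_ne_zero (pow_ne_zero 2 h.s_pos.ne'))
    (fun a b => h.differentiableAt_mind a b) h.mind_det_pos.ne' c a b

theorem gamInv_eq (a b : Fin 2) : K.gamInv x s a b = s ^ 2 * (K.mind s x)⁻¹ a b := by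
  have := matrix_inv_smul (M := K.mind s x) (inv_ne_zero (pow_ne_zero 2 h.s_pos.ne'))
    h.mind_det_pos.ne'
  rw [inv_inv] at this
  exact congrFun (congrFun this a) b

theorem inv_mind_symm (a b : Fin 2) : (K.mind s x)⁻¹ a b = (K.mind s x)⁻¹ b a := by
  have h1 : (K.mind s x).transpose = K.mind s x := by ext a b; exact h.mind_symm b a
  have h2 := congrFun (congrFun (Matrix.transpose_nonsing_inv (K.mind s x)) b) a
  rw [h1] at h2
  exact h2

theorem inv_mind_mul (b c : Fin 2) :
    ∑ a, (K.mind s x)⁻¹ c a * K.mind s x a b = if c = b then 1 else 0 := h.triple.inv_gram2_mul b c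

variable (hs : 1 + Real.exp (w x) * (s' - 1) = s)
  (hw : ∀ᶠ y in 𝓝 x, ContDiffAt ℝ ∞ w y) (hgeo : K.covL K.L x s = 0) (hs' : 1 ≤ s')

section

include hs hw hgeo hs'

/-- The components of the induced metric agree in both foliations, but the derivatives are taken along
different spheres; the discrepancy is the first variation `∂_s g̸ = 2 χ` times the shift. -/
theorem tilt_pd_mind (i p q : Fin 2) : pd i (fun y => (K.tilt w).mind s' y p q) x =
    pd i (fun y => K.mind s y p q) x + 2 * shift w x s i * K.chi x s p q := by
  have h' := h.tilt hs hs' hw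
  have key : ∀ p q, (K.tilt w).ip x s' ((K.tilt w).cov (dirE i) ((K.tilt w).e p) x s')
      ((K.tilt w).e q x s') = K.ip x s (K.cov (dirE i) (K.e p) x s) (K.e q x s)
        + shift w x s i * K.chi x s p q + shift w x s p * K.chi x s i q
        - shift w x s q * K.chi x s i p := by
    intro p q
    have k1 := h.ip_cov_L_L
    have k2 : K.ip x s (K.L x s) (K.L x s) = 0 := h.triple.null
    have k3 : ∀ c, K.ip x s (K.L x s) (K.e c x s) = 0 := h.triple.orth
    have k4 : K.ip x s (K.cov (dirE i) (K.e p) x s) (K.L x s) = -K.chi x s i p := by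
      rw [h.ip_comm, h.ip_L_cov_e]
    rw [← h'.covE_eq (h'.smoothField_e p), h.tilt_covE_e hs hw hgeo, h.tilt_e_eq hs hw, tilt_ip hs]
    simp only [h.chi_eq] at *
    simp only [ip_eq_bil] at *
    simp only [bil_add_left, bil_add_right, bil_smul_left, bil_smul_right, k1, k2, k3, k4]
    ring
  have h1 := h'.pd_ip (h'.smoothField_e p) (h'.smoothField_e q) i
  have h2 := h.pd_ip (h.smoothField_e p) (h.smoothField_e q) i
  rw [h'.ip_comm ((K.tilt w).e p x s'), key, key] at h1
  rw [h.ip_comm (K.e p x s)] at h2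
  have h3 : pd i (fun y => (K.tilt w).mind s' y p q) x = _ := h1
  have h4 : pd i (fun y => K.mind s y p q) x = _ := h2
  rw [h3, h4, h.chi_symm q p]
  ring

theorem tilt_christoffel (c a b : Fin 2) : christoffel ((K.tilt w).gam s') x c a b =
    christoffel (K.gam s) x c a b + ∑ d, (K.mind s x)⁻¹ c d * (shift w x s a * K.chi x s b d
      + shift w x s b * K.chi x s a d - shift w x s d * K.chi x s a b) := by
  have h' := h.tilt hs hs' hw
  rw [h'.christoffel_gam, h.christoffel_gam, christoffel_eq, christoffel_eq, h.tilt_mind hs hw,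
    ← Finset.sum_add_distrib]
  refine Finset.sum_congr rfl fun d _ => ?_
  simp only [christoffelLow, h.tilt_pd_mind hs hw hgeo hs', h.chi_symm d]
  ring

end

/-- The contribution of one tensor index to the difference of the two induced connections. -/
theorem sum_christoffel_diff (a b : Fin 2) (ψ : Fin 2 → ℝ) :
    ∑ c, (∑ d, (K.mind s x)⁻¹ c d * (shift w x s a * K.chi x s b d
      + shift w x s b * K.chi x s a d - shift w x s d * K.chi x s a b)) * ψ c =
    s⁻¹ * (1 - s⁻¹) * pd a w x * (∑ c, ∑ d, K.gamInv x s c d * K.H x s b c * ψ d)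
      + (1 - s⁻¹) * pd a w x * ψ b
      + s⁻¹ * (1 - s⁻¹) * (∑ k, ∑ d, K.gamInv x s k d *
          (pd b w x * K.H x s d a - pd d w x * K.H x s a b) * ψ k)
      + (1 - s⁻¹) * (pd b w x * ψ a
          - ∑ k, ∑ d, K.gamInv x s k d * pd d w x * K.gam s x a b * ψ k) := by
  have hs0 := h.s_pos.ne'
  have hχ : ∀ a b, K.chi x s a b = K.H x s a b + s⁻¹ * K.mind s x a b := fun a b => by
    rw [H]; ring
  have hg : K.gam s x a b = (s ^ 2)⁻¹ * K.mind s x a b := rfl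
  have hH : K.H x s 1 0 = K.H x s 0 1 := by rw [H, H, h.chi_symm 1 0, h.mind_symm 1 0]
  have k00 := h.inv_mind_mul 0 0
  have k01 := h.inv_mind_mul 1 0
  have k10 := h.inv_mind_mul 0 1
  have k11 := h.inv_mind_mul 1 1
  simp only [Fin.sum_univ_two, h.inv_mind_symm 1 0, h.mind_symm 1 0, if_true, zero_ne_one,
    one_ne_zero, if_false] at k00 k01 k10 k11
  simp only [hχ, h.gamInv_eq, Fin.sum_univ_two, shift, hg, h.inv_mind_symm 1 0]
  fin_cases a <;> fin_cases b <;>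
    simp only [Fin.mk_one, Fin.zero_eta, h.mind_symm 1 0, hH] <;> field_simp
  · linear_combination 2 * (s - 1) * pd 0 w x * (ψ 0 * k00 + ψ 1 * k10)
  · linear_combination (s - 1) * (pd 0 w x * (ψ 0 * k01 + ψ 1 * k11)
      + pd 1 w x * (ψ 0 * k00 + ψ 1 * k10))
  · linear_combination (s - 1) * (pd 0 w x * (ψ 0 * k01 + ψ 1 * k11)
      + pd 1 w x * (ψ 0 * k00 + ψ 1 * k10))
  · linear_combination 2 * (s - 1) * pd 1 w x * (ψ 0 * k01 + ψ 1 * k11)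

variable {l : ℕ} {Ψ' : (Fin l → Fin 2) → EuclideanSpace ℝ (Fin 2) → ℝ → ℝ}

include hs hw in
/-- Partial derivatives on the level sets of the two parameters. -/
theorem pd_pullback {P : ParamSpace → ℝ} (hP : DifferentiableAt ℝ P (x, s')) (a : Fin 2) :
    pd a (fun y => P (y, s')) x = pd a (fun y => P (y, 1 + Real.exp (-w y) * (s - 1))) x
      + s⁻¹ * (1 - s⁻¹) * pd a w x *
        deriv (fun t : ℝ => P (x, 1 + Real.exp (-w x) * (1 / (1 - t) - 1))) (1 - 1 / s) := by
  have hs0 := h.s_pos.ne'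
  have hexp : Real.exp (-w x) * Real.exp (w x) = 1 := by rw [← Real.exp_add]; simp
  have hinv : 1 + Real.exp (-w x) * (s - 1) = s' := by
    rw [← hs]; linear_combination (s' - 1) * hexp
  have hwd := hw.self_of_nhds.differentiableAt (by simp : (∞ : WithTop ℕ∞) ≠ 0)
  have hneg : pd a (fun y => -w y) x = -pd a w x := by simp [pd]
  have h1 := pd_comp_graph (u := P) (differentiableAt_sigma (s' := s) hwd.neg)
    (by simpa only [Pi.neg_apply, hinv] using hP) a
  have h2 := pd_sigma (w := fun y => -w y) (s' := s) hinv hwd.neg a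
  simp only [Pi.neg_apply] at h1
  rw [h2, hneg] at h1
  simp only [hinv] at h1
  have h3 : deriv (fun t : ℝ => P (x, 1 + Real.exp (-w x) * (1 / (1 - t) - 1))) (1 - 1 / s)
      = fderiv ℝ P (x, s') dirL * (Real.exp (-w x) * s ^ 2) := by
    have e1 : HasDerivAt (fun t : ℝ => 1 - t) (-1) (1 - 1 / s) := by
      simpa using (hasDerivAt_id (1 - 1 / s)).const_sub 1
    have e2 : (1 - (1 - 1 / s)) = s⁻¹ := by ring
    have e3 := (((e1.inv (by rw [e2]; exact inv_ne_zero hs0)).sub_const 1).const_mul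
      (Real.exp (-w x))).const_add 1
    rw [e2] at e3
    have e4 : HasDerivAt (fun τ => P (x, τ)) (fderiv ℝ P (x, s') dirL) s' := by
      have := hP.hasFDerivAt.comp s' ((hasFDerivAt_const x s').prodMk (hasFDerivAt_id s'))
      have := this.hasDerivAt
      simpa [dirL, Function.comp_def] using this
    have e5 : (fun t : ℝ => 1 + Real.exp (-w x) * ((1 - t)⁻¹ - 1)) (1 - 1 / s) = s' := by
      simp only [e2, inv_inv, hinv]
    have e6 := HasDerivAt.comp (h₂ := fun τ => P (x, τ)) (1 - 1 / s) (by
      rw [Pi.inv_apply, e2, inv_inv, hinv]; exact e4) e3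
    simp only [one_div] at e6 ⊢
    have := e6.deriv
    simp only [Function.comp_def, Pi.inv_apply] at this
    rw [this]
    field_simp
  rw [pd_slice hP, h1, h3, map_add, map_smul, smul_eq_mul, ← hinv]
  field_simp
  ring

include hs hw hgeo hs' in
/-- The difference of the two induced connections on horizontal tensor fields. -/
theorem tilt_nabla (hΨ : ∀ u, DifferentiableAt ℝ (fun q : ParamSpace => Ψ' u q.1 q.2) (x, s'))
    {Ψ : (Fin l → Fin 2) → EuclideanSpace ℝ (Fin 2) → ℝ → ℝ}
    (hΨ' : Ψ = fun u y σ => Ψ' u y (1 + Real.exp (-w y) * (σ - 1))) (a : Fin 2)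
    (u : Fin l → Fin 2) :
    (K.tilt w).nabla Ψ' a u x s' =
      K.nabla Ψ a u x s + s⁻¹ * (1 - s⁻¹) * pd a w x * K.nablaT Ψ u x s
      - (l : ℝ) * (1 - s⁻¹) * pd a w x * Ψ u x s
      - s⁻¹ * (1 - s⁻¹) * (∑ i, ∑ k, ∑ d, K.gamInv x s k d *
          (pd (u i) w x * K.H x s d a - pd d w x * K.H x s a (u i)) *
            Ψ (Function.update u i k) x s)
      - (1 - s⁻¹) * (∑ i, (pd (u i) w x * Ψ (Function.update u i a) x s
          - ∑ k, ∑ d, K.gamInv x s k d * pd d w x * K.gam s x a (u i) *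
              Ψ (Function.update u i k) x s)) := by
  have hexp : Real.exp (-w x) * Real.exp (w x) = 1 := by rw [← Real.exp_add]; simp
  have hinv : 1 + Real.exp (-w x) * (s - 1) = s' := by
    rw [← hs]; linear_combination (s' - 1) * hexp
  have hval : ∀ u, Ψ u x s = Ψ' u x s' := fun u => by rw [hΨ']; simp only [hinv]
  have h1 := h.pd_pullback hs hw (hΨ u) a
  simp only at h1
  have h2 := fun i => h.sum_christoffel_diff (w := w) a (u i)
    (fun c => Ψ (Function.update u i c) x s)
  have h3 : ∑ i, ∑ c, christoffel ((K.tilt w).gam s') x c a (u i) * Ψ (Function.update u i c) x s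
      = ∑ i, ∑ c, christoffel (K.gam s) x c a (u i) * Ψ (Function.update u i c) x s
        + ∑ i, ∑ c, (∑ d, (K.mind s x)⁻¹ c d * (shift w x s a * K.chi x s (u i) d
          + shift w x s (u i) * K.chi x s a d - shift w x s d * K.chi x s a (u i)))
            * Ψ (Function.update u i c) x s := by
    simp only [h.tilt_christoffel hs hw hgeo hs', add_mul, Finset.sum_add_distrib]
  have h4 : (l : ℝ) * (1 - s⁻¹) * pd a w x * Ψ u x s
      = ∑ i : Fin l, (1 - s⁻¹) * pd a w x * Ψ (Function.update u i (u i)) x s := by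
    simp; ring
  have h5 : deriv (fun t : ℝ => Ψ u x (1 / (1 - t))) (1 - 1 / s)
      = deriv (fun t : ℝ => Ψ' u x (1 + Real.exp (-w x) * (1 / (1 - t) - 1))) (1 - 1 / s) := by
    rw [hΨ']
  have h6 : pd a (fun y => Ψ u y s) x = pd a (fun y => Ψ' u y (1 + Real.exp (-w y) * (s - 1))) x := by
    rw [hΨ']
  simp only [nabla, nablaT, ← hval]
  rw [h3, h4, h5, h6, h1]
  simp only [h2, Finset.sum_add_distrib, ← Finset.mul_sum]
  ring

end IsNullAt

end ConeCoords

/-! ### Transformation of the curvature components -/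

namespace ConeCoords

variable {K : ConeCoords} {x : EuclideanSpace ℝ (Fin 2)} {s s' : ℝ}
  {w : EuclideanSpace ℝ (Fin 2) → ℝ}

variable (K) in
/-- The metric, the volume form and the curvature at the point of parameters `(x, s)`. -/
abbrev IsVacuumAt (x : EuclideanSpace ℝ (Fin 2)) (s : ℝ) : Prop :=
  IsVacuumCurvature (K.G (K.f x s)) (K.vol (K.f x s)) (riemann K.G (K.f x s))

variable (K) in
/-- The area element of the level sphere in transported coordinates, with the sign given by the
orientation. -/
def area (x : EuclideanSpace ℝ (Fin 2)) (s : ℝ) : ℝ :=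
  quad (K.vol (K.f x s)) (K.e 0 x s) (K.e 1 x s) (K.Lbar x s) (K.L x s) / 2

theorem Rm_eq (V₁ V₂ V₃ V₄ : Fin 4 → ℝ) :
    K.Rm x s V₁ V₂ V₃ V₄ = quad (riemann K.G (K.f x s)) V₁ V₂ V₃ V₄ := rfl

theorem starRm_eq (V₁ V₂ V₃ V₄ : Fin 4 → ℝ) : K.starRm x s V₁ V₂ V₃ V₄ =
    quad (starTensor (K.G (K.f x s)) (K.vol (K.f x s)) (riemann K.G (K.f x s))) V₁ V₂ V₃ V₄ := rfl

theorem tilt_Rm (hs : 1 + Real.exp (w x) * (s' - 1) = s) (V₁ V₂ V₃ V₄ : Fin 4 → ℝ) :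
    (K.tilt w).Rm x s' V₁ V₂ V₃ V₄ = quad (riemann K.G (K.f x s)) V₁ V₂ V₃ V₄ := by
  subst hs; rfl

theorem tilt_starRm (hs : 1 + Real.exp (w x) * (s' - 1) = s) (V₁ V₂ V₃ V₄ : Fin 4 → ℝ) :
    (K.tilt w).starRm x s' V₁ V₂ V₃ V₄ =
      quad (starTensor (K.G (K.f x s)) (K.vol (K.f x s)) (riemann K.G (K.f x s))) V₁ V₂ V₃ V₄ := by
  subst hs; rfl

namespace IsNullAt

variable (h : K.IsNullAt x s) (hT : K.IsVacuumAt x s)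
include h hT

theorem area_sq : K.area x s ^ 2 = (K.mind s x).det := by
  have h1 := hT.vol_sq h.triple (isNullConj_Lbar h.triple)
  have h2 : gram2 (K.G (K.f x s)) (fun a => K.e a x s) = K.mind s x := rfl
  rw [h2] at h1
  exact h1

theorem area_ne_zero : K.area x s ≠ 0 := by
  intro h0
  have h1 := h.area_sq hT
  have h2 := h.mind_det_pos
  rw [← h1, h0] at h2
  simp at h2

theorem eps_eq (a b : Fin 2) : K.eps x s a b =
    K.area x s / s ^ 2 * (!![0, 1; -1, 0] : Matrix (Fin 2) (Fin 2) ℝ) a b := by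
  have h1 : (K.gam s x).det = (K.area x s / s ^ 2) ^ 2 := by
    have : (K.gam s x).det = ((s ^ 2)⁻¹ • K.mind s x).det := rfl
    rw [this, Matrix.det_smul, Fintype.card_fin, ← h.area_sq hT]
    ring
  have h2 : ∑ μ, ∑ ν, ∑ κ, ∑ l, K.vol (K.f x s) μ ν κ l *
      K.e 0 x s μ * K.e 1 x s ν * K.Lbar x s κ * K.L x s l = 2 * K.area x s := by
    rw [area, quad]; ring
  rw [eps, h2, h1, Real.sqrt_sq_eq_abs]
  congr 1
  have hs2 : 0 < s ^ 2 := pow_pos h.s_pos 2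
  rw [abs_div, abs_of_pos hs2]
  rcases lt_or_gt_of_ne (h.area_ne_zero hT) with h3 | h3
  · rw [Real.sign_of_neg (by linarith), abs_of_neg h3]; ring
  · rw [Real.sign_of_pos (by linarith), abs_of_pos h3]; ring

theorem epsUp_eq (a b : Fin 2) : K.epsUp x s a b =
    s ^ 2 / K.area x s * (!![0, 1; -1, 0] : Matrix (Fin 2) (Fin 2) ℝ) a b := by
  have h0 := h.s_pos.ne'
  have h1 := h.area_ne_zero hT
  have h3 : (K.mind s x)⁻¹ 0 0 * (K.mind s x)⁻¹ 1 1 - (K.mind s x)⁻¹ 0 1 * (K.mind s x)⁻¹ 0 1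
      = (K.area x s ^ 2)⁻¹ := by
    rw [h.area_sq hT, ← Ring.inverse_eq_inv', ← Matrix.det_nonsing_inv, Matrix.det_fin_two,
      h.inv_mind_symm 1 0]
  simp only [epsUp, h.eps_eq hT, h.gamInv_eq, Fin.sum_univ_two]
  fin_cases a <;> fin_cases b <;> simp [h.inv_mind_symm 1 0]
  · ring
  · field_simp at h3 ⊢
    linear_combination h3
  · field_simp at h3 ⊢
    linear_combination -h3
  · ring

omit h in
theorem alpha_symm (a b : Fin 2) : K.alpha x s a b = K.alpha x s b a := hT.quad_pair _ _ _ _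

variable (hs : 1 + Real.exp (w x) * (s' - 1) = s) (hw : ∀ᶠ y in 𝓝 x, ContDiffAt ℝ ∞ w y)
include hs hw

theorem tilt_alpha (a b : Fin 2) :
    (K.tilt w).alpha x s' a b = Real.exp (w x) ^ 2 * K.alpha x s a b := by
  have h1 := hT.alpha_rotate (e := fun a => K.e a x s) (L := K.L x s) (y := shift w x s) a b
  rw [alpha, alpha, tilt_Rm hs, h.tilt_L_eq hs, h.tilt_e_eq hs hw, h.tilt_e_eq hs hw, Rm_eq]
  simp only [quad_smul₁, quad_smul₃, h1]
  ring

variable (hs' : 1 ≤ s')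
include hs'

theorem tilt_beta (a : Fin 2) : (K.tilt w).beta x s' a =
    Real.exp (w x) * (K.beta x s a + ∑ l, K.shiftUp w x s l * K.alpha x s a l) := by
  have h1 := hT.beta_rotate (e := fun a => K.e a x s) (L := K.L x s) (Lb := K.conj x s)
    (y := shift w x s) (Y := K.shiftUp w x s) a
  have h2 := (Real.exp_pos (w x)).ne'
  rw [beta, beta, tilt_Rm hs, h.tilt_L_eq hs, h.tilt_e_eq hs hw, h.tilt_Lbar hs hs' hw, Rm_eq,
    Lbar_eq_conj h.triple, tiltConj]
  simp only [quad_smul₁, quad_smul₃, quad_smul₄, h1, alpha, Rm_eq]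
  field_simp

theorem tilt_rho : (K.tilt w).rho x s' =
    K.rho x s + ∑ l, K.shiftUp w x s l * (2 * K.beta x s l
      + ∑ k, K.shiftUp w x s k * K.alpha x s l k) := by
  have h1 := hT.rho_rotate (e := fun a => K.e a x s) (L := K.L x s) (Lb := K.conj x s)
    (y := shift w x s) (Y := K.shiftUp w x s)
  have h2 := (Real.exp_pos (w x)).ne'
  rw [rho, rho, tilt_Rm hs, h.tilt_L_eq hs, h.tilt_Lbar hs hs' hw, Rm_eq,
    Lbar_eq_conj h.triple, tiltConj]
  simp only [quad_smul₁, quad_smul₂, quad_smul₃, quad_smul₄, h1, alpha, beta, Rm_eq,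
    Lbar_eq_conj h.triple, Fin.sum_univ_two]
  field_simp

theorem tilt_sigma : (K.tilt w).sigma x s' =
    K.sigma x s - (K.area x s)⁻¹ *
      (shift w x s 0 * (2 * K.beta x s 1 + ∑ k, K.shiftUp w x s k * K.alpha x s 1 k)
        - shift w x s 1 * (2 * K.beta x s 0 + ∑ k, K.shiftUp w x s k * K.alpha x s 0 k)) := by
  have h1 := hT.sigma_rotate h.triple h.isNullConj (h.shift_eq (w := w))
  have h2 := (Real.exp_pos (w x)).ne'
  rw [sigma, sigma, tilt_starRm hs, h.tilt_L_eq hs, h.tilt_Lbar hs hs' hw, starRm_eq,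
    Lbar_eq_conj h.triple, tiltConj]
  simp only [quad_smul₁, quad_smul₂, quad_smul₃, quad_smul₄, h1, alpha, beta, Rm_eq, area,
    Lbar_eq_conj h.triple, Fin.sum_univ_two]
  field_simp
  ring

theorem tilt_betabar (a : Fin 2) : (K.tilt w).betabar x s' a =
    (Real.exp (w x))⁻¹ * (K.betabar x s a + 3 * shift w x s a * K.rho x s
      - 3 * (K.area x s * (![K.shiftUp w x s 1, -K.shiftUp w x s 0] : Fin 2 → ℝ) a) * K.sigma x s
      + 4 * shift w x s a * ∑ k, K.shiftUp w x s k * K.beta x s k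
      - (∑ k, K.shiftUp w x s k * shift w x s k) * K.beta x s a
      + 2 * (![K.shiftUp w x s 1, -K.shiftUp w x s 0] : Fin 2 → ℝ) a *
          (shift w x s 0 * K.beta x s 1 - shift w x s 1 * K.beta x s 0)
      + 2 * shift w x s a * ∑ k, ∑ l, K.shiftUp w x s k * K.shiftUp w x s l * K.alpha x s k l
      - (∑ k, K.shiftUp w x s k * shift w x s k) * ∑ l, K.shiftUp w x s l * K.alpha x s a l) := by
  have h1 := hT.betabar_rotate h.triple h.isNullConj (h.shift_eq (w := w)) a
  have h2 := (Real.exp_pos (w x)).ne'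
  rw [betabar, betabar, tilt_Rm hs, h.tilt_L_eq hs, h.tilt_e_eq hs hw, h.tilt_Lbar hs hs' hw, Rm_eq,
    Lbar_eq_conj h.triple, tiltConj]
  simp only [quad_smul₁, quad_smul₃, quad_smul₄, h1, alpha, beta, rho, sigma, Rm_eq,
    starRm_eq, area, Lbar_eq_conj h.triple, Fin.sum_univ_two]
  field_simp
  ring

end IsNullAt

end ConeCoords

/-! ### Transformation of the renormalized quantities -/

namespace ConeCoords

variable {K : ConeCoords} {x : EuclideanSpace ℝ (Fin 2)} {s s' : ℝ}
  {w : EuclideanSpace ℝ (Fin 2) → ℝ}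

/-- The base of the coefficients `𝓑_k` is `e^v s' / s`. -/
theorem coefB_eq (hs : 1 + Real.exp (w x) * (s' - 1) = s) (hs0 : s ≠ 0) (k : ℤ) :
    coefB (w x) s k = (Real.exp (w x) * s' / s) ^ k := by
  rw [coefB]
  congr 1
  field_simp
  linear_combination -hs

theorem exp_nat_mul_eq (r : ℝ) : Real.exp (1 * r) = Real.exp r ∧ Real.exp (2 * r) = Real.exp r ^ 2
    ∧ Real.exp (3 * r) = Real.exp r ^ 3 ∧ Real.exp (-1 * r) = (Real.exp r)⁻¹
    ∧ Real.exp (-2 * r) = (Real.exp r ^ 2)⁻¹ ∧ Real.exp (-3 * r) = (Real.exp r ^ 3)⁻¹ := by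
  refine ⟨by rw [one_mul], ?_, ?_, by rw [neg_one_mul, Real.exp_neg], ?_, ?_⟩
  · rw [← Real.exp_nat_mul]; norm_num
  · rw [← Real.exp_nat_mul]; norm_num
  · rw [← Real.exp_nat_mul, ← Real.exp_neg]; norm_num
  · rw [← Real.exp_nat_mul, ← Real.exp_neg]; norm_num

theorem R_re (m : ℝ) : (K.R m x s).re = s ^ 3 * K.rho x s + 2 * m := by
  have h : K.R m x s = ((s ^ 3 * K.rho x s + 2 * m : ℝ) : ℂ)
      + ((s ^ 3 * K.sigma x s : ℝ) : ℂ) * Complex.I := by rw [R]; push_cast; ring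
  rw [h, Complex.add_re, Complex.re_ofReal_mul, Complex.I_re, Complex.ofReal_re]; ring

theorem R_im (m : ℝ) : (K.R m x s).im = s ^ 3 * K.sigma x s := by
  have h : K.R m x s = ((s ^ 3 * K.rho x s + 2 * m : ℝ) : ℂ)
      + ((s ^ 3 * K.sigma x s : ℝ) : ℂ) * Complex.I := by rw [R]; push_cast; ring
  rw [h, Complex.add_im, Complex.im_ofReal_mul, Complex.I_im, Complex.ofReal_im]; ring

namespace IsNullAt

variable (h : K.IsNullAt x s)

include h in
/-- Contraction of the shift with a covector, in renormalized form. -/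
theorem sum_shiftUp (φ : Fin 2 → ℝ) : ∑ l, K.shiftUp w x s l * φ l =
    (s - 1) / s ^ 2 * ∑ k, ∑ l, K.gamInv x s k l * pd k w x * φ l := by
  have h0 := h.s_pos.ne'
  simp only [Fin.sum_univ_two, shiftUp, shift, h.gamInv_eq, h.inv_mind_symm 1 0]
  field_simp
  ring

variable (hs : 1 + Real.exp (w x) * (s' - 1) = s)
  (hw : ∀ᶠ y in 𝓝 x, ContDiffAt ℝ ∞ w y) (hs' : 1 ≤ s')
include h hs hw hs'

section Connection

variable (hgeo : K.covL K.L x s = 0)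
include hgeo

theorem tilt_H (i j : Fin 2) : (K.tilt w).H x s' i j =
    Real.exp (1 * w x) * (K.H x s i j - coefC (w x) s (-1) * K.gam s x i j) := by
  have h0 := h.s_pos.ne'
  have h1 : s' ≠ 0 := (lt_of_lt_of_le one_pos hs').ne'
  have h2 := (Real.exp_pos (w x)).ne'
  rw [H, H, h.tilt_chi hs hw hgeo, h.tilt_mind hs hw, coefC, coefB_eq hs h0,
    (exp_nat_mul_eq (w x)).1, gam, zpow_neg_one]
  field_simp
  ring

theorem tilt_Z (i : Fin 2) : (K.tilt w).Z x s' i =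
    Real.exp (-1 * w x) * coefB (w x) s 1 * (K.Z x s i
      + (1 - s⁻¹) * ∑ k, ∑ l, K.gamInv x s k l * pd k w x * K.H x s i l - pd i w x) := by
  have h0 := h.s_pos.ne'
  have h2 := (Real.exp_pos (w x)).ne'
  obtain ⟨-, -, -, e4, -, -⟩ := exp_nat_mul_eq (w x)
  have hχ : ∀ a b, K.chi x s a b = K.H x s a b + s⁻¹ * K.mind s x a b := fun a b => by
    rw [H]; ring
  -- the part of `χ` that is pure trace turns `-s dv` into `-dv`
  have hk : K.shiftUp w x s 0 * K.mind s x i 0 + K.shiftUp w x s 1 * K.mind s x i 1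
      = (s - 1) * pd i w x := by
    have := h.shift_eq (w := w) i
    rw [shift] at this
    linear_combination -this
  have hY : ∀ a, K.shiftUp w x s a =
      (s - 1) * ((K.mind s x)⁻¹ a 0 * pd 0 w x + (K.mind s x)⁻¹ a 1 * pd 1 w x) := fun a => by
    simp only [shiftUp, shift, Fin.sum_univ_two]; ring
  have key : ∑ b, K.shiftUp w x s b * K.chi x s i b = (s - 1) / s ^ 2 *
      (∑ k, ∑ l, K.gamInv x s k l * pd k w x * K.H x s i l) + s⁻¹ * ((s - 1) * pd i w x) := by
    rw [← hk]
    simp only [Fin.sum_univ_two, hχ, h.gamInv_eq, hY, h.inv_mind_symm 1 0]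
    field_simp
    ring
  rw [Z, h.tilt_zeta hs hw hgeo hs', key, coefB_eq hs h0, e4, zpow_one, Z]
  field_simp
  ring

theorem tilt_Hbar (m : ℝ) (i j : Fin 2) : (K.tilt w).Hbar m x s' i j =
    coefB (w x) s (-1) * (K.Hbar m x s i j + 2 * (1 - s⁻¹) * K.hess w x s i j
        + (Real.exp (2 * w x) - 1 + s⁻¹ * Real.exp (2 * w x) * coefC (w x) s (-1)) * K.gam s x i j)
      + 2 * m * s⁻¹ * Real.exp (3 * w x) * coefB (w x) s (-1) * ((Real.exp (-3 * w x) - 1)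
        - s⁻¹ * coefC (w x) s (-1) * (1 + coefB (w x) s (-1))) * K.gam s x i j
      + coefB (w x) s (-1) * ((1 - s⁻¹) ^ 2 * (∑ k, ∑ l, K.gamInv x s k l * pd k w x * pd l w x)
          * K.gam s x i j - 2 * (1 - s⁻¹) * (1 - 2 * s⁻¹) * pd i w x * pd j w x)
      + coefB (w x) s (-1) * s⁻¹ * (1 - s⁻¹) ^ 2 * (∑ k, ∑ l, K.gamInv x s k l * pd k w x *
          (pd l w x * K.H x s i j - 2 * pd i w x * K.H x s j l - 2 * pd j w x * K.H x s i l))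
      - 2 * coefB (w x) s (-1) * s⁻¹ * (1 - s⁻¹) *
          (pd i w x * K.Z x s j + pd j w x * K.Z x s i) := by
  have h0 := h.s_pos.ne'
  have h1 : s' ≠ 0 := (lt_of_lt_of_le one_pos hs').ne'
  have h2 := (Real.exp_pos (w x)).ne'
  obtain ⟨-, e2, e3, -, -, e6⟩ := exp_nat_mul_eq (w x)
  have hχ : ∀ a b, K.chi x s a b = K.H x s a b + s⁻¹ * K.mind s x a b := fun a b => by
    rw [H]; ring
  have hk : ∀ i, K.shiftUp w x s 0 * K.mind s x i 0 + K.shiftUp w x s 1 * K.mind s x i 1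
      = (s - 1) * pd i w x := fun i => by
    have := h.shift_eq (w := w) i
    rw [shift] at this
    linear_combination -this
  have hY : ∀ a, K.shiftUp w x s a =
      (s - 1) * ((K.mind s x)⁻¹ a 0 * pd 0 w x + (K.mind s x)⁻¹ a 1 * pd 1 w x) := fun a => by
    simp only [shiftUp, shift, Fin.sum_univ_two]; ring
  have hg : K.gam s x i j = (s ^ 2)⁻¹ * K.mind s x i j := rfl
  -- contraction of `dv` with a symmetric 2-tensor slot
  have key : ∀ i, ∑ b, K.shiftUp w x s b * K.chi x s i b = (s - 1) / s ^ 2 *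
      (∑ k, ∑ l, K.gamInv x s k l * pd k w x * K.H x s i l) + s⁻¹ * ((s - 1) * pd i w x) := by
    intro i
    rw [← hk]
    simp only [Fin.sum_univ_two, hχ, h.gamInv_eq, hY, h.inv_mind_symm 1 0]
    field_simp
    ring
  have key2 : ∑ c, shift w x s c * K.shiftUp w x s c = (s - 1) ^ 2 / s ^ 2 *
      ∑ k, ∑ l, K.gamInv x s k l * pd k w x * pd l w x := by
    simp only [Fin.sum_univ_two, h.gamInv_eq, hY, h.inv_mind_symm 1 0, shift]
    field_simp
  have key3 : ∑ c, K.shiftUp w x s c * (shift w x s i * K.chi x s j c + shift w x s j * K.chi x s i c)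
      = (s - 1) * pd i w x * ∑ c, K.shiftUp w x s c * K.chi x s j c
        + (s - 1) * pd j w x * ∑ c, K.shiftUp w x s c * K.chi x s i c := by
    simp only [Fin.sum_univ_two, shift]; ring
  have key4 : ∑ k, ∑ l, K.gamInv x s k l * pd k w x *
      (pd l w x * K.H x s i j - 2 * pd i w x * K.H x s j l - 2 * pd j w x * K.H x s i l)
      = (∑ k, ∑ l, K.gamInv x s k l * pd k w x * pd l w x) * K.H x s i j
        - 2 * pd i w x * (∑ k, ∑ l, K.gamInv x s k l * pd k w x * K.H x s j l)
        - 2 * pd j w x * (∑ k, ∑ l, K.gamInv x s k l * pd k w x * K.H x s i l) := by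
    simp only [Fin.sum_univ_two]; ring
  rw [Hbar, h.tilt_chibar hs hw hgeo hs', h.tilt_mind hs hw, key4, key2, key3, key, key, hχ i j]
  simp only [Hbar, hess, h.christoffel_gam, coefC, coefB_eq hs h0, e2, e3, e6, zpow_neg_one, shift,
    Z, hg]
  generalize ∑ k, ∑ l, K.gamInv x s k l * pd k w x * pd l w x = a₁
  generalize ∑ k, ∑ l, K.gamInv x s k l * pd k w x * K.H x s i l = a₂
  generalize ∑ k, ∑ l, K.gamInv x s k l * pd k w x * K.H x s j l = a₃
  generalize ∑ c, christoffel (K.mind s) x c i j * pd c w x = a₄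
  field_simp
  ring

end Connection

section Curvature

variable (hT : K.IsVacuumAt x s)
include hT

theorem tilt_A (i j : Fin 2) : (K.tilt w).A x s' i j = coefB (w x) s 2 * K.A x s i j := by
  have h0 := h.s_pos.ne'
  rw [A, A, h.tilt_alpha hT hs hw, coefB_eq hs h0]
  norm_cast
  field_simp

theorem tilt_B (i : Fin 2) : (K.tilt w).B x s' i =
    Real.exp (-2 * w x) * coefB (w x) s 3 * (K.B x s i
      + (1 - s⁻¹) * ∑ k, ∑ l, K.gamInv x s k l * pd k w x * K.A x s i l) := by
  have h0 := h.s_pos.ne'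
  have h2 := (Real.exp_pos (w x)).ne'
  obtain ⟨-, -, -, -, e5, -⟩ := exp_nat_mul_eq (w x)
  have hA : ∑ k, ∑ l, K.gamInv x s k l * pd k w x * K.A x s i l
      = s ^ 2 * ∑ k, ∑ l, K.gamInv x s k l * pd k w x * K.alpha x s i l := by
    simp only [A, Fin.sum_univ_two]; ring
  rw [B, B, h.tilt_beta hT hs hw hs', coefB_eq hs h0, e5, h.sum_shiftUp, hA]
  norm_cast
  field_simp

theorem tilt_R (m : ℝ) : (K.tilt w).R m x s' =
    ((Real.exp (-3 * w x) * coefB (w x) s 3 : ℝ) : ℂ) * K.R m x s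
      + ((2 * m * Real.exp (-3 * w x) * (Real.exp (3 * w x) - 1 - s⁻¹ * coefC (w x) s 3) : ℝ) : ℂ)
      + ((Real.exp (-3 * w x) * coefB (w x) s 3 * s⁻¹ * (1 - s⁻¹) : ℝ) : ℂ) * ∑ i, ∑ j,
          ((K.gamInv x s i j : ℂ) - Complex.I * (K.epsUp x s i j : ℂ)) *
            ((pd i w x * (2 * K.B x s j + (1 - s⁻¹) *
              ∑ k, ∑ l, K.gamInv x s k l * pd k w x * K.A x s j l) : ℝ) : ℂ) := by
  have h0 := h.s_pos.ne'
  have h2 := (Real.exp_pos (w x)).ne'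
  have h3 := h.area_ne_zero hT
  obtain ⟨-, -, e3, -, -, e6⟩ := exp_nat_mul_eq (w x)
  have hA : ∀ j, ∑ k, ∑ l, K.gamInv x s k l * pd k w x * K.A x s j l
      = s ^ 2 * ∑ k, ∑ l, K.gamInv x s k l * pd k w x * K.alpha x s j l := fun j => by
    simp only [A, Fin.sum_univ_two]; ring
  have hb3 : coefB (w x) s 3 = (Real.exp (w x) * s' / s) ^ 3 := by
    rw [coefB_eq hs h0]; norm_cast
  apply Complex.ext
  · rw [R_re, h.tilt_rho hT hs hw hs']
    simp only [Complex.add_re, Complex.ofReal_re, R_re, Complex.re_sum,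
      Complex.mul_re, Complex.sub_re, Complex.sub_im, Complex.ofReal_im, Complex.I_re, Complex.I_im,
      Complex.mul_im, hA, h.sum_shiftUp, coefC, hb3, e3, e6, B]
    simp only [Fin.sum_univ_two]
    field_simp
    ring
  · rw [R_im, h.tilt_sigma hT hs hw hs']
    simp only [Complex.add_im, Complex.ofReal_re, R_im, Complex.im_sum,
      Complex.mul_re, Complex.sub_re, Complex.sub_im, Complex.ofReal_im, Complex.I_re, Complex.I_im,
      Complex.mul_im, hA, h.sum_shiftUp, coefC, hb3, e3, e6, B, h.epsUp_eq hT, shift]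
    simp only [Fin.sum_univ_two]
    simp
    field_simp
    ring

theorem tilt_Bbar (m : ℝ) (i : Fin 2) : (K.tilt w).Bbar x s' i =
      Real.exp (-2 * w x) * coefB (w x) s 1 * K.Bbar x s i
      + Real.exp (-2 * w x) * coefB (w x) s 1 * s⁻¹ * (1 - s⁻¹) *
          (3 * pd i w x * ((K.R m x s).re - 2 * m) - 3 * K.starGrad w x s i * (K.R m x s).im)
      + Real.exp (-2 * w x) * coefB (w x) s 1 * (s ^ 2)⁻¹ * (1 - s⁻¹) ^ 2 * (∑ j, ∑ k, pd j w x *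
          (K.gamInv x s j k * (4 * pd i w x * K.B x s k - pd k w x * K.B x s i)
            + 2 * K.epsUp x s j k * K.starGrad w x s i * K.B x s k))
      + Real.exp (-2 * w x) * coefB (w x) s 1 * (s ^ 2)⁻¹ * (1 - s⁻¹) ^ 3 *
        (∑ j, ∑ k, ∑ p, ∑ q, K.gamInv x s j p * K.gamInv x s k q * pd j w x * pd k w x *
          (2 * pd i w x * K.A x s p q - pd q w x * K.A x s i p)) := by
  have h0 := h.s_pos.ne'
  have h2 := (Real.exp_pos (w x)).ne'
  have h3 := h.area_ne_zero hT
  obtain ⟨-, -, -, -, e5, -⟩ := exp_nat_mul_eq (w x)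
  have hb1 : coefB (w x) s 1 = Real.exp (w x) * s' / s := by rw [coefB_eq hs h0, zpow_one]
  have hY : ∀ a, K.shiftUp w x s a =
      (s - 1) * ((K.mind s x)⁻¹ a 0 * pd 0 w x + (K.mind s x)⁻¹ a 1 * pd 1 w x) := fun a => by
    simp only [shiftUp, shift, Fin.sum_univ_two]; ring
  have hstar : K.starGrad w x s i = K.area x s *
      (![(K.mind s x)⁻¹ 0 1 * pd 0 w x + (K.mind s x)⁻¹ 1 1 * pd 1 w x,
        -((K.mind s x)⁻¹ 0 0 * pd 0 w x + (K.mind s x)⁻¹ 0 1 * pd 1 w x)] : Fin 2 → ℝ) i := by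
    simp only [starGrad, h.eps_eq hT, h.gamInv_eq, Fin.sum_univ_two, h.inv_mind_symm 1 0]
    fin_cases i <;> simp <;> field_simp <;> ring
  rw [Bbar, Bbar, h.tilt_betabar hT hs hw hs', R_re, R_im, hb1, e5, hstar]
  simp only [Fin.sum_univ_two, hY, h.gamInv_eq, h.epsUp_eq hT, B, A, h.inv_mind_symm 1 0,
    alpha_symm hT 1 0, shift]
  fin_cases i <;> simp [alpha_symm hT 1 0] <;> field_simp <;> ring

end Curvature

end IsNullAt

end ConeCoords

/-! ### The initial sphere -/

namespace ConeCoords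

variable {K : ConeCoords} {x : EuclideanSpace ℝ (Fin 2)} {s : ℝ}
  {w : EuclideanSpace ℝ (Fin 2) → ℝ}

namespace IsNullAt

/-- `IsNullAt` is an open condition in `x`, the parameter `s` being fixed. -/
theorem eventually_nhds (h : K.IsNullAt x s) : ∀ᶠ y in 𝓝 x, K.IsNullAt y s := by
  have hc : ContinuousAt (fun y => K.f y s) x :=
    ContinuousAt.comp (g := fun q : ParamSpace => K.f q.1 q.2) (f := fun y => (y, s))
      h.f.continuousAt (continuousAt_id.prodMk continuousAt_const)
  filter_upwards [eventually_graph (σ := fun _ => s) h.smooth_f.eventually_nhds continuousAt_const,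
    hc.eventually h.smooth_G.eventually_nhds, hc.eventually h.symm_G.eventually_nhds,
    eventually_graph (σ := fun _ => s) h.null.eventually_nhds continuousAt_const]
    with y h1 h2 h3 h4
  exact ⟨h.one_le, h1, h2, h3, h4⟩

section Slice

/-- Fields on a level sphere inherit differentiability from smooth functions on the parameter space. -/
theorem differentiableAt_slice {P : EuclideanSpace ℝ (Fin 2) → ℝ} {Q : ParamSpace → ℝ}
    (hQ : ContDiffAt ℝ ∞ Q (x, s)) (hP : ∀ᶠ y in 𝓝 x, P y = Q (y, s)) : DifferentiableAt ℝ P x :=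
  ((hQ.differentiableAt (by simp)).comp x
    (differentiableAt_id.prodMk (differentiableAt_const s))).congr_of_eventuallyEq hP

variable (h : K.IsNullAt x s)
include h

theorem differentiableAt_chi (a b : Fin 2) : DifferentiableAt ℝ (fun y => K.chi y s a b) x :=
  differentiableAt_slice
    (h.contDiffAt_ip (h.smoothField_cov h.smoothField_L (dirE a)) (h.smoothField_e b))
    (h.eventually_nhds.mono fun _ hy => hy.chi_eq a b)

theorem differentiableAt_zeta (a : Fin 2) : DifferentiableAt ℝ (fun y => K.zeta y s a) x :=
  differentiableAt_slice
    (contDiffAt_const.mul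
      (h.contDiffAt_ip (h.smoothField_cov h.smoothField_L (dirE a)) h.smoothField_conj))
    (h.eventually_nhds.mono fun _ hy => hy.zeta_eq a)

theorem differentiableAt_trH : DifferentiableAt ℝ (fun y => K.trH y s) x := by
  have hg : ∀ a b, DifferentiableAt ℝ (fun y => K.gamInv y s a b) x := fun a b =>
    differentiableAt_slice
      (contDiffAt_const.mul (contDiffAt_matrix_inv (fun i j => h.contDiffAt_mind i j)
        h.mind_det_pos.ne' a b))
      (h.eventually_nhds.mono fun _ hy => hy.gamInv_eq a b)
  exact DifferentiableAt.fun_sum fun a _ => DifferentiableAt.fun_sum fun b _ =>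
    (hg a b).mul ((h.differentiableAt_chi a b).sub ((h.differentiableAt_mind a b).const_mul _))

theorem sum_inv_mind_mul_mind : ∑ a, ∑ b, (K.mind s x)⁻¹ a b * K.mind s x a b = 2 := by
  have h1 := h.inv_mind_mul 0 0
  have h2 := h.inv_mind_mul 1 1
  simp only [Fin.sum_univ_two, if_true] at h1 h2 ⊢
  linear_combination h1 + h2 + ((K.mind s x)⁻¹ 0 1 - (K.mind s x)⁻¹ 1 0) * h.mind_symm 0 1

end Slice

variable (h : K.IsNullAt x 1) (hw : ∀ᶠ y in 𝓝 x, ContDiffAt ℝ ∞ w y)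

theorem gam_one (i j : Fin 2) : K.gam 1 x i j = K.mind 1 x i j := by simp [gam]

theorem shiftUp_one (i : Fin 2) : K.shiftUp w x 1 i = 0 := by simp [shiftUp, shift]

include h hw

theorem tilt_trH_one (hgeo : K.covL K.L x 1 = 0) :
    (K.tilt w).trH x 1 = Real.exp (w x) * K.trH x 1 + 2 * (Real.exp (w x) - 1) := by
  have hs : 1 + Real.exp (w x) * ((1 : ℝ) - 1) = 1 := by simp
  have h' := h.tilt hs le_rfl hw
  have h1 := h.sum_inv_mind_mul_mind
  simp only [trH, h'.gamInv_eq, h.gamInv_eq, H, h.tilt_chi hs hw hgeo, h.tilt_mind hs hw,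
    Fin.sum_univ_two] at h1 ⊢
  linear_combination (Real.exp (w x) - 1) * h1

theorem tilt_zeta_one (hgeo : K.covL K.L x 1 = 0) (i : Fin 2) :
    (K.tilt w).zeta x 1 i = K.zeta x 1 i - pd i w x := by
  have hs : 1 + Real.exp (w x) * ((1 : ℝ) - 1) = 1 := by simp
  rw [h.tilt_zeta hs hw hgeo le_rfl]
  simp [shiftUp_one]

theorem tilt_chibar_one (hgeo : K.covL K.L x 1 = 0) (i j : Fin 2) :
    (K.tilt w).chibar x 1 i j = (Real.exp (w x))⁻¹ * K.chibar x 1 i j := by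
  have hs : 1 + Real.exp (w x) * ((1 : ℝ) - 1) = 1 := by simp
  rw [h.tilt_chibar hs hw hgeo le_rfl]
  simp [shiftUp_one, shift]

theorem tilt_H_one (hgeo : K.covL K.L x 1 = 0) (i j : Fin 2) : (K.tilt w).H x 1 i j =
    Real.exp (1 * w x) * K.H x 1 i j + (Real.exp (1 * w x) - 1) * K.gam 1 x i j := by
  have hs : 1 + Real.exp (w x) * ((1 : ℝ) - 1) = 1 := by simp
  rw [H, H, h.tilt_chi hs hw hgeo, h.tilt_mind hs hw, gam_one, one_mul]
  ring

theorem tilt_Z_one (hgeo : K.covL K.L x 1 = 0) (i : Fin 2) :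
    (K.tilt w).Z x 1 i = K.Z x 1 i - pd i w x := by
  rw [Z, Z, h.tilt_zeta_one hw hgeo, one_mul, one_mul]

theorem tilt_Hbar_one (hgeo : K.covL K.L x 1 = 0) (m : ℝ) (i j : Fin 2) :
    (K.tilt w).Hbar m x 1 i j = Real.exp (-1 * w x) * K.Hbar m x 1 i j
      + (1 - 2 * m) * (1 - Real.exp (-1 * w x)) * K.gam 1 x i j := by
  have hs : 1 + Real.exp (w x) * ((1 : ℝ) - 1) = 1 := by simp
  rw [Hbar, Hbar, h.tilt_chibar_one hw hgeo, h.tilt_mind hs hw, gam_one, neg_one_mul, Real.exp_neg]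
  ring

theorem pd_tilt_trH_one (hgeo : ∀ᶠ y in 𝓝 x, K.covL K.L y 1 = 0) (i : Fin 2) :
    pd i (fun y => (K.tilt w).trH y 1) x = Real.exp (1 * w x) * pd i (fun y => K.trH y 1) x
      + Real.exp (1 * w x) * pd i w x * K.trH x 1 + 2 * Real.exp (1 * w x) * pd i w x := by
  have hwd := hw.self_of_nhds.differentiableAt (by simp : (∞ : WithTop ℕ∞) ≠ 0)
  have hE : pd i (fun y => Real.exp (w y)) x = Real.exp (w x) * pd i w x := by
    rw [pd, hwd.hasFDerivAt.exp.fderiv]; rfl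
  have h1 : (fun y => (K.tilt w).trH y 1) =ᶠ[𝓝 x]
      fun y => Real.exp (w y) * K.trH y 1 + 2 * (Real.exp (w y) - 1) := by
    filter_upwards [h.eventually_nhds, hw.eventually_nhds, hgeo] with y hy hwy hgy
    exact hy.tilt_trH_one hwy hgy
  have hd := h.differentiableAt_trH
  rw [pd_congr i h1, pd_add i (hwd.exp.fun_mul hd) ((hwd.exp.sub_const 1).const_mul 2),
    pd_mul i hwd.exp hd, pd_const_mul i 2 (hwd.exp.sub_const 1),
    pd_sub i hwd.exp (differentiableAt_const 1), pd_const, hE, one_mul]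
  ring

theorem tilt_traceless_one (T : Fin 2 → Fin 2 → ℝ) (r : ℝ) (i j : Fin 2) :
    (K.tilt w).traceless (fun a b => r * T a b) x 1 i j = r * K.traceless T x 1 i j := by
  have hs : 1 + Real.exp (w x) * ((1 : ℝ) - 1) = 1 := by simp
  simp only [traceless, h.tilt_mind hs hw, Fin.sum_univ_two]
  ring

/-- On the initial sphere only the divergence of the torsion sees the change of foliation: the
factors `e^v` and `e^{-v}` of the two shears cancel. -/
theorem tilt_Mass_one (hT : K.IsVacuumAt x 1) (hgeo : ∀ᶠ y in 𝓝 x, K.covL K.L y 1 = 0) (m : ℝ) :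
    (K.tilt w).Mass m x 1 = K.Mass m x 1 + K.lap w x 1 := by
  have hs : 1 + Real.exp (w x) * ((1 : ℝ) - 1) = 1 := by simp
  have h' := h.tilt hs le_rfl hw
  have hg := hgeo.self_of_nhds
  have hζ : ∀ a b, pd a (fun y => (K.tilt w).zeta y 1 b) x =
      pd a (fun y => K.zeta y 1 b) x - pd a (pd b w) x := fun a b => by
    have h1 : (fun y => (K.tilt w).zeta y 1 b) =ᶠ[𝓝 x] fun y => K.zeta y 1 b - pd b w y := by
      filter_upwards [h.eventually_nhds, hw.eventually_nhds, hgeo] with y hy hwy hgy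
      exact hy.tilt_zeta_one hwy hgy b
    rw [pd_congr a h1, pd_sub a (h.differentiableAt_zeta b)
      ((contDiffAt_pd hw.self_of_nhds b).differentiableAt (by simp))]
  have hΓ : ∀ c a b, christoffel ((K.tilt w).mind 1) x c a b = christoffel (K.mind 1) x c a b :=
    fun c a b => by
      rw [← h'.christoffel_gam, h.tilt_christoffel hs hw hg le_rfl, h.christoffel_gam]
      simp [shift]
  have hρ : (K.tilt w).rho x 1 = K.rho x 1 := by
    rw [h.tilt_rho hT hs hw le_rfl]; simp [shiftUp_one]
  have hχ : (K.tilt w).chi x 1 = fun a b => Real.exp (w x) * K.chi x 1 a b := by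
    funext a b; exact h.tilt_chi hs hw hg a b
  have hχb : (K.tilt w).chibar x 1 = fun a b => (Real.exp (w x))⁻¹ * K.chibar x 1 a b := by
    funext a b; exact h.tilt_chibar_one hw hg a b
  have hE : Real.exp (w x) * (Real.exp (w x))⁻¹ = 1 := mul_inv_cancel₀ (Real.exp_pos _).ne'
  have hsh : ∀ a b c d : Fin 2, ∀ p q : ℝ, p * q * (Real.exp (w x) * K.traceless (K.chi x 1) x 1 a b)
      * ((Real.exp (w x))⁻¹ * K.traceless (K.chibar x 1) x 1 c d) =
      p * q * K.traceless (K.chi x 1) x 1 a b * K.traceless (K.chibar x 1) x 1 c d :=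
    fun a b c d p q => by
      linear_combination (p * q * K.traceless (K.chi x 1) x 1 a b
        * K.traceless (K.chibar x 1) x 1 c d) * hE
  simp only [Mass, massAspect, hζ, hΓ, hρ, hχ, hχb, h.tilt_traceless_one hw, hsh,
    h.tilt_mind hs hw, h.tilt_zeta_one hw hg, lap, hess, h.gamInv_eq, h.christoffel_gam]
  simp only [Fin.sum_univ_two]
  ring

end IsNullAt

end ConeCoords

/-! ### Lorentzian linear algebra in a basis -/

section LorentzBasis

variable {V : Type*} [AddCommGroup V] [Module ℝ V] {g : LinearMap.BilinForm ℝ V}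
  {vol : V [⋀^Fin 4]→ₗ[ℝ] ℝ}

/-- The determinant of the metric is minus the square of the volume of the basis. -/
theorem det_metric_eq {e : Fin 4 → V} (he : IsLorentzFrame g e) (hvol : |vol e| = 1)
    (b : Module.Basis (Fin 4) ℝ V) :
    vol b ^ 2 = -(Matrix.of fun μ ν => g (b μ) (b ν)).det ∧ vol b ≠ 0 := by
  have h1 : (b.toMatrix e).transpose * (Matrix.of fun μ ν => g (b μ) (b ν)) * b.toMatrix e
      = Matrix.diagonal ![-1, 1, 1, 1] := by
    ext i j
    have h2 : g (e i) (e j) = ∑ ν, (∑ μ, b.toMatrix e μ i * g (b μ) (b ν)) * b.toMatrix e ν j := by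
      conv_lhs => rw [← b.sum_toMatrix_smul_self e i, ← b.sum_toMatrix_smul_self e j]
      simp only [map_sum, map_smul, LinearMap.sum_apply, LinearMap.smul_apply, smul_eq_mul,
        Finset.sum_mul, Finset.mul_sum]
      exact Finset.sum_congr rfl fun _ _ => Finset.sum_congr rfl fun _ _ => by ring
    simp only [Matrix.mul_apply, Matrix.transpose_apply, Matrix.of_apply]
    rw [← h2, he i j]
    fin_cases i <;> fin_cases j <;> simp [Matrix.diagonal]
  have h3 := congrArg Matrix.det h1
  rw [Matrix.det_mul, Matrix.det_mul, Matrix.det_transpose, Matrix.det_diagonal,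
    Fin.prod_univ_four] at h3
  have h4 : vol e = vol b * (b.toMatrix e).det := by
    conv_lhs => rw [vol.eq_smul_basis_det b]
    rw [AlternatingMap.smul_apply, smul_eq_mul, Module.Basis.det_apply]
  have h5 : (vol b * (b.toMatrix e).det) ^ 2 = 1 := by rw [← h4, ← sq_abs, hvol, one_pow]
  have h6 : (b.toMatrix e).det ≠ 0 := by
    intro h0; rw [h0] at h5; simp at h5
  simp at h3
  refine ⟨mul_right_cancel₀ (pow_ne_zero 2 h6) ?_, ?_⟩
  · linear_combination h5 + h3
  · intro h0; rw [h0] at h5; simp at h5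

/-- A 4-form evaluated through its components is a multiple of the determinant. -/
theorem quad_alternating (b : Module.Basis (Fin 4) ℝ V) (V₁ V₂ V₃ V₄ : Fin 4 → ℝ) :
    quad (fun μ ν κ l => vol ![b μ, b ν, b κ, b l]) V₁ V₂ V₃ V₄ =
      vol b * (Matrix.of ![V₁, V₂, V₃, V₄]).det := by
  set D := vol.compLinearMap b.equivFun.symm.toLinearMap with hD
  have hE : ∀ μ, b.equivFun.symm (Pi.single μ 1) = b μ := fun μ => by
    simp [Module.Basis.equivFun_symm_apply, Pi.single_apply]
  have hb : ∀ μ ν κ l, vol ![b μ, b ν, b κ, b l] =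
      D ![Pi.single μ 1, Pi.single ν 1, Pi.single κ 1, Pi.single l 1] := fun μ ν κ l => by
    rw [hD, AlternatingMap.compLinearMap_apply]
    congr 1
    funext i
    fin_cases i <;> simp [hE]
  have hlin : ∀ (M : Fin 4 → Fin 4 → ℝ) (i : Fin 4) (W : Fin 4 → ℝ), D (Function.update M i W) =
      ∑ μ, W μ * D (Function.update M i (Pi.single μ 1)) := fun M i W => by
    have := LinearMap.pi_apply_eq_sum_univ (D.toMultilinearMap.toLinearMap M i) W
    simp only [MultilinearMap.toLinearMap_apply, AlternatingMap.coe_multilinearMap,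
      smul_eq_mul] at this
    rw [this]
    refine Finset.sum_congr rfl fun μ _ => ?_
    congr 3
    funext j
    simp [Pi.single_apply, eq_comm]
  have h0 : ∀ A B C E : Fin 4 → ℝ, D ![A, B, C, E] = ∑ μ, A μ * D ![Pi.single μ 1, B, C, E] :=
    fun A B C E => by
      have hu : ∀ W : Fin 4 → ℝ, Function.update ![0, B, C, E] 0 W = ![W, B, C, E] := fun W => by
        funext i; fin_cases i <;> rfl
      simpa only [hu] using hlin ![0, B, C, E] 0 A
  have h1 : ∀ A B C E : Fin 4 → ℝ, D ![A, B, C, E] = ∑ μ, B μ * D ![A, Pi.single μ 1, C, E] :=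
    fun A B C E => by
      have hu : ∀ W : Fin 4 → ℝ, Function.update ![A, 0, C, E] 1 W = ![A, W, C, E] := fun W => by
        funext i; fin_cases i <;> rfl
      simpa only [hu] using hlin ![A, 0, C, E] 1 B
  have h2 : ∀ A B C E : Fin 4 → ℝ, D ![A, B, C, E] = ∑ μ, C μ * D ![A, B, Pi.single μ 1, E] :=
    fun A B C E => by
      have hu : ∀ W : Fin 4 → ℝ, Function.update ![A, B, 0, E] 2 W = ![A, B, W, E] := fun W => by
        funext i; fin_cases i <;> rfl
      simpa only [hu] using hlin ![A, B, 0, E] 2 C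
  have h3 : ∀ A B C E : Fin 4 → ℝ, D ![A, B, C, E] = ∑ μ, E μ * D ![A, B, C, Pi.single μ 1] :=
    fun A B C E => by
      have hu : ∀ W : Fin 4 → ℝ, Function.update ![A, B, C, 0] 3 W = ![A, B, C, W] := fun W => by
        funext i; fin_cases i <;> rfl
      simpa only [hu] using hlin ![A, B, C, 0] 3 E
  have h4 : D ![V₁, V₂, V₃, V₄] = vol b * (Matrix.of ![V₁, V₂, V₃, V₄]).det := by
    have h5 : D (Pi.basisFun ℝ (Fin 4)) = vol b := by
      rw [hD, AlternatingMap.compLinearMap_apply]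
      congr 1
      funext i
      simp [hE]
    conv_lhs => rw [D.eq_smul_basis_det (Pi.basisFun ℝ (Fin 4)), h5]
    rw [AlternatingMap.smul_apply, smul_eq_mul, Pi.basisFun_det_apply]
  rw [← h4, quad, h0]
  refine Finset.sum_congr rfl fun μ _ => ?_
  rw [h1, Finset.mul_sum]
  refine Finset.sum_congr rfl fun ν _ => ?_
  rw [h2, Finset.mul_sum, Finset.mul_sum]
  refine Finset.sum_congr rfl fun κ _ => ?_
  rw [h3, Finset.mul_sum, Finset.mul_sum, Finset.mul_sum]
  refine Finset.sum_congr rfl fun l _ => ?_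
  rw [hb]; ring

end LorentzBasis

/-! ### Null cones in charts -/

section Charts

variable {M : Type*} [TopologicalSpace M] [ChartedSpace (EuclideanSpace ℝ (Fin 4)) M]
  {φ : OpenPartialHomeomorph M (EuclideanSpace ℝ (Fin 4))}

/-- The coordinate vector fields of a chart form a basis of the tangent space. -/
theorem exists_basis_coordVec (hφ : φ ∈ IsManifold.maximalAtlas (𝓡 4) ∞ M)
    {y : EuclideanSpace ℝ (Fin 4)} (hy : y ∈ φ.target) :
    ∃ b : Module.Basis (Fin 4) ℝ (TangentSpace (𝓡 4) (φ.symm y)), ∀ μ, b μ = coordVec φ y μ := by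
  have hd : φ.MDifferentiable (𝓡 4) (𝓡 4) :=
    ⟨(contMDiffOn_of_mem_maximalAtlas hφ).mdifferentiableOn (by simp),
      (contMDiffOn_symm_of_mem_maximalAtlas hφ).mdifferentiableOn (by simp)⟩
  let E : EuclideanSpace ℝ (Fin 4) ≃ₗ[ℝ] TangentSpace (𝓡 4) (φ.symm y) :=
    (hd.symm.mfderiv (x := y) hy).toLinearEquiv
  refine ⟨(EuclideanSpace.basisFun (Fin 4) ℝ).toBasis.map E, fun μ => ?_⟩
  rw [Module.Basis.map_apply, OrthonormalBasis.coe_toBasis, EuclideanSpace.basisFun_apply]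
  rfl

variable [IsManifold (𝓡 4) ∞ M] (g : VacuumSpacetime M)

/-- The metric has negative determinant in coordinates, and the volume form is a square root of its
negative times the coordinate volume form. -/
theorem VacuumSpacetime.det_metricComp (hφ : φ ∈ IsManifold.maximalAtlas (𝓡 4) ∞ M)
    {y : EuclideanSpace ℝ (Fin 4)} (hy : y ∈ φ.target) :
    (metricComp g.metric φ y).det < 0 ∧ ∃ c : ℝ, c ^ 2 = -(metricComp g.metric φ y).det ∧
      ∀ V₁ V₂ V₃ V₄, quad (volComp g.vol φ y) V₁ V₂ V₃ V₄ =
        c * (Matrix.of ![V₁, V₂, V₃, V₄]).det := by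
  obtain ⟨b, hb⟩ := exists_basis_coordVec hφ hy
  obtain ⟨e, he⟩ := g.lorentz (φ.symm y)
  obtain ⟨h1, h2⟩ := det_metric_eq he (g.vol_unit _ e he) b
  have h3 : (Matrix.of fun μ ν => g.metric (φ.symm y) (b μ) (b ν)) = metricComp g.metric φ y := by
    ext μ ν; simp only [Matrix.of_apply, hb]; rfl
  rw [h3] at h1
  refine ⟨?_, g.vol (φ.symm y) b, h1, fun V₁ V₂ V₃ V₄ => ?_⟩
  · have := pow_pos (abs_pos.2 h2) 2
    rw [sq_abs] at this
    linarith
  · rw [← quad_alternating]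
    simp only [hb]
    rfl

theorem VacuumSpacetime.isVacuumCurvature (hφ : φ ∈ IsManifold.maximalAtlas (𝓡 4) ∞ M)
    {y : EuclideanSpace ℝ (Fin 4)} (hy : y ∈ φ.target) :
    IsVacuumCurvature (metricComp g.metric φ y) (volComp g.vol φ y)
      (riemann (metricComp g.metric φ) y) := by
  obtain ⟨hd, hvol⟩ := g.det_metricComp hφ hy
  have hn : ∀ᶠ z in 𝓝 y, z ∈ φ.target := φ.open_target.mem_nhds hy
  refine { isCurvatureTensor_riemann (hn.mono fun z hz a b => ?_) (.of_forall fun z a b => ?_)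
    hd.ne with ricci := fun ν l => ?_, vol := hvol }
  · exact (g.smooth φ hφ a b).contDiffAt (φ.open_target.mem_nhds hz)
  · exact g.symm _ _ _
  · rw [sum_inv_mul_riemann hd.ne]
    exact g.vacuum φ hφ y hy ν l

variable {S : Type*} [TopologicalSpace S] [ChartedSpace (EuclideanSpace ℝ (Fin 2)) S]
  {ψ : OpenPartialHomeomorph S (EuclideanSpace ℝ (Fin 2))}
  {g} {F : S × ℝ → M} (hF : IsNullCone g F) (hφ : φ ∈ IsManifold.maximalAtlas (𝓡 4) ∞ M)
  (hψ : ψ ∈ IsManifold.maximalAtlas (𝓡 2) ∞ S) {x : EuclideanSpace ℝ (Fin 2)} (hx : x ∈ ψ.target)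
  {s : ℝ} (hs : 1 ≤ s) (hp : F (ψ.symm x, s) ∈ φ.source)
include hF hφ hψ hx hs hp

namespace IsNullCone

/-- Near a point of the cone, the charts and the parametrization are defined and smooth. -/
theorem eventually_smooth : ∀ᶠ z : ParamSpace in 𝓝 (x, s), z.1 ∈ ψ.target ∧
    F (ψ.symm z.1, z.2) ∈ φ.source ∧
    ContDiffAt ℝ ∞ (fun q : ParamSpace => (coneCoords g F φ ψ).f q.1 q.2) z := by
  obtain ⟨U, hU, hU1, hFU⟩ := hF.smooth
  have hpar : ∀ z : ParamSpace, z.1 ∈ ψ.target → ContMDiffAt 𝓘(ℝ, ParamSpace)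
      ((𝓡 2).prod 𝓘(ℝ, ℝ)) ∞ (fun q : ParamSpace => (ψ.symm q.1, q.2)) z := fun z hz =>
    ((contMDiffAt_symm_of_mem_maximalAtlas hψ hz).comp z contDiffAt_fst.contMDiffAt).prodMk
      contDiffAt_snd.contMDiffAt
  have hFz : ∀ z : ParamSpace, z.1 ∈ ψ.target → (ψ.symm z.1, z.2) ∈ U → ContMDiffAt
      𝓘(ℝ, ParamSpace) (𝓡 4) ∞ (fun q : ParamSpace => F (ψ.symm q.1, q.2)) z := fun z hz hzU =>
    ContMDiffAt.comp (g := F) z (hFU.contMDiffAt (hU.mem_nhds hzU)) (hpar z hz)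
  have hxU : (ψ.symm x, s) ∈ U := hU1 ⟨Set.mem_univ _, hs⟩
  have h1 : ∀ᶠ z : ParamSpace in 𝓝 (x, s), z.1 ∈ ψ.target :=
    (continuousAt_fst (p := ((x, s) : ParamSpace))).eventually (ψ.open_target.mem_nhds hx)
  filter_upwards [h1, (hpar (x, s) hx).continuousAt.eventually (hU.mem_nhds hxU),
    (hFz (x, s) hx hxU).continuousAt.eventually (φ.open_source.mem_nhds hp)] with z hz hzU hzp
  exact ⟨hz, hzp, (ContMDiffAt.comp (g := φ) z (contMDiffAt_of_mem_maximalAtlas hφ hzp)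
    (hFz z hz hzU)).contDiffAt⟩

/-- The local hypotheses hold at every point of a null cone that is covered by the charts. -/
theorem isNullAt : (coneCoords g F φ ψ).IsNullAt x s := by
  have hn : ∀ᶠ y in 𝓝 ((coneCoords g F φ ψ).f x s), y ∈ φ.target :=
    φ.open_target.mem_nhds (φ.map_source hp)
  have h0 := hF.eventually_smooth hφ hψ hx hs hp
  refine ⟨hs, h0.mono fun z hz => hz.2.2, hn.mono fun y hy a b =>
    (g.smooth φ hφ a b).contDiffAt (φ.open_target.mem_nhds hy),
    .of_forall fun y a b => g.symm _ _ _, h0.mono fun z hz hz1 => ?_⟩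
  obtain ⟨h1, h2⟩ := hF.null φ hφ ψ hψ z.1 hz.1 z.2 hz1 hz.2.1
  exact ⟨fun _ _ => g.symm _ _ _, (g.det_metricComp hφ (φ.map_source hz.2.1)).1, h1, h2,
    hF.immersion φ hφ ψ hψ z.1 hz.1 z.2 hz1 hz.2.1⟩

theorem eventually_covL : ∀ᶠ y in 𝓝 x,
    (coneCoords g F φ ψ).covL (coneCoords g F φ ψ).L y s = 0 :=
  (ConeCoords.eventually_graph (σ := fun _ => s) (hF.eventually_smooth hφ hψ hx hs hp)
    continuousAt_const).mono fun y hy => hF.geodesic φ hφ ψ hψ y hy.1 s hs hy.2.1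

end IsNullCone

end Charts

end

theorem proposition2p2
    {M : Type*} [TopologicalSpace M] [ChartedSpace (EuclideanSpace ℝ (Fin 4)) M]
    [IsManifold (𝓡 4) ∞ M]
    {S : Type*} [TopologicalSpace S] [ChartedSpace (EuclideanSpace ℝ (Fin 2)) S]
    [IsManifold (𝓡 2) ∞ S]
    (g : VacuumSpacetime M) (F : S × ℝ → M) (hF : IsNullCone g F) (m : ℝ)
    (v : S → ℝ) (hv : ContMDiff (𝓡 2) 𝓘(ℝ, ℝ) ∞ v)
    (φ : OpenPartialHomeomorph M (EuclideanSpace ℝ (Fin 4)))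
    (hφ : φ ∈ IsManifold.maximalAtlas (𝓡 4) ∞ M)
    (ψ : OpenPartialHomeomorph S (EuclideanSpace ℝ (Fin 2)))
    (hψ : ψ ∈ IsManifold.maximalAtlas (𝓡 2) ∞ S)
    (x : EuclideanSpace ℝ (Fin 2)) (hx : x ∈ ψ.target) (s : ℝ) (hs : 1 ≤ s)
    (hp : F (ψ.symm x, s) ∈ φ.source) :
    let K : ConeCoords := coneCoords g F φ ψ
    let K' : ConeCoords := coneCoords g (refoliate F v) φ ψ
    let vc : EuclideanSpace ℝ (Fin 2) → ℝ := fun y => v (ψ.symm y)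
    let s' : ℝ := 1 + Real.exp (-vc x) * (s - 1)
    let t : ℝ := 1 - s⁻¹
    let E : ℝ → ℝ := fun k => Real.exp (k * vc x)
    let dv : Fin 2 → ℝ := fun a => pd a vc x
    let γ : Fin 2 → Fin 2 → ℝ := K.gam s x
    let γi : Fin 2 → Fin 2 → ℝ := K.gamInv x s
    let ε : Fin 2 → Fin 2 → ℝ := K.epsUp x s
    let H : Fin 2 → Fin 2 → ℝ := K.H x s
    let Z : Fin 2 → ℝ := K.Z x s
    let A : Fin 2 → Fin 2 → ℝ := K.A x s
    let B : Fin 2 → ℝ := K.B x s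
    let R : ℂ := K.R m x s
    let b : ℤ → ℝ := coefB (vc x) s
    let c : ℤ → ℝ := coefC (vc x) s
    -- the Ricci coefficients
    (∀ i j, K'.H x s' i j = E 1 * (H i j - c (-1) * γ i j)) ∧
    (∀ i, K'.Z x s' i = E (-1) * b 1 * (Z i + t * ∑ k, ∑ l, γi k l * dv k * H i l - dv i)) ∧
    (∀ i j, K'.Hbar m x s' i j =
      b (-1) * (K.Hbar m x s i j + 2 * t * K.hess vc x s i j
        + (E 2 - 1 + s⁻¹ * E 2 * c (-1)) * γ i j)
      + 2 * m * s⁻¹ * E 3 * b (-1) * ((E (-3) - 1) - s⁻¹ * c (-1) * (1 + b (-1))) * γ i j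
      + b (-1) * (t ^ 2 * (∑ k, ∑ l, γi k l * dv k * dv l) * γ i j
        - 2 * t * (1 - 2 * s⁻¹) * dv i * dv j)
      + b (-1) * s⁻¹ * t ^ 2 * (∑ k, ∑ l, γi k l * dv k *
          (dv l * H i j - 2 * dv i * H j l - 2 * dv j * H i l))
      - 2 * b (-1) * s⁻¹ * t * (dv i * Z j + dv j * Z i)) ∧
    -- the curvature components
    (∀ i j, K'.A x s' i j = b 2 * A i j) ∧
    (∀ i, K'.B x s' i = E (-2) * b 3 * (B i + t * ∑ k, ∑ l, γi k l * dv k * A i l)) ∧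
    (K'.R m x s' = ((E (-3) * b 3 : ℝ) : ℂ) * R
      + ((2 * m * E (-3) * (E 3 - 1 - s⁻¹ * c 3) : ℝ) : ℂ)
      + ((E (-3) * b 3 * s⁻¹ * t : ℝ) : ℂ) * ∑ i, ∑ j,
          ((γi i j : ℂ) - Complex.I * (ε i j : ℂ)) *
            ((dv i * (2 * B j + t * ∑ k, ∑ l, γi k l * dv k * A j l) : ℝ) : ℂ)) ∧
    (∀ i, K'.Bbar x s' i =
      E (-2) * b 1 * K.Bbar x s i
      + E (-2) * b 1 * s⁻¹ * t *
          (3 * dv i * (R.re - 2 * m) - 3 * K.starGrad vc x s i * R.im)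
      + E (-2) * b 1 * (s ^ 2)⁻¹ * t ^ 2 * (∑ j, ∑ k, dv j *
          (γi j k * (4 * dv i * B k - dv k * B i) + 2 * ε j k * K.starGrad vc x s i * B k))
      + E (-2) * b 1 * (s ^ 2)⁻¹ * t ^ 3 * (∑ j, ∑ k, ∑ p, ∑ q, γi j p * γi k q * dv j * dv k *
          (2 * dv i * A p q - dv q * A i p))) ∧
    -- the connection, on an arbitrary `t'`-horizontal covariant tensor field `Ψ'` of rank `l`
    (∀ (l : ℕ) (Ψ' : (Fin l → Fin 2) → EuclideanSpace ℝ (Fin 2) → ℝ → ℝ),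
      (∀ u, DifferentiableAt ℝ
        (fun q : EuclideanSpace ℝ (Fin 2) × ℝ => Ψ' u q.1 q.2) (x, s')) →
      -- the induced `t`-horizontal field
      let Ψ : (Fin l → Fin 2) → EuclideanSpace ℝ (Fin 2) → ℝ → ℝ :=
        fun u y σ => Ψ' u y (1 + Real.exp (-vc y) * (σ - 1))
      ∀ (a : Fin 2) (u : Fin l → Fin 2), K'.nabla Ψ' a u x s' =
        K.nabla Ψ a u x s + s⁻¹ * t * dv a * K.nablaT Ψ u x s - (l : ℝ) * t * dv a * Ψ u x s
        - s⁻¹ * t * (∑ i, ∑ k, ∑ d, γi k d * (dv (u i) * H d a - dv d * H a (u i)) *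
            Ψ (Function.update u i k) x s)
        - t * (∑ i, (dv (u i) * Ψ (Function.update u i a) x s
            - ∑ k, ∑ d, γi k d * dv d * γ a (u i) * Ψ (Function.update u i k) x s))) ∧
    -- the initial sphere
    (s = 1 →
      (∀ i j, K'.H x 1 i j = E 1 * H i j + (E 1 - 1) * γ i j) ∧
      (∀ i, K'.Z x 1 i = Z i - dv i) ∧
      (∀ i j, K'.Hbar m x 1 i j =
        E (-1) * K.Hbar m x 1 i j + (1 - 2 * m) * (1 - E (-1)) * γ i j) ∧
      (∀ i, pd i (fun y => K'.trH y 1) x =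
        E 1 * pd i (fun y => K.trH y 1) x + E 1 * dv i * K.trH x 1 + 2 * E 1 * dv i) ∧
      K'.Mass m x 1 = K.Mass m x 1 + K.lap vc x 1) := by
  intro K K' vc s' t E dv γ γi ε H Z A B R b c
  have h : K.IsNullAt x s := hF.isNullAt hφ hψ hx hs hp
  have hgeo := hF.eventually_covL hφ hψ hx hs hp
  have hT : K.IsVacuumAt x s := g.isVacuumCurvature hφ (φ.map_source hp)
  have hw : ∀ᶠ y in 𝓝 x, ContDiffAt ℝ ∞ vc y := by
    filter_upwards [ψ.open_target.mem_nhds hx] with y hy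
    exact (hv.contMDiffAt.comp y (contMDiffAt_symm_of_mem_maximalAtlas hψ hy)).contDiffAt
  have hg : K.covL K.L x s = 0 := hgeo.self_of_nhds
  have hE : Real.exp (vc x) * Real.exp (-vc x) = 1 := by rw [← Real.exp_add]; simp
  have hss : 1 + Real.exp (vc x) * (s' - 1) = s := by linear_combination (s - 1) * hE
  have hs' : 1 ≤ s' := by
    have := mul_nonneg (Real.exp_pos (-vc x)).le (sub_nonneg.2 hs)
    simp only [s']; linarith
  have hK : K' = K.tilt vc := rfl
  rw [hK]
  refine ⟨h.tilt_H hss hw hs' hg, h.tilt_Z hss hw hs' hg, h.tilt_Hbar hss hw hs' hg m,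
    h.tilt_A hss hw hs' hT, h.tilt_B hss hw hs' hT, h.tilt_R hss hw hs' hT m,
    h.tilt_Bbar hss hw hs' hT m, fun l Ψ' hΨ => h.tilt_nabla hss hw hg hs' hΨ rfl, ?_⟩
  rintro rfl
  exact ⟨h.tilt_H_one hw hg, h.tilt_Z_one hw hg, h.tilt_Hbar_one hw hg m,
    h.pd_tilt_trH_one hw hgeo, h.tilt_Mass_one hw hT hgeo m⟩
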